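/- **Setting.** Let $G$ be a real Lie group with Lie algebra $\mathfrak g=T_1G$, let $H\subset G$ be a closed subgroup with Lie algebra $\mathfrak h$, let $M=H\backslash G$ be the homogeneous space of right cosets $Hg$, and let $\pi:G\to M$ be the projection. For $a\in\mathfrak g$ let $a^L,a^R$ be the left- and right-invariant vector fields on $G$ with value $a$ at $1$, and let $a^\pi=\pi_*(a^L)$; for $\alpha\in\mathfrak g^*$ let $\alpha^R$ be the right-invariant 1-form with value $\alpha$ at $1$. Fix a symmetric tensor $C=\sum C^{ab}\,a_a\otimes a_b\in\mathrm{Sym}^2\mathfrak g$. Let $C^L$ be the corresponding left-invariant tensor on $G$, regarded as a bundle map $T^*G\to TG$, and let $C^\pi=\pi_*(C^L)=\sum C^{ab}\,a_a^\pi\otimes a_b^\pi$, a contravariant symmetric tensor on $M$. Let $M_0\subset M$ be the open set where $C^\pi$ is nondegenerate, with the pseudo-Riemannian metric inverse to $C^\pi$. Let $\mathfrak f$ be a Lie algebra with $\mathfrak h\subsetneq\mathfrak f\subsetneq\mathfrak g$. Assume that $H$ is connected or, more generally, that $\Lambda=\pi_*(\mathfrak f^R)$ is a well-defined distribution on $M$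 (i.e. $\pi_*(\mathfrak f^R_q)$ depends only on $\pi(q)$). Let $\Lambda^\perp$ be the distribution on $M_0$ of tangent vectors perpendicular to $\Lambda$. An integral curve of $\Lambda^\perp$ is a $C^1$ curve in $M_0$, defined on an open interval, with nowhere vanishing velocity that lies in $\Lambda^\perp$. A change of parameter is a $C^1$ diffeomorphism between open intervals; geodesics are those of the Levi-Civita connection of $M_0$. **Statement.** If $\dim M=2$, then $\Lambda^\perp$ has rank $1$. Whenever $\Lambda^\perp$ has rank $1$ on $M_0$, the following hold. 1. Every integral curve of $\Lambda^\perp$ becomes a geodesic of $M_0$ after a change of parameter. 2. Let $\alpha\in\mathfrak g^*$ be any nonzero functional that vanishes on $\mathfrak f$. (a) If $\gamma$ is an integral curve of the vector field $C^L\alpha^R$ on an open interval and $\pi\circ\gamma$ lies in $M_0$, then $\pi\circ\gamma$ is a geodesic of $M_0$ and an integral curve of $\Lambda^\perp$. (b) Conversely, if $c:J\to M_0$ is an integral curve of $\Lambda^\perp$, $t_0\in J$ and $q\in\pi^{-1}(c(t_0))$, then after a change of parameter $s:J'\to J$ one has $c\circ s=\pi\circ\gamma$ for an integral curve $\gamma:J'\to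 G$ of $C^L\alpha^R$ that passes through $q$ at the parameter value corresponding to $t_0$. -/

import Mathlib

open scoped Manifold ContDiff TensorProduct Topology

namespace LieAlgebraicMetric

/-- A smooth real Lie group has the regularity that Mathlib asks for in the construction of the
Lie bracket on its tangent space at `1`. -/
instance lieGroup_minSmoothness {E : Type*} [NormedAddCommGroup E] [NormedSpace ℝ E]
    {G : Type*} [TopologicalSpace G] [ChartedSpace E G] [Group G] [LieGroup 𝓘(ℝ, E) ∞ G] :
    LieGroup 𝓘(ℝ, E) (minSmoothness ℝ 3) G :=
  LieGroup.of_le (n := ∞) (by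
    rw [minSmoothness_of_isRCLikeNormedField]
    exact WithTop.coe_le_coe.2 le_top)

noncomputable section

/-! ### Algebra: contraction with a tensor in `𝔤 ⊗ 𝔤` -/

/-- The map `V* → V`, `α ↦ (α ⊗ id) C`, defined by a tensor `C ∈ V ⊗ V`; if
`C = ∑ C^{ab} v_a ⊗ v_b`, it is `α ↦ ∑ C^{ab} α(v_a) v_b`. -/
def contract {V : Type*} [AddCommGroup V] [Module ℝ V] (C : V ⊗[ℝ] V) :
    Module.Dual ℝ V →ₗ[ℝ] V where
  toFun α := TensorProduct.lid ℝ V (LinearMap.rTensor V α C)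
  map_add' α β := by simp [LinearMap.rTensor_add]
  map_smul' r α := by simp [LinearMap.rTensor_smul]

section LieGroup

variable {E : Type*} [NormedAddCommGroup E] [NormedSpace ℝ E]
  {G : Type*} [TopologicalSpace G] [ChartedSpace E G] [Group G]

/-! ### Invariant fields and forms on the group -/

/-- The differential at `1` of left translation by `q`; the left-invariant vector field of
`a ∈ 𝔤` is `aᴸ_q = leftTr q a`. -/
def leftTr (q : G) : GroupLieAlgebra 𝓘(ℝ, E) G →ₗ[ℝ] TangentSpace 𝓘(ℝ, E) q where
  toFun a := mulInvariantVectorField a q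
  map_add' a b := by rw [mulInvariantVectorField_add]; rfl
  map_smul' r a := by rw [mulInvariantVectorField_smul]; rfl

/-- The right-invariant vector field `aᴿ` of `a ∈ 𝔤`: the image of `a` under the differential at
`1` of right translation by `q`. -/
def rightField (a : GroupLieAlgebra 𝓘(ℝ, E) G) (q : G) : TangentSpace 𝓘(ℝ, E) q :=
  mfderiv 𝓘(ℝ, E) 𝓘(ℝ, E) (fun x : G ↦ x * q) 1 a

/-- The differential at `q` of right translation by `q⁻¹`, as a map `T_q G → T_1 G = 𝔤`. -/
def rightTrInv (q : G) : TangentSpace 𝓘(ℝ, E) q →ₗ[ℝ] GroupLieAlgebra 𝓘(ℝ, E) G :=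
  (mfderiv 𝓘(ℝ, E) 𝓘(ℝ, E) (fun x : G ↦ x * q⁻¹) q).toLinearMap

/-- The right-invariant 1-form `αᴿ` of `α ∈ 𝔤*`. -/
def rightForm (α : Module.Dual ℝ (GroupLieAlgebra 𝓘(ℝ, E) G)) (q : G) :
    Module.Dual ℝ (TangentSpace 𝓘(ℝ, E) q) :=
  α ∘ₗ rightTrInv q

/-- The left-invariant bivector field `Cᴸ`, as a bundle map `T*G → TG`. -/
def leftTensor (C : GroupLieAlgebra 𝓘(ℝ, E) G ⊗[ℝ] GroupLieAlgebra 𝓘(ℝ, E) G) (q : G) :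
    Module.Dual ℝ (TangentSpace 𝓘(ℝ, E) q) →ₗ[ℝ] TangentSpace 𝓘(ℝ, E) q :=
  leftTr q ∘ₗ contract C ∘ₗ (leftTr q).dualMap

/-- The vector field `Cᴸ αᴿ` on `G`. -/
def horizontalField (C : GroupLieAlgebra 𝓘(ℝ, E) G ⊗[ℝ] GroupLieAlgebra 𝓘(ℝ, E) G)
    (α : Module.Dual ℝ (GroupLieAlgebra 𝓘(ℝ, E) G)) (q : G) : TangentSpace 𝓘(ℝ, E) q :=
  leftTensor C q (rightForm α q)

/-! ### The homogeneous space of right cosets -/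

/-- The space `M` of right cosets `H g`, with the quotient topology. -/
abbrev RightCosets (H : Subgroup G) : Type _ := Quotient (QuotientGroup.rightRel H)

/-- The canonical projection `π : G → M`, `g ↦ H g`. -/
def proj (H : Subgroup G) (g : G) : RightCosets H := Quotient.mk _ g

/-- The orbit map of a point `p = H x` of `M` under the right action of `G`:
`g ↦ p · g = H x g`. -/
def orbitMap {H : Subgroup G} (p : RightCosets H) (g : G) : RightCosets H :=
  Quotient.map (sa := QuotientGroup.rightRel H) (sb := QuotientGroup.rightRel H)
    (fun x : G ↦ x * g)
    (fun x y h ↦ by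
      have h' : y * x⁻¹ ∈ H := QuotientGroup.rightRel_apply.mp h
      exact QuotientGroup.rightRel_apply.mpr (by simpa [mul_assoc] using h')) p

variable {F : Type*} [NormedAddCommGroup F] [NormedSpace ℝ F]

/-- The atlas on the space of right cosets makes it the quotient manifold of `G`: the canonical
projection is a smooth submersion. Such a smooth structure is unique. -/
structure IsQuotientManifold (H : Subgroup G) [ChartedSpace F (RightCosets H)] : Prop where
  isManifold : IsManifold 𝓘(ℝ, F) ∞ (RightCosets H)
  contMDiff_proj : ContMDiff 𝓘(ℝ, E) 𝓘(ℝ, F) ∞ (proj H)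
  surjective_mfderiv_proj :
    ∀ q : G, Function.Surjective (mfderiv 𝓘(ℝ, E) 𝓘(ℝ, F) (proj H) q)

variable {H : Subgroup G} [ChartedSpace F (RightCosets H)]

variable (F H) in
/-- The Lie algebra `𝔥` of `H`, as a subspace of `𝔤 = T_1 G`: the tangent space at `1` of the
fibre `H = π⁻¹(π 1)` of the submersion `π`. -/
def isotropyAlgebra : Submodule ℝ (GroupLieAlgebra 𝓘(ℝ, E) G) :=
  LinearMap.ker (mfderiv 𝓘(ℝ, E) 𝓘(ℝ, F) (proj H) 1).toLinearMap

/-- The value at `p` of the vector fields `a^π` (`a ∈ 𝔤`) on `M`, the infinitesimal generators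
of the right action of `G`; one has `a^π (π q) = π_* (aᴸ_q)`. -/
def generator (p : RightCosets H) :
    GroupLieAlgebra 𝓘(ℝ, E) G →ₗ[ℝ] TangentSpace 𝓘(ℝ, F) p where
  toFun a := mfderiv 𝓘(ℝ, E) 𝓘(ℝ, F) (orbitMap p) 1 a
  map_add' a b := map_add (mfderiv 𝓘(ℝ, E) 𝓘(ℝ, F) (orbitMap p) 1) a b
  map_smul' r a := map_smul (mfderiv 𝓘(ℝ, E) 𝓘(ℝ, F) (orbitMap p) 1) r a

/-! ### The Lie algebraic metric -/

/-- The contravariant tensor `C^π = ∑ C^{ab} a^π ⊗ b^π` at `p ∈ M`, as a map `T*_p M → T_p M`. -/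
def cometric (C : GroupLieAlgebra 𝓘(ℝ, E) G ⊗[ℝ] GroupLieAlgebra 𝓘(ℝ, E) G)
    (p : RightCosets H) :
    Module.Dual ℝ (TangentSpace 𝓘(ℝ, F) p) →ₗ[ℝ] TangentSpace 𝓘(ℝ, F) p :=
  generator p ∘ₗ contract C ∘ₗ (generator p).dualMap

variable (F H) in
/-- The set `M₀ ⊆ M` of the points at which `C^π` is nondegenerate. -/
def nondegenerateLocus (C : GroupLieAlgebra 𝓘(ℝ, E) G ⊗[ℝ] GroupLieAlgebra 𝓘(ℝ, E) G) :
    Set (RightCosets H) :=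
  {p | Function.Bijective (cometric (F := F) C p)}

open Classical in
/-- The (covariant) pseudo-Riemannian metric on `M₀`, the inverse of `C^π` (and `0` off `M₀`). -/
def metric (C : GroupLieAlgebra 𝓘(ℝ, E) G ⊗[ℝ] GroupLieAlgebra 𝓘(ℝ, E) G)
    (p : RightCosets H) : LinearMap.BilinForm ℝ (TangentSpace 𝓘(ℝ, F) p) :=
  if h : Function.Bijective (cometric (F := F) C p) then
    (LinearEquiv.ofBijective (cometric (F := F) C p) h).symm.toLinearMap
  else 0

/-! ### Geodesics of the Levi-Civita connection, in charts -/

/-- The components of the metric in the chart around `p₀`: its value at the point of `M` with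
coordinates `y`, on the tangent vectors with components `u`, `v`. -/
def chartMetric (C : GroupLieAlgebra 𝓘(ℝ, E) G ⊗[ℝ] GroupLieAlgebra 𝓘(ℝ, E) G)
    (p₀ : RightCosets H) (y u v : F) : ℝ :=
  metric C ((extChartAt 𝓘(ℝ, F) p₀).symm y)
    (mfderiv 𝓘(ℝ, F) 𝓘(ℝ, F) (extChartAt 𝓘(ℝ, F) p₀).symm y u)
    (mfderiv 𝓘(ℝ, F) 𝓘(ℝ, F) (extChartAt 𝓘(ℝ, F) p₀).symm y v)

/-- The Christoffel symbol of the first kind in the chart around `p₀`,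
`Γ(u, v; w) = ½ (∂_u g(v, w) + ∂_v g(u, w) - ∂_w g(u, v))`. -/
def christoffel (C : GroupLieAlgebra 𝓘(ℝ, E) G ⊗[ℝ] GroupLieAlgebra 𝓘(ℝ, E) G)
    (p₀ : RightCosets H) (y u v w : F) : ℝ :=
  (fderiv ℝ (fun z ↦ chartMetric C p₀ z v w) y u
    + fderiv ℝ (fun z ↦ chartMetric C p₀ z u w) y v
    - fderiv ℝ (fun z ↦ chartMetric C p₀ z u v) y w) / 2

/-- `c` is a geodesic of the pseudo-Riemannian manifold `M₀` on the open set `J` of times: a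
smooth curve in `M₀` whose expression `x` in every chart satisfies
`g(x'', w) + Γ(x', x'; w) = 0` for all `w`. -/
structure IsGeodesicOn (C : GroupLieAlgebra 𝓘(ℝ, E) G ⊗[ℝ] GroupLieAlgebra 𝓘(ℝ, E) G)
    (c : ℝ → RightCosets H) (J : Set ℝ) : Prop where
  mapsTo : Set.MapsTo c J (nondegenerateLocus F H C)
  contMDiffOn : ContMDiffOn 𝓘(ℝ, ℝ) 𝓘(ℝ, F) ∞ c J
  equation : ∀ t ∈ J, ∀ p₀ : RightCosets H, c t ∈ (chartAt F p₀).source →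
    ∀ x : ℝ → F, x = extChartAt 𝓘(ℝ, F) p₀ ∘ c →
    ∀ w : F, chartMetric C p₀ (x t) (deriv (deriv x) t) w
      + christoffel C p₀ (x t) (deriv x t) (deriv x t) w = 0

/-! ### The invariant distribution and its perpendicular distribution -/

/-- The distribution `Λ = π_*(𝔣ᴿ)` on `M`. -/
def invariantDistribution (𝔣 : Submodule ℝ (GroupLieAlgebra 𝓘(ℝ, E) G))
    (p : RightCosets H) : Submodule ℝ (TangentSpace 𝓘(ℝ, F) p) :=
  Submodule.span ℝ {v | ∃ q : G, ∃ a ∈ 𝔣,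
    tangentMap 𝓘(ℝ, E) 𝓘(ℝ, F) (proj H) ⟨q, rightField a q⟩ = ⟨p, v⟩}

variable (F H) in
/-- The distribution `𝔣ᴿ` on `G` projects to a well-defined distribution on `M`: the image
`π_*(𝔣ᴿ_q)` depends only on the point `π q`. -/
def IsProjectable (𝔣 : Submodule ℝ (GroupLieAlgebra 𝓘(ℝ, E) G)) : Prop :=
  ∀ q q' : G, proj H q = proj H q' → ∀ a ∈ 𝔣, ∃ a' ∈ 𝔣,
    tangentMap 𝓘(ℝ, E) 𝓘(ℝ, F) (proj H) ⟨q, rightField a q⟩ =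
      tangentMap 𝓘(ℝ, E) 𝓘(ℝ, F) (proj H) ⟨q', rightField a' q'⟩

/-- The perpendicular distribution `Λ^⊥` on `M₀`. -/
def perpDistribution (C : GroupLieAlgebra 𝓘(ℝ, E) G ⊗[ℝ] GroupLieAlgebra 𝓘(ℝ, E) G)
    (𝔣 : Submodule ℝ (GroupLieAlgebra 𝓘(ℝ, E) G)) (p : RightCosets H) :
    Submodule ℝ (TangentSpace 𝓘(ℝ, F) p) where
  carrier := {v | ∀ w ∈ invariantDistribution 𝔣 p, metric C p v w = 0}
  add_mem' {u v} hu hv w hw := by simp [hu w hw, hv w hw]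
  zero_mem' w _ := by simp
  smul_mem' r v hv w hw := by simp [hv w hw]

/-- `c` is an integral curve of `Λ^⊥` on the open set `J` of times: a regular curve in `M₀` (of
class `C¹`, with nowhere vanishing velocity) whose velocity lies in `Λ^⊥`. -/
structure IsIntegralCurvePerp
    (C : GroupLieAlgebra 𝓘(ℝ, E) G ⊗[ℝ] GroupLieAlgebra 𝓘(ℝ, E) G)
    (𝔣 : Submodule ℝ (GroupLieAlgebra 𝓘(ℝ, E) G)) (c : ℝ → RightCosets H) (J : Set ℝ) :
    Prop where
  mapsTo : Set.MapsTo c J (nondegenerateLocus F H C)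
  contMDiffOn : ContMDiffOn 𝓘(ℝ, ℝ) 𝓘(ℝ, F) 1 c J
  velocity_ne_zero : ∀ t ∈ J, mfderiv 𝓘(ℝ, ℝ) 𝓘(ℝ, F) c t (1 : ℝ) ≠ 0
  velocity_mem : ∀ t ∈ J,
    mfderiv 𝓘(ℝ, ℝ) 𝓘(ℝ, F) c t (1 : ℝ) ∈ perpDistribution C 𝔣 (c t)

end LieGroup

/-- Open intervals of the real line, bounded or not. -/
def IsOpenInterval (J : Set ℝ) : Prop := IsOpen J ∧ J.OrdConnected

/-- `s` is a regular change of parameter from the open interval `J'` onto the open interval `J`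
(a `C¹` diffeomorphism). -/
structure IsReparametrization (s : ℝ → ℝ) (J' J : Set ℝ) : Prop where
  isOpenInterval : IsOpenInterval J'
  bijOn : Set.BijOn s J' J
  contDiffOn : ContDiffOn ℝ 1 s J'
  deriv_ne_zero : ∀ t ∈ J', deriv s t ≠ 0

end

end LieAlgebraicMetric

open LieAlgebraicMetric

/-!
# Geodesics of Lie algebraic metrics

Let `α` be a functional on `𝔤` that vanishes on `𝔥`. At every `q ∈ G` the form `αᴿ` vanishes on the
vertical vectors, so it is the pull-back of a covector `ξ` on `M`, and `π_*(Cᴸ αᴿ) = C^π ξ`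
(`exists_momentum`, `cometric_momentum`). Along an integral curve `γ` of `Cᴸ αᴿ`, the covector `ξ`
is thus the momentum of the curve `π ∘ γ`, that is, its velocity lowered by the metric.

*Geodesics.* By definition of `ξ`, its pairing with the projection of a right-invariant field `bᴿ`
is the constant `α b`; this plays the role of Noether's theorem, although `bᴿ` need not project to
a vector field on `M`. The maps `x ↦ H x q` and `y ↦ H q y` are both restrictions of
`(x, y) ↦ H x q y`, so symmetry of second derivatives exchanges the derivative of the projected
right-invariant vector along `γ` for the derivative of the generators of the action, of which `C^π`
is built (`mfderiv_rightCoord_leftTr`). Differentiating `ξ(π_* bᴿ) = α b` therefore gives Hamilton's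
equation for `ξ`, and hence the geodesic equation in every chart (`geodesic_equation_of_hamilton`,
`geodesic_equation`). If `α` vanishes on `𝔣`, then `ξ` annihilates `Λ = π_*(𝔣ᴿ)`, so that the
velocity lies in `Λ^⊥` (`mfderiv_proj_horizontalField_mem`).

*Lifts.* Suppose that `Λ^⊥` has rank one. The covectors `ξ` at two points of the same fibre are then
proportional, since both correspond to vectors of `Λ^⊥`. It follows that `α ∘ Ad h = χ α` for
`h ∈ H`, and left translation by `h` preserves `Cᴸ αᴿ` up to the constant factor `χ`
(`exists_horizontalField_mul`). An integral curve of `Λ^⊥` is locally tangent to the projection of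
`Cᴸ αᴿ`, so by uniqueness for ordinary differential equations it is locally a reparametrized
projection of an integral curve of `Cᴸ αᴿ`. In its own parameter it has local lifts with velocity
proportional to `Cᴸ αᴿ`. These can be translated by elements of `H`, and they are determined by
their value at one time (`IsLiftOn.mul_left`, `IsLiftOn.eqOn`); so they glue to a lift over the
whole interval (`exists_isLiftOn`). A primitive of the factor of proportionality is the required
parameter (`exists_primitive_inverse`, `exists_integralCurve_lift`).

*The hypotheses on `Λ`.* If `H` is connected, then `Ad H` preserves `𝔣`: along a curve in `H`
starting at `1`, the class of `Ad (h t) a` modulo `𝔣`, with `a ∈ 𝔣`, solves a homogeneous linear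
differential equation, because the differential of `Ad` is the bracket (`vectorDiff_Ad_one`,
`Ad_mem_of_curve`); the stabilizer of `𝔣` in `H` is therefore an open subgroup. Hence `Λ` is well
defined (`isProjectable_of_isConnected`). Finally `Λ` is neither zero nor all of `TM`, since
`𝔥 < 𝔣 < 𝔤`, and its rank and that of `Λ^⊥` add up to `dim M`; on a surface both are one
(`finrank_perpDistribution_of_finrank_eq_two`).
-/

namespace LieAlgebraicMetric

/-! ### Calculus on normed spaces -/

/-- The coefficient of a continuous multiple of a nonvanishing continuous vector is continuous. -/
theorem continuousAt_coeff_of_smul {X F : Type*} [TopologicalSpace X] [NormedAddCommGroup F]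
    [NormedSpace ℝ F] {v w : X → F} {μ : X → ℝ} {t : X} (hv : ContinuousAt v t)
    (hw : ContinuousAt w t) (h0 : w t ≠ 0) (h : ∀ᶠ s in 𝓝 t, v s = μ s • w s) :
    ContinuousAt μ t := by
  obtain ⟨ℓ, hℓ⟩ : ∃ ℓ : F →L[ℝ] ℝ, ℓ (w t) ≠ 0 := by
    obtain ⟨ℓ, -, hℓ⟩ := exists_dual_vector ℝ (w t) (norm_ne_zero_iff.mpr h0)
    exact ⟨ℓ, by rw [hℓ]; simpa using h0⟩
  have hw' : ContinuousAt (fun s ↦ ℓ (w s)) t := ℓ.continuous.continuousAt.comp hw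
  have hv' : ContinuousAt (fun s ↦ ℓ (v s)) t := ℓ.continuous.continuousAt.comp hv
  refine (hv'.div hw' hℓ).congr ?_
  filter_upwards [h, hw'.eventually_ne hℓ] with s hs hs'
  simp only [Pi.div_apply]
  rw [hs, map_smul, smul_eq_mul, mul_div_assoc, div_self hs', mul_one]

/-- A nonvanishing continuous density on an open interval is the derivative of a diffeomorphism
onto another open interval. -/
theorem exists_primitive_inverse {J : Set ℝ} (hJ : IsOpenInterval J) {lam : ℝ → ℝ}
    (hc : ContinuousOn lam J) (h0 : ∀ t ∈ J, lam t ≠ 0) {t₀ : ℝ} (ht₀ : t₀ ∈ J) :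
    ∃ (r s : ℝ → ℝ) (J' : Set ℝ), IsOpenInterval J' ∧ Set.BijOn s J' J ∧ r t₀ = 0 ∧
      Set.MapsTo r J J' ∧ (∀ t ∈ J, s (r t) = t) ∧ (∀ u ∈ J', r (s u) = u) ∧
      (∀ t ∈ J, HasDerivAt r (lam t) t) ∧ (∀ u ∈ J', HasDerivAt s (lam (s u))⁻¹ u) := by
  obtain ⟨hJo, hJc⟩ := hJ
  set r : ℝ → ℝ := fun t ↦ ∫ u in t₀..t, lam u with hr
  have hsub : ∀ t ∈ J, Set.uIcc t₀ t ⊆ J := fun t ht ↦ hJc.uIcc_subset ht₀ ht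
  have hderiv : ∀ t ∈ J, HasDerivAt r (lam t) t := by
    intro t ht
    refine intervalIntegral.integral_hasDerivAt_right
      ((hc.mono (hsub t ht)).intervalIntegrable) ?_ (hc.continuousAt (hJo.mem_nhds ht))
    exact hc.stronglyMeasurableAtFilter hJo t ht
  have hstrict : ∀ t ∈ J, HasStrictDerivAt r (lam t) t := by
    intro t ht
    refine hasStrictDerivAt_of_hasDerivAt_of_continuousAt ?_ (hc.continuousAt (hJo.mem_nhds ht))
    filter_upwards [hJo.mem_nhds ht] with u hu using hderiv u hu
  have hrc : ContinuousOn r J := fun t ht ↦ (hderiv t ht).continuousAt.continuousWithinAt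
  have hlt : ∀ a ∈ J, ∀ b ∈ J, a < b → r a ≠ r b := by
    intro a ha b hb hab hEq
    have hI : Set.Icc a b ⊆ J := hJc.out ha hb
    obtain ⟨c, hcI, hc0⟩ := exists_hasDerivAt_eq_zero hab (hrc.mono hI) hEq
      (fun x hx ↦ hderiv x (hI (Set.Ioo_subset_Icc_self hx)))
    exact h0 c (hI (Set.Ioo_subset_Icc_self hcI)) hc0
  have hinj : Set.InjOn r J := by
    intro a ha b hb hab
    rcases lt_trichotomy a b with h | h | h
    · exact absurd hab (hlt a ha b hb h)
    · exact h
    · exact absurd hab.symm (hlt b hb a ha h)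
  set s := Function.invFunOn r J
  have hsr : ∀ t ∈ J, s (r t) = t := fun t ht ↦ hinj.leftInvOn_invFunOn ht
  have himage : ∀ t ∈ J, ∀ U ∈ 𝓝 t, r '' U ∈ 𝓝 (r t) := by
    intro t ht U hU
    rw [← (hstrict t ht).map_nhds_eq (h0 t ht)]
    exact Filter.image_mem_map hU
  have hopen : IsOpen (r '' J) := by
    rw [isOpen_iff_mem_nhds]
    rintro _ ⟨t, ht, rfl⟩
    exact himage t ht J (hJo.mem_nhds ht)
  refine ⟨r, s, r '' J, ⟨hopen, ?_⟩, ?_, by simp [hr], Set.mapsTo_image r J, hsr, ?_, hderiv, ?_⟩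
  · exact (hJc.isPreconnected.image r hrc).ordConnected
  · refine ⟨?_, ?_, ?_⟩
    · rintro _ ⟨t, ht, rfl⟩
      rwa [hsr t ht]
    · rintro _ ⟨t, ht, rfl⟩ _ ⟨t', ht', rfl⟩ h
      rw [hsr t ht, hsr t' ht'] at h
      rw [h]
    · exact fun t ht ↦ ⟨r t, ⟨t, ht, rfl⟩, hsr t ht⟩
  · rintro _ ⟨t, ht, rfl⟩
    rw [hsr t ht]
  · rintro _ ⟨t, ht, rfl⟩
    have hsc : ContinuousAt s (r t) := by
      intro U hU
      rw [hsr t ht] at hU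
      rw [Filter.mem_map]
      filter_upwards [himage t ht (U ∩ J) (Filter.inter_mem hU (hJo.mem_nhds ht))]
      rintro _ ⟨u, ⟨huU, huJ⟩, rfl⟩
      change s (r u) ∈ U
      rwa [hsr u huJ]
    refine HasDerivAt.of_local_left_inverse (f := r) hsc ?_ (by rw [hsr t ht]; exact h0 t ht) ?_
    · rw [hsr t ht]; exact hderiv t ht
    · filter_upwards [hopen.mem_nhds ⟨t, ht, rfl⟩]
      rintro _ ⟨u, hu, rfl⟩
      rw [hsr u hu]

section Hamilton

variable {E F : Type*} [NormedAddCommGroup E] [NormedSpace ℝ E] [NormedAddCommGroup F]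
  [NormedSpace ℝ F]

/-- The cometric `Φ ∘ T ∘ Φ*` on `F` that `Φ : E → F` induces from a cometric `T : E* → E`. -/
noncomputable def pushCometric (T : (E →L[ℝ] ℝ) →L[ℝ] E) (Φ : E →L[ℝ] F) : (F →L[ℝ] ℝ) →L[ℝ] F :=
  Φ ∘L T ∘L (ContinuousLinearMap.compL ℝ E F ℝ).flip Φ

@[simp]
theorem pushCometric_apply (T : (E →L[ℝ] ℝ) →L[ℝ] E) (Φ : E →L[ℝ] F) (β : F →L[ℝ] ℝ) :
    pushCometric T Φ β = Φ (T (β ∘L Φ)) := by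
  simp [pushCometric]

theorem contDiff_pushCometric (T : (E →L[ℝ] ℝ) →L[ℝ] E) {n : WithTop ℕ∞} :
    ContDiff ℝ n (pushCometric (F := F) T) := by
  unfold pushCometric
  fun_prop

theorem pushCometric_symm {T : (E →L[ℝ] ℝ) →L[ℝ] E} (hT : ∀ β γ : E →L[ℝ] ℝ, β (T γ) = γ (T β))
    (Φ : E →L[ℝ] F) (β γ : F →L[ℝ] ℝ) : β (pushCometric T Φ γ) = γ (pushCometric T Φ β) := by
  simpa using hT (β ∘L Φ) (γ ∘L Φ)

/-- In coordinates, Hamilton's equations for the Hamiltonian `½ ξ (Φ (T (Φ* ξ)))` imply the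
geodesic equation of the inverse metric `g`. The left-hand side of the geodesic equation is
`ξ' + ½ ∂ (ξ (Φ (T (Φ* ξ))))`, the derivative of the Hamiltonian being at fixed `ξ`. -/
theorem geodesic_equation_of_hamilton [CompleteSpace F] {T : (E →L[ℝ] ℝ) →L[ℝ] E}
    (hT : ∀ β γ : E →L[ℝ] ℝ, β (T γ) = γ (T β)) {Φ : F → E →L[ℝ] F} {x : ℝ → F} {t : ℝ}
    {Φ' : F →L[ℝ] E →L[ℝ] F} (hΦ : HasFDerivAt Φ Φ' (x t))
    (hbij : ∀ᶠ y in 𝓝 (x t), (pushCometric T (Φ y)).IsInvertible)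
    {g : F → F → F → ℝ}
    (hg : ∀ᶠ y in 𝓝 (x t), ∀ β v, g y (pushCometric T (Φ y) β) v = β v)
    {ξ : ℝ → F →L[ℝ] ℝ} (hx : ∀ᶠ τ in 𝓝 t, HasDerivAt x (pushCometric T (Φ (x τ)) (ξ τ)) τ)
    (hx2 : DifferentiableAt ℝ (deriv x) t)
    (hξ : ∀ ξ', HasDerivAt ξ ξ' t → ∀ w, ξ' w = -ξ t (Φ' w (T (ξ t ∘L Φ (x t))))) (w : F) :
    g (x t) (deriv (deriv x) t) w
      + (fderiv ℝ (fun z ↦ g z (deriv x t) w) (x t) (deriv x t)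
        + fderiv ℝ (fun z ↦ g z (deriv x t) w) (x t) (deriv x t)
        - fderiv ℝ (fun z ↦ g z (deriv x t) (deriv x t)) (x t) w) / 2 = 0 := by
  set K : F → (F →L[ℝ] ℝ) →L[ℝ] F := fun y ↦ pushCometric T (Φ y) with hK
  set A : F → F →L[ℝ] F →L[ℝ] ℝ := fun y ↦ (K y).inverse with hA
  have hKd : HasFDerivAt K (fderiv ℝ K (x t)) (x t) :=
    (((contDiff_pushCometric T (n := 1)).differentiable one_ne_zero _).comp _
      hΦ.differentiableAt).hasFDerivAt
  have hAd : HasFDerivAt A (fderiv ℝ A (x t)) (x t) := by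
    obtain ⟨e, he⟩ := hbij.self_of_nhds
    have : DifferentiableAt ℝ ContinuousLinearMap.inverse (K (x t)) := by
      rw [hK]; dsimp only; rw [← he]
      exact (contDiffAt_map_inverse (n := 1) e).differentiableAt one_ne_zero
    have h2 : DifferentiableAt ℝ A (x t) := DifferentiableAt.comp (𝕜 := ℝ) (f := K)
      (g := ContinuousLinearMap.inverse) (x t) this hKd.differentiableAt
    exact h2.hasFDerivAt
  have hAK : ∀ᶠ y in 𝓝 (x t), ∀ β, A y (K y β) = β := by
    filter_upwards [hbij] with y hy β
    exact congrArg (fun f ↦ f β) hy.inverse_comp_self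
  have hKA : ∀ᶠ y in 𝓝 (x t), ∀ u, K y (A y u) = u := by
    filter_upwards [hbij] with y hy u
    exact congrArg (fun f ↦ f u) hy.self_comp_inverse
  have hgA : ∀ᶠ y in 𝓝 (x t), ∀ u v, g y u v = A y u v := by
    filter_upwards [hg, hKA] with y hy hy' u v
    conv_lhs => rw [← hy' u]
    exact hy _ _
  have hxt := hx.self_of_nhds.continuousAt
  have hsymm : ∀ y (β γ : F →L[ℝ] ℝ), β (K y γ) = γ (K y β) := fun y ↦ pushCometric_symm hT _
  have hdx : deriv x t = K (x t) (ξ t) := hx.self_of_nhds.deriv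
  -- `ξ` is the image of the velocity under the metric
  have hξA : ξ =ᶠ[𝓝 t] fun τ ↦ A (x τ) (deriv x τ) := by
    filter_upwards [hx, hxt.eventually hAK] with τ h1 h2
    rw [h1.deriv, h2]
  have hder : HasDerivAt ξ
      (fderiv ℝ A (x t) (deriv x t) (deriv x t) + A (x t) (deriv (deriv x) t)) t := by
    refine HasDerivAt.congr_of_eventuallyEq ?_ hξA
    have h1 : HasDerivAt (fun τ ↦ A (x τ)) (fderiv ℝ A (x t) (deriv x t)) t := by
      rw [hdx]
      exact HasFDerivAt.comp_hasDerivAt (l := A) (f := x) t hAd hx.self_of_nhds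
    exact h1.clm_apply hx2.hasDerivAt
  have hfd : ∀ u v w : F, fderiv ℝ (fun z ↦ g z u v) (x t) w = fderiv ℝ A (x t) w u v := by
    intro u v w
    have : (fun z ↦ g z u v) =ᶠ[𝓝 (x t)] fun z ↦ A z u v := by
      filter_upwards [hgA] with y hy using hy u v
    rw [this.fderiv_eq]
    have h2 := ((hAd.clm_apply (hasFDerivAt_const u (x t))).clm_apply
      (hasFDerivAt_const v (x t))).fderiv
    rw [h2]
    simp
  -- differentiate `K y (A y u) = u`
  have hKA' : ∀ u w : F, fderiv ℝ K (x t) w (A (x t) u) + K (x t) (fderiv ℝ A (x t) w u) = 0 := by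
    intro u w
    have h1 := hKd.clm_apply (hAd.clm_apply (hasFDerivAt_const u (x t)))
    have h2 : (fun y ↦ K y (A y u)) =ᶠ[𝓝 (x t)] fun _ ↦ u := by
      filter_upwards [hKA] with y hy using hy u
    have h3 := h1.unique ((hasFDerivAt_const u (x t)).congr_of_eventuallyEq h2)
    have h4 := congrArg (fun f ↦ f w) h3
    simpa [add_comm] using h4
  have hK' : ∀ w : F, ∀ β : F →L[ℝ] ℝ,
      β (fderiv ℝ K (x t) w β) = 2 * β (Φ' w (T (β ∘L Φ (x t)))) := by
    intro w β
    have h1 : HasFDerivAt (fun y ↦ β (K y β)) (β ∘L ((fderiv ℝ K (x t)).flip β)) (x t) := by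
      have := (β.hasFDerivAt (x := K (x t) β)).comp (x t)
        (hKd.clm_apply (hasFDerivAt_const β (x t)))
      refine this.congr_fderiv ?_
      ext w
      simp
    have hβΦ : HasFDerivAt (fun y ↦ β ∘L Φ y) ((ContinuousLinearMap.compL ℝ E F ℝ β) ∘L Φ') (x t) :=
      ((ContinuousLinearMap.compL ℝ E F ℝ β).hasFDerivAt).comp (x t) hΦ
    have h2 : HasFDerivAt (fun y ↦ (β ∘L Φ y) (T (β ∘L Φ y)))
        _ (x t) := hβΦ.clm_apply ((T.hasFDerivAt).comp (x t) hβΦ)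
    have h3 : (fun y ↦ β (K y β)) = fun y ↦ (β ∘L Φ y) (T (β ∘L Φ y)) := by
      funext y
      simp [hK]
    rw [h3] at h1
    have h4 := congrArg (fun f ↦ f w) (h1.unique h2)
    have h5 := hT (β ∘L Φ (x t)) (β ∘L Φ' w)
    simp at h4 h5
    rw [h4, h5]
    ring
  have hξt : A (x t) (deriv x t) = ξ t := by rw [hdx]; exact hAK.self_of_nhds _
  have e1 := hξ _ hder w
  -- the derivative of the metric is minus the derivative of the cometric
  have e2 : fderiv ℝ A (x t) w (deriv x t) (deriv x t)
      = - (2 * ξ t (Φ' w (T (ξ t ∘L Φ (x t))))) := by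
    have h1 := congrArg (ξ t) (hKA' (deriv x t) w)
    rw [map_add, map_zero, hξt, hK', hsymm, ← hdx] at h1
    linarith
  rw [hgA.self_of_nhds, hfd, hfd, e2]
  simp only [add_apply] at e1
  linarith

end Hamilton

/-! ### Derivatives in charts -/

section Charts

variable {E F F' : Type*} [NormedAddCommGroup E] [NormedSpace ℝ E] [NormedAddCommGroup F]
  [NormedSpace ℝ F] [NormedAddCommGroup F'] [NormedSpace ℝ F']
  {P M N : Type*} [TopologicalSpace P] [ChartedSpace E P] [TopologicalSpace M] [ChartedSpace F M]
  [TopologicalSpace N] [ChartedSpace F' N]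

theorem mfderiv_extChartAt_symm_self [IsManifold 𝓘(ℝ, E) 1 P] (x : P) :
    HasMFDerivAt 𝓘(ℝ, E) 𝓘(ℝ, E) (extChartAt 𝓘(ℝ, E) x).symm (extChartAt 𝓘(ℝ, E) x x)
      (ContinuousLinearMap.id ℝ E) := by
  have h := mfderivWithin_range_extChartAt_symm (I := 𝓘(ℝ, E)) (x := x)
  have h1 := mdifferentiableWithinAt_extChartAt_symm (I := 𝓘(ℝ, E))
    (mem_extChartAt_target (I := 𝓘(ℝ, E)) x)
  have h2 := h1.hasMFDerivWithinAt
  rw [h] at h2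
  simp only [modelWithCornersSelf_coe, Set.range_id] at h2
  exact hasMFDerivWithinAt_univ.mp h2

variable (F) in
/-- The differential at `p` of the preferred chart around `p₀`, as a map onto the model space. -/
noncomputable def chartDiff (p₀ p : M) : TangentSpace 𝓘(ℝ, F) p →L[ℝ] F :=
  mfderiv 𝓘(ℝ, F) 𝓘(ℝ, F) (extChartAt 𝓘(ℝ, F) p₀) p

/-- The differential of a vector-valued function, as a map onto the vector space. -/
noncomputable def vectorDiff (f : P → F) (x : P) : TangentSpace 𝓘(ℝ, E) x →L[ℝ] F :=
  mfderiv 𝓘(ℝ, E) 𝓘(ℝ, F) f x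

/-- The derivative at a point of a map, read in the preferred chart at this point and in some
chart of the target. -/
theorem fderiv_extChartAt_comp [IsManifold 𝓘(ℝ, E) 1 P] [IsManifold 𝓘(ℝ, F) 1 M] {f : P → M}
    {x : P} (hf : MDifferentiableAt 𝓘(ℝ, E) 𝓘(ℝ, F) f x) {p₀ : M}
    (hx : f x ∈ (chartAt F p₀).source) (a : E) :
    fderiv ℝ (fun z ↦ extChartAt 𝓘(ℝ, F) p₀ (f ((extChartAt 𝓘(ℝ, E) x).symm z)))
      (extChartAt 𝓘(ℝ, E) x x) a =
    chartDiff F p₀ (f x) (mfderiv 𝓘(ℝ, E) 𝓘(ℝ, F) f x a) := by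
  have h1 := mfderiv_extChartAt_symm_self (E := E) x
  have h2 : HasMFDerivAt 𝓘(ℝ, E) 𝓘(ℝ, F) (extChartAt 𝓘(ℝ, F) p₀ ∘ f) x _ :=
    (mdifferentiableAt_extChartAt hx).hasMFDerivAt.comp x hf.hasMFDerivAt
  have h3 := HasMFDerivAt.comp (extChartAt 𝓘(ℝ, E) x x)
    (g := extChartAt 𝓘(ℝ, F) p₀ ∘ f) (by rw [extChartAt_to_inv]; exact h2) h1
  set L : E →L[ℝ] F := (mfderiv 𝓘(ℝ, F) 𝓘(ℝ, F) (extChartAt 𝓘(ℝ, F) p₀) (f x) ∘L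
    mfderiv 𝓘(ℝ, E) 𝓘(ℝ, F) f x) with hL
  have h4 : HasFDerivAt (fun z ↦ extChartAt 𝓘(ℝ, F) p₀ (f ((extChartAt 𝓘(ℝ, E) x).symm z))) L
      (extChartAt 𝓘(ℝ, E) x x) := hasMFDerivAt_iff_hasFDerivAt.mp h3
  rw [h4.fderiv]
  rfl

/-- The partial derivative of a smooth map of two variables, in coordinates, is smooth. -/
theorem contMDiffAt_partial_fderiv [IsManifold 𝓘(ℝ, E) ∞ P] [IsManifold 𝓘(ℝ, F) ∞ M]
    [IsManifold 𝓘(ℝ, F') ∞ N] {f : N → P → M} {n₀ : N} {x : P}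
    (hf : ContMDiffAt (𝓘(ℝ, F').prod 𝓘(ℝ, E)) 𝓘(ℝ, F) ∞ (Function.uncurry f) (n₀, x)) {p₀ : M}
    (hx : f n₀ x ∈ (chartAt F p₀).source) :
    ContMDiffAt 𝓘(ℝ, F') 𝓘(ℝ, E →L[ℝ] F) ∞ (fun n ↦ fderiv ℝ
      (fun z ↦ extChartAt 𝓘(ℝ, F) p₀ (f n ((extChartAt 𝓘(ℝ, E) x).symm z)))
      (extChartAt 𝓘(ℝ, E) x x)) n₀ := by
  have h1 : ContMDiffAt 𝓘(ℝ, E) 𝓘(ℝ, E) ∞ (extChartAt 𝓘(ℝ, E) x).symm (extChartAt 𝓘(ℝ, E) x x) :=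
    (contMDiffOn_extChartAt_symm x).contMDiffAt (extChartAt_target_mem_nhds x)
  have h2 : ContMDiffAt (𝓘(ℝ, F').prod 𝓘(ℝ, E)) 𝓘(ℝ, F) ∞ (Function.uncurry fun (n : N) (z : E) ↦
      extChartAt 𝓘(ℝ, F) p₀ (f n ((extChartAt 𝓘(ℝ, E) x).symm z)))
      (n₀, extChartAt 𝓘(ℝ, E) x x) := by
    have h3 : ContMDiffAt (𝓘(ℝ, F').prod 𝓘(ℝ, E)) (𝓘(ℝ, F').prod 𝓘(ℝ, E)) ∞
        (fun y : N × E ↦ (y.1, (extChartAt 𝓘(ℝ, E) x).symm y.2)) (n₀, extChartAt 𝓘(ℝ, E) x x) :=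
      contMDiffAt_fst.prodMk (h1.comp (n₀, extChartAt 𝓘(ℝ, E) x x) contMDiffAt_snd)
    have h4 : ContMDiffAt (𝓘(ℝ, F').prod 𝓘(ℝ, E)) 𝓘(ℝ, F) ∞
        (Function.uncurry f ∘ fun y : N × E ↦ (y.1, (extChartAt 𝓘(ℝ, E) x).symm y.2))
        (n₀, extChartAt 𝓘(ℝ, E) x x) := by
      refine ContMDiffAt.comp _ ?_ h3
      simpa only [extChartAt_to_inv] using hf
    refine ContMDiffAt.comp (I' := 𝓘(ℝ, F)) (n₀, extChartAt 𝓘(ℝ, E) x x)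
      (g := extChartAt 𝓘(ℝ, F) p₀) ?_ h4
    refine contMDiffAt_extChartAt' ?_
    simpa only [Function.comp, Function.uncurry, extChartAt_to_inv] using hx
  have h5 := ContMDiffAt.mfderiv (m := ∞) (x₀ := n₀)
    (fun (n : N) (z : E) ↦ extChartAt 𝓘(ℝ, F) p₀ (f n ((extChartAt 𝓘(ℝ, E) x).symm z)))
    (fun _ ↦ extChartAt 𝓘(ℝ, E) x x) h2 contMDiffAt_const (by simp)
  have h6 : inTangentCoordinates 𝓘(ℝ, E) 𝓘(ℝ, F) (fun _ : N ↦ extChartAt 𝓘(ℝ, E) x x)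
      (fun n ↦ extChartAt 𝓘(ℝ, F) p₀ (f n ((extChartAt 𝓘(ℝ, E) x).symm
        (extChartAt 𝓘(ℝ, E) x x)))) (fun n ↦ (mfderiv 𝓘(ℝ, E) 𝓘(ℝ, F) (fun z ↦
          extChartAt 𝓘(ℝ, F) p₀ (f n ((extChartAt 𝓘(ℝ, E) x).symm z)))
          (extChartAt 𝓘(ℝ, E) x x) : E →L[ℝ] F)) n₀ = _ := inTangentCoordinates_model_space _ _ _ _
  refine ContMDiffAt.congr_of_eventuallyEq h5 (Filter.EventuallyEq.of_eq ?_)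
  rw [h6]
  funext n
  rw [mfderiv_eq_fderiv]

variable {c : ℝ → M} {t : ℝ}

/-- The velocity of the curve `c` at the time `t` is `v`. -/
def HasVelocityAt (c : ℝ → M) (t : ℝ) (v : TangentSpace 𝓘(ℝ, F) (c t)) : Prop :=
  HasMFDerivAt 𝓘(ℝ, ℝ) 𝓘(ℝ, F) c t (ContinuousLinearMap.smulRight (1 : ℝ →L[ℝ] ℝ) v)

theorem HasVelocityAt.continuousAt {v : TangentSpace 𝓘(ℝ, F) (c t)} (h : HasVelocityAt c t v) :
    ContinuousAt c t := HasMFDerivAt.continuousAt h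

theorem HasVelocityAt.mfderiv_one {v : TangentSpace 𝓘(ℝ, F) (c t)} (h : HasVelocityAt c t v) :
    mfderiv 𝓘(ℝ, ℝ) 𝓘(ℝ, F) c t (1 : ℝ) = v := by
  have h1 := HasMFDerivAt.mfderiv h
  rw [h1]
  exact one_smul ℝ v

theorem MDifferentiableAt.hasVelocityAt (h : MDifferentiableAt 𝓘(ℝ, ℝ) 𝓘(ℝ, F) c t) :
    HasVelocityAt c t (mfderiv 𝓘(ℝ, ℝ) 𝓘(ℝ, F) c t (1 : ℝ)) := by
  have h1 := h.hasMFDerivAt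
  refine h1.congr_mfderiv ?_
  refine ContinuousLinearMap.ext fun (a : ℝ) ↦ ?_
  have h2 := (mfderiv 𝓘(ℝ, ℝ) 𝓘(ℝ, F) c t).map_smul a (1 : ℝ)
  have h3 : (a • (1 : ℝ)) = a := by simp
  exact (congrArg (mfderiv 𝓘(ℝ, ℝ) 𝓘(ℝ, F) c t) h3).symm.trans h2

theorem HasVelocityAt.comp_map {f : M → N} {v : TangentSpace 𝓘(ℝ, F) (c t)}
    (hf : MDifferentiableAt 𝓘(ℝ, F) 𝓘(ℝ, F') f (c t)) (h : HasVelocityAt c t v) :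
    HasVelocityAt (f ∘ c) t (mfderiv 𝓘(ℝ, F) 𝓘(ℝ, F') f (c t) v) := by
  refine (hf.hasMFDerivAt.comp t h).congr_mfderiv ?_
  refine ContinuousLinearMap.ext fun (a : ℝ) ↦ ?_
  exact (mfderiv 𝓘(ℝ, F) 𝓘(ℝ, F') f (c t)).map_smul a v

theorem HasVelocityAt.comp_param {s : ℝ → ℝ} {a u : ℝ} {v : TangentSpace 𝓘(ℝ, F) (c (s u))}
    (h : HasVelocityAt c (s u) v) (hs : HasDerivAt s a u) :
    HasVelocityAt (c ∘ s) u (a • v) := by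
  have hs' : HasMFDerivAt 𝓘(ℝ, ℝ) 𝓘(ℝ, ℝ) s u (ContinuousLinearMap.smulRight (1 : ℝ →L[ℝ] ℝ) a) :=
    (hasMFDerivAt_iff_hasFDerivAt).mpr hs.hasFDerivAt
  refine (HasMFDerivAt.comp u h hs').congr_mfderiv ?_
  refine ContinuousLinearMap.ext fun (b : ℝ) ↦ ?_
  exact mul_smul b a v

theorem HasVelocityAt.unique {v w : TangentSpace 𝓘(ℝ, F) (c t)} (hv : HasVelocityAt c t v)
    (hw : HasVelocityAt c t w) : v = w := hv.mfderiv_one.symm.trans hw.mfderiv_one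

theorem HasVelocityAt.hasDerivAt_comp {f : M → F'} {v : TangentSpace 𝓘(ℝ, F) (c t)}
    (h : HasVelocityAt c t v) (hf : MDifferentiableAt 𝓘(ℝ, F) 𝓘(ℝ, F') f (c t)) :
    HasDerivAt (fun τ ↦ f (c τ)) (vectorDiff f (c t) v) t := by
  have h1 := h.comp_map hf
  set w : F' := vectorDiff f (c t) v
  have h2 : HasFDerivAt (fun τ ↦ f (c τ))
      (ContinuousLinearMap.smulRight (1 : ℝ →L[ℝ] ℝ) w) t := hasMFDerivAt_iff_hasFDerivAt.mp h1
  exact h2.hasDerivAt.congr_deriv (one_smul ℝ w)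

/-- Velocities in coordinates. -/
theorem HasVelocityAt.hasDerivAt [IsManifold 𝓘(ℝ, F) 1 M] {v : TangentSpace 𝓘(ℝ, F) (c t)}
    (h : HasVelocityAt c t v) {p₀ : M} (hp : c t ∈ (chartAt F p₀).source) :
    HasDerivAt (extChartAt 𝓘(ℝ, F) p₀ ∘ c) (chartDiff F p₀ (c t) v) t := by
  exact h.hasDerivAt_comp (mdifferentiableAt_extChartAt hp)

theorem HasVelocityAt.congr {c' : ℝ → M} {v : TangentSpace 𝓘(ℝ, F) (c t)}
    {v' : TangentSpace 𝓘(ℝ, F) (c' t)} (h : HasVelocityAt c t v) (hc : c' =ᶠ[𝓝 t] c)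
    (hv : (v : F) = v') : HasVelocityAt c' t v' := by
  have := HasMFDerivAt.congr_of_eventuallyEq h hc
  subst hv
  exact this

/-- A chart is bijective on tangent spaces. -/
theorem bijective_chartDiff [IsManifold 𝓘(ℝ, F) 1 M] {p p₀ : M}
    (hp : p ∈ (chartAt F p₀).source) :
    Function.Bijective (chartDiff F p₀ p) := by
  obtain ⟨e, he⟩ := isInvertible_mfderiv_extChartAt (I := 𝓘(ℝ, F)) (x := p₀)
    (by rwa [extChartAt_source] : p ∈ (extChartAt 𝓘(ℝ, F) p₀).source)
  rw [chartDiff, ← he]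
  exact e.bijective

end Charts

/-! ### The space of right cosets -/

section Cosets

variable {G : Type*} [Group G] {H : Subgroup G}

@[simp]
theorem orbitMap_proj (q g : G) : orbitMap (proj H q) g = proj H (q * g) := rfl

theorem proj_surjective : Function.Surjective (proj H) := Quotient.mk_surjective

theorem proj_eq_proj {q q' : G} : proj H q = proj H q' ↔ q' * q⁻¹ ∈ H :=
  Quotient.eq.trans QuotientGroup.rightRel_apply

theorem proj_mul_of_mem {h : G} (hh : h ∈ H) (q : G) : proj H (h * q) = proj H q := by
  rw [proj_eq_proj]
  simpa using hh

theorem orbitMap_one (p : RightCosets H) : orbitMap p 1 = p := by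
  obtain ⟨x, rfl⟩ := proj_surjective p
  rw [orbitMap_proj, mul_one]

end Cosets

section QuotientManifold

variable {E : Type*} [NormedAddCommGroup E] [NormedSpace ℝ E]
  {G : Type*} [TopologicalSpace G] [ChartedSpace E G] [Group G] [LieGroup 𝓘(ℝ, E) ∞ G]
  {H : Subgroup G} {F : Type*} [NormedAddCommGroup F] [NormedSpace ℝ F] [FiniteDimensional ℝ F]
  [ChartedSpace F (RightCosets H)]

/-- The projection onto the space of cosets has smooth local sections through every point. -/
theorem IsQuotientManifold.exists_localSection (hM : IsQuotientManifold (E := E) (F := F) H)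
    (q : G) : ∃ σ : RightCosets H → G, ContMDiffAt 𝓘(ℝ, F) 𝓘(ℝ, E) ∞ σ (proj H q) ∧
      σ (proj H q) = q ∧ ∀ᶠ p in 𝓝 (proj H q), proj H (σ p) = p := by
  have := hM.isManifold
  have : CompleteSpace F := FiniteDimensional.complete ℝ F
  set φ := extChartAt 𝓘(ℝ, F) (proj H q) with hφ
  set e := extChartAt 𝓘(ℝ, E) q with he
  have hπ := hM.contMDiff_proj
  have hπd : MDifferentiableAt 𝓘(ℝ, E) 𝓘(ℝ, F) (proj H) q :=
    hπ.contMDiffAt.mdifferentiableAt (by simp)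
  set f : E → F := fun z ↦ φ (proj H (e.symm z)) with hf
  set x₀ := e q with hx₀
  have hesymm : ContMDiffAt 𝓘(ℝ, E) 𝓘(ℝ, E) ∞ e.symm x₀ :=
    (contMDiffOn_extChartAt_symm q).contMDiffAt (extChartAt_target_mem_nhds q)
  have hφd : ContMDiffAt 𝓘(ℝ, F) 𝓘(ℝ, F) ∞ φ (proj H q) := contMDiffAt_extChartAt
  have hex₀ : e.symm x₀ = q := extChartAt_to_inv q
  have hfc : ContDiffAt ℝ ∞ f x₀ := by
    rw [← contMDiffAt_iff_contDiffAt]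
    refine ContMDiffAt.comp (I' := 𝓘(ℝ, F)) x₀ (g := φ) ?_
      (ContMDiffAt.comp (I' := 𝓘(ℝ, E)) x₀ (g := proj H) hπ.contMDiffAt hesymm)
    simpa only [Function.comp, hex₀] using hφd
  have hsurj : Function.Surjective (fderiv ℝ f x₀) := by
    intro w
    obtain ⟨v, hv⟩ := (bijective_chartDiff (mem_chart_source F (proj H q))).2 w
    obtain ⟨a, ha⟩ := hM.surjective_mfderiv_proj q v
    exact ⟨a, (fderiv_extChartAt_comp hπd (mem_chart_source F (proj H q)) a).trans
      ((congrArg (chartDiff F (proj H q) (proj H q)) ha).trans hv)⟩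
  obtain ⟨S', hS'⟩ := (fderiv ℝ f x₀).toLinearMap.exists_rightInverse_of_surjective
    (LinearMap.range_eq_top.mpr hsurj)
  set S : F →L[ℝ] E := LinearMap.toContinuousLinearMap S' with hS
  have hfS : ∀ w, fderiv ℝ f x₀ (S w) = w := fun w ↦ congrArg (fun L ↦ L w) hS'
  -- In charts, `f` is inverted along the affine map `j` with linear part a right inverse `S` of
  -- its derivative: `f ∘ j` has the identity as derivative, hence a local inverse `k`, and `j ∘ k`
  -- is the section.
  set y₀ := φ (proj H q) with hy₀
  set j : F → E := fun y ↦ x₀ + S (y - y₀) with hj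
  have hj0 : j y₀ = x₀ := by simp [hj]
  have hjc : ContDiff ℝ ∞ j := by fun_prop
  have hjd : HasFDerivAt j S y₀ := by
    have h1 : HasFDerivAt (fun y : F ↦ y - y₀) (ContinuousLinearMap.id ℝ F) y₀ :=
      (hasFDerivAt_id y₀).sub_const y₀
    have h2 := HasFDerivAt.comp (f := fun y : F ↦ y - y₀) y₀ S.hasFDerivAt h1
    exact (h2.const_add x₀).congr_fderiv S.comp_id
  have hgc : ContDiffAt ℝ ∞ (f ∘ j) y₀ := ContDiffAt.comp y₀ (by rwa [hj0]) hjc.contDiffAt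
  have hgd : HasFDerivAt (f ∘ j) ((ContinuousLinearEquiv.refl ℝ F : F ≃L[ℝ] F) : F →L[ℝ] F) y₀ := by
    have h1 : HasFDerivAt f (fderiv ℝ f x₀) (j y₀) := by
      rw [hj0]; exact (hfc.differentiableAt (by simp)).hasFDerivAt
    refine (h1.comp y₀ hjd).congr_fderiv ?_
    ext w
    exact hfS w
  have hgy : (f ∘ j) y₀ = y₀ := by rw [Function.comp, hj0, hf]; simp only [hex₀, hy₀]
  set k := hgc.localInverse hgd (by simp) with hk
  have hkc : ContDiffAt ℝ ∞ k y₀ := by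
    have := hgc.to_localInverse hgd (by simp)
    rwa [hgy] at this
  have hk0 : k y₀ = y₀ := by
    have := hgc.localInverse_apply_image hgd (by simp)
    rwa [hgy] at this
  have hgk : ∀ᶠ y in 𝓝 y₀, f (j (k y)) = y := by
    have := (hgc.hasStrictFDerivAt' hgd (by simp)).eventually_right_inverse
    rwa [hgy] at this
  set σ : RightCosets H → G := fun p ↦ e.symm (j (k (φ p))) with hσ
  have hσ0 : σ (proj H q) = q := by
    simp only [hσ, ← hy₀, hk0, hj0, hex₀]
  have hσc : ContMDiffAt 𝓘(ℝ, F) 𝓘(ℝ, E) ∞ σ (proj H q) := by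
    have h1 : ContMDiffAt 𝓘(ℝ, F) 𝓘(ℝ, E) ∞ (fun p ↦ j (k (φ p))) (proj H q) :=
      ContMDiffAt.comp (I' := 𝓘(ℝ, F)) (proj H q) (g := fun y ↦ j (k y))
        ((hjc.contDiffAt.comp y₀ hkc).contMDiffAt) hφd
    refine ContMDiffAt.comp (I' := 𝓘(ℝ, E)) (proj H q) (g := e.symm) ?_ h1
    simpa only [← hy₀, hk0, hj0] using hesymm
  refine ⟨σ, hσc, hσ0, ?_⟩
  have hπσ : ContinuousAt (fun p ↦ proj H (σ p)) (proj H q) :=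
    ContinuousAt.comp (g := proj H) hπ.continuous.continuousAt hσc.continuousAt
  have hsrc : φ.source ∈ 𝓝 (proj H q) := extChartAt_source_mem_nhds _
  have h1 := hπσ.preimage_mem_nhds (t := φ.source) (by simpa only [hσ0] using hsrc)
  filter_upwards [h1, hsrc, hφd.continuousAt.eventually hgk] with p hp1 hp2 hp3
  exact φ.injOn hp1 hp2 hp3

/-- The right action of the group on the space of cosets is smooth. -/
theorem IsQuotientManifold.contMDiff_orbitMap (hM : IsQuotientManifold (E := E) (F := F) H) :
    ContMDiff (𝓘(ℝ, F).prod 𝓘(ℝ, E)) 𝓘(ℝ, F) ∞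
      (Function.uncurry fun (p : RightCosets H) (g : G) ↦ orbitMap p g) := by
  rintro ⟨p, g⟩
  obtain ⟨q, rfl⟩ := proj_surjective p
  obtain ⟨σ, hσ, -, hπσ⟩ := hM.exists_localSection q
  have h1 : ContMDiffAt (𝓘(ℝ, F).prod 𝓘(ℝ, E)) 𝓘(ℝ, E) ∞
      (fun x : RightCosets H × G ↦ σ x.1 * x.2) (proj H q, g) :=
    ContMDiffAt.mul (ContMDiffAt.comp (proj H q, g) hσ contMDiffAt_fst) contMDiffAt_snd
  have h2 := ContMDiffAt.comp (proj H q, g) (hM.contMDiff_proj.contMDiffAt) h1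
  refine h2.congr_of_eventuallyEq ?_
  have h3 : ∀ᶠ x : RightCosets H × G in 𝓝 (proj H q, g), proj H (σ x.1) = x.1 :=
    (continuousAt_fst (p := (proj H q, g))).eventually hπσ
  filter_upwards [h3] with x hx
  conv_lhs => rw [Function.uncurry, ← hx]
  rfl

end QuotientManifold

/-! ### Differentials of translations -/

/-- The chain rule at a point that is only propositionally the image point, for a composition
known by its values. -/
theorem mfderiv_mfderiv_of_comp {E F F' : Type*} [NormedAddCommGroup E] [NormedSpace ℝ E]
    [NormedAddCommGroup F] [NormedSpace ℝ F] [NormedAddCommGroup F'] [NormedSpace ℝ F']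
    {P M N : Type*} [TopologicalSpace P] [ChartedSpace E P] [TopologicalSpace M] [ChartedSpace F M]
    [TopologicalSpace N] [ChartedSpace F' N] {f : P → M} {g : M → N} {h : P → N} {x : P} {y : M}
    (hf : MDifferentiableAt 𝓘(ℝ, E) 𝓘(ℝ, F) f x) (hg : MDifferentiableAt 𝓘(ℝ, F) 𝓘(ℝ, F') g y)
    (hy : f x = y) (hh : ∀ x, g (f x) = h x) (v : E) :
    (mfderiv 𝓘(ℝ, F) 𝓘(ℝ, F') g y (mfderiv 𝓘(ℝ, E) 𝓘(ℝ, F) f x v : F) : F') =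
      (mfderiv 𝓘(ℝ, E) 𝓘(ℝ, F') h x v : F') := by
  subst hy
  obtain rfl : g ∘ f = h := funext hh
  have h1 := mfderiv_comp x hg hf
  exact (congrArg (fun L : E →L[ℝ] F' ↦ L v) h1).symm

theorem IsQuotientManifold.mdifferentiableAt_proj {E : Type*} [NormedAddCommGroup E]
    [NormedSpace ℝ E] {G : Type*} [TopologicalSpace G] [ChartedSpace E G] [Group G]
    {H : Subgroup G} {F : Type*} [NormedAddCommGroup F] [NormedSpace ℝ F]
    [ChartedSpace F (RightCosets H)] (hM : IsQuotientManifold (E := E) (F := F) H) (q : G) :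
    MDifferentiableAt 𝓘(ℝ, E) 𝓘(ℝ, F) (proj H) q :=
  hM.contMDiff_proj.contMDiffAt.mdifferentiableAt (by simp)

section Translations

variable {E : Type*} [NormedAddCommGroup E] [NormedSpace ℝ E]
  {G : Type*} [TopologicalSpace G] [ChartedSpace E G] [Group G] [LieGroup 𝓘(ℝ, E) ∞ G]

theorem mdifferentiableAt_mul_left' (g x : G) :
    MDifferentiableAt 𝓘(ℝ, E) 𝓘(ℝ, E) (fun y : G ↦ g * y) x :=
  (contMDiff_mul_left (I := 𝓘(ℝ, E)) (n := ∞)).contMDiffAt.mdifferentiableAt (by simp)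

theorem mdifferentiableAt_mul_right' (g x : G) :
    MDifferentiableAt 𝓘(ℝ, E) 𝓘(ℝ, E) (fun y : G ↦ y * g) x :=
  (contMDiff_mul_right (I := 𝓘(ℝ, E)) (n := ∞)).contMDiffAt.mdifferentiableAt (by simp)

theorem leftTr_mul (h q : G) (a : E) :
    (leftTr (h * q) a : E) = mfderiv 𝓘(ℝ, E) 𝓘(ℝ, E) (fun y : G ↦ h * y) q (leftTr q a) :=
  (mfderiv_mfderiv_of_comp (mdifferentiableAt_mul_left' q 1) (mdifferentiableAt_mul_left' h q)
    (mul_one q) (fun _ ↦ (mul_assoc _ _ _).symm) a).symm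

theorem rightTrInv_rightField (q : G) (a : E) : rightTrInv q (rightField a q) = a := by
  have h1 := mfderiv_mfderiv_of_comp (h := id) (mdifferentiableAt_mul_right' q (1 : G))
    (mdifferentiableAt_mul_right' q⁻¹ q) (one_mul q) (fun _ ↦ mul_inv_cancel_right _ _) a
  rw [mfderiv_id] at h1
  exact h1

theorem rightField_rightTrInv (q : G) (v : TangentSpace 𝓘(ℝ, E) q) :
    rightField (rightTrInv q v) q = v := by
  have h1 := mfderiv_mfderiv_of_comp (E := E) (F := E) (F' := E) (h := id)
    (mdifferentiableAt_mul_right' q⁻¹ q)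
    (mdifferentiableAt_mul_right' q 1) (mul_inv_cancel q) (fun _ ↦ inv_mul_cancel_right _ _) v
  rw [mfderiv_id] at h1
  exact h1

variable (E) in
/-- The adjoint representation: the derivative at `1` of the conjugation by `q`, read in the
preferred chart at `1`, which identifies `T_1 G` with `E`. It is defined as a plain `fderiv` with
values in `E →L[ℝ] E` so that it can be differentiated in `q`. -/
noncomputable def Ad (q : G) : E →L[ℝ] E :=
  fderiv ℝ (fun z ↦ extChartAt 𝓘(ℝ, E) (1 : G) (q * (extChartAt 𝓘(ℝ, E) (1 : G)).symm z * q⁻¹))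
    (extChartAt 𝓘(ℝ, E) (1 : G) 1)

theorem contMDiff_conj : ContMDiff (𝓘(ℝ, E).prod 𝓘(ℝ, E)) 𝓘(ℝ, E) ∞
    (Function.uncurry fun (q x : G) ↦ q * x * q⁻¹) := by
  have h1 : ContMDiff (𝓘(ℝ, E).prod 𝓘(ℝ, E)) 𝓘(ℝ, E) ∞ (fun x : G × G ↦ x.1 * x.2 * x.1⁻¹) :=
    (contMDiff_fst.mul contMDiff_snd).mul contMDiff_fst.inv
  exact h1

theorem contMDiff_conj' (q : G) : ContMDiff 𝓘(ℝ, E) 𝓘(ℝ, E) ∞ (fun x : G ↦ q * x * q⁻¹) :=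
  (contMDiff_const.mul contMDiff_id).mul contMDiff_const

theorem mdifferentiableAt_conj' (q x : G) :
    MDifferentiableAt 𝓘(ℝ, E) 𝓘(ℝ, E) (fun x : G ↦ q * x * q⁻¹) x :=
  (contMDiff_conj' q).contMDiffAt.mdifferentiableAt (by simp)

theorem contMDiff_Ad : ContMDiff 𝓘(ℝ, E) 𝓘(ℝ, E →L[ℝ] E) ∞ (Ad E : G → E →L[ℝ] E) := by
  intro q
  refine contMDiffAt_partial_fderiv (n₀ := q) (x := (1 : G)) (contMDiff_conj (q, 1)) (p₀ := 1) ?_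
  rw [mul_one, mul_inv_cancel]
  exact mem_chart_source E 1

theorem Ad_eq_mfderiv (q : G) (a : E) :
    Ad E q a = mfderiv 𝓘(ℝ, E) 𝓘(ℝ, E) (fun x : G ↦ q * x * q⁻¹) 1 a := by
  have h0 : q * 1 * q⁻¹ = 1 := by simp
  have h1 := fderiv_extChartAt_comp (mdifferentiableAt_conj' q (1 : G)) (p₀ := (1 : G))
    (by rw [h0]; exact mem_chart_source E 1) a
  refine h1.trans ?_
  rw [h0, chartDiff, mfderiv_extChartAt_self]
  rfl

theorem Ad_eq_rightTrInv_leftTr (q : G) (a : E) : Ad E q a = rightTrInv q (leftTr q a) := by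
  rw [Ad_eq_mfderiv]
  exact (mfderiv_mfderiv_of_comp (mdifferentiableAt_mul_left' q (1 : G))
    (mdifferentiableAt_mul_right' q⁻¹ q) (mul_one q) (fun _ ↦ rfl) a).symm

theorem Ad_mul (h q : G) (a : E) : Ad E (h * q) a = Ad E h (Ad E q a) := by
  rw [Ad_eq_mfderiv, Ad_eq_mfderiv, Ad_eq_mfderiv]
  exact (mfderiv_mfderiv_of_comp (h := fun x ↦ h * q * x * (h * q)⁻¹)
    (mdifferentiableAt_conj' q 1) (mdifferentiableAt_conj' h 1) (by simp)
    (fun x ↦ by simp [mul_assoc]) a).symm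

theorem Ad_one (a : E) : Ad E (1 : G) a = a := by
  have h0 : (fun x : G ↦ 1 * x * 1⁻¹) = id := by ext; simp
  rw [Ad_eq_mfderiv, h0, mfderiv_id]
  rfl

/-- Left translation by `h` maps `aᴿ_q` to the right-invariant vector of `Ad h a` at `h q`. -/
theorem mfderiv_mul_left_rightField (h q : G) (a : E) :
    (mfderiv 𝓘(ℝ, E) 𝓘(ℝ, E) (fun y : G ↦ h * y) q (rightField a q) : E) =
      rightField (Ad E h a) (h * q) := by
  rw [Ad_eq_mfderiv]
  refine (mfderiv_mfderiv_of_comp (h := fun y ↦ h * (y * q))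
    (mdifferentiableAt_mul_right' q (1 : G))
    (mdifferentiableAt_mul_left' h q) (one_mul q) (fun _ ↦ rfl) a).trans ?_
  exact (mfderiv_mfderiv_of_comp (h := fun y ↦ h * (y * q))
    (mdifferentiableAt_conj' h 1) (mdifferentiableAt_mul_right' (h * q) 1) (by simp)
    (fun x ↦ by simp [mul_assoc]) a).symm

variable {H : Subgroup G} {F : Type*} [NormedAddCommGroup F] [NormedSpace ℝ F]
  [ChartedSpace F (RightCosets H)]

/-- The projection does not see left translations by elements of `H`. -/
theorem IsQuotientManifold.mfderiv_proj_mul_left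
    (hM : IsQuotientManifold (E := E) (F := F) H) {h : G} (hh : h ∈ H) (q : G) (v : E) :
    (mfderiv 𝓘(ℝ, E) 𝓘(ℝ, F) (proj H) (h * q)
      (mfderiv 𝓘(ℝ, E) 𝓘(ℝ, E) (fun y : G ↦ h * y) q v : E) : F) =
      mfderiv 𝓘(ℝ, E) 𝓘(ℝ, F) (proj H) q v :=
  mfderiv_mfderiv_of_comp (mdifferentiableAt_mul_left' h q) (hM.mdifferentiableAt_proj _) rfl
    (fun x ↦ proj_mul_of_mem hh x) v

theorem IsQuotientManifold.generator_proj
    (hM : IsQuotientManifold (E := E) (F := F) H) (q : G) (a : E) :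
    generator (F := F) (proj H q) a = mfderiv 𝓘(ℝ, E) 𝓘(ℝ, F) (proj H) q (leftTr q a) :=
  (mfderiv_mfderiv_of_comp (h := orbitMap (proj H q)) (mdifferentiableAt_mul_left' q (1 : G))
    (hM.mdifferentiableAt_proj q) (mul_one q) (fun _ ↦ rfl) a).symm

variable [FiniteDimensional ℝ F]

theorem IsQuotientManifold.mdifferentiableAt_orbitMap_left
    (hM : IsQuotientManifold (E := E) (F := F) H) (g : G) (p : RightCosets H) :
    MDifferentiableAt 𝓘(ℝ, F) 𝓘(ℝ, F) (fun p : RightCosets H ↦ orbitMap p g) p := by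
  have h1 : ContMDiff 𝓘(ℝ, F) (𝓘(ℝ, F).prod 𝓘(ℝ, E)) ∞ (fun p : RightCosets H ↦ (p, g)) :=
    contMDiff_id.prodMk contMDiff_const
  exact (hM.contMDiff_orbitMap.comp h1).contMDiffAt.mdifferentiableAt (by simp)

theorem IsQuotientManifold.mdifferentiableAt_orbitMap
    (hM : IsQuotientManifold (E := E) (F := F) H) (p : RightCosets H) (g : G) :
    MDifferentiableAt 𝓘(ℝ, E) 𝓘(ℝ, F) (orbitMap p) g := by
  have h1 : ContMDiff 𝓘(ℝ, E) (𝓘(ℝ, F).prod 𝓘(ℝ, E)) ∞ (fun g : G ↦ (p, g)) :=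
    contMDiff_const.prodMk contMDiff_id
  exact (hM.contMDiff_orbitMap.comp h1).contMDiffAt.mdifferentiableAt (by simp)

theorem IsQuotientManifold.mfderiv_proj_rightField
    (hM : IsQuotientManifold (E := E) (F := F) H) (q : G) (a : E) :
    (mfderiv 𝓘(ℝ, E) 𝓘(ℝ, F) (proj H) q (rightField a q) : F) =
      mfderiv 𝓘(ℝ, F) 𝓘(ℝ, F) (fun p : RightCosets H ↦ orbitMap p q) (proj H 1)
        (mfderiv 𝓘(ℝ, E) 𝓘(ℝ, F) (proj H) 1 a) :=
  (mfderiv_mfderiv_of_comp (h := fun x ↦ proj H (x * q)) (mdifferentiableAt_mul_right' q (1 : G))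
    (hM.mdifferentiableAt_proj q) (one_mul q) (fun _ ↦ rfl) a).trans
  (mfderiv_mfderiv_of_comp (hM.mdifferentiableAt_proj 1)
    (hM.mdifferentiableAt_orbitMap_left q (proj H 1)) rfl (fun _ ↦ rfl) a).symm

/-- The vertical vectors at `q` are the values at `q` of the right-invariant fields of `𝔥`. -/
theorem IsQuotientManifold.mfderiv_proj_rightField_eq_zero_iff
    (hM : IsQuotientManifold (E := E) (F := F) H) (q : G)
    (a : GroupLieAlgebra 𝓘(ℝ, E) G) :
    mfderiv 𝓘(ℝ, E) 𝓘(ℝ, F) (proj H) q (rightField a q) = 0 ↔ a ∈ isotropyAlgebra F H := by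
  have hiff : a ∈ isotropyAlgebra F H ↔ mfderiv 𝓘(ℝ, E) 𝓘(ℝ, F) (proj H) 1 a = 0 := Iff.rfl
  rw [hiff]
  have h1 := hM.mfderiv_proj_rightField q a
  have h2 := mfderiv_mfderiv_of_comp (h := id)
    (hM.mdifferentiableAt_orbitMap_left q (proj H 1))
    (hM.mdifferentiableAt_orbitMap_left q⁻¹ (orbitMap (proj H 1) q)) rfl
    (fun x ↦ by obtain ⟨x, rfl⟩ := proj_surjective x; simp)
    (mfderiv 𝓘(ℝ, E) 𝓘(ℝ, F) (proj H) 1 a)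
  rw [mfderiv_id] at h2
  constructor
  · intro h
    have h3 : (mfderiv 𝓘(ℝ, F) 𝓘(ℝ, F) (fun p : RightCosets H ↦ orbitMap p q) (proj H 1)
        (mfderiv 𝓘(ℝ, E) 𝓘(ℝ, F) (proj H) 1 a) : F) = (0 : F) := h1.symm.trans h
    rw [h3] at h2
    exact h2.symm.trans (map_zero (mfderiv 𝓘(ℝ, F) 𝓘(ℝ, F)
      (fun p : RightCosets H ↦ orbitMap p q⁻¹) (orbitMap (proj H 1) q)))
  · intro h
    rw [h] at h1
    exact h1.trans (map_zero (mfderiv 𝓘(ℝ, F) 𝓘(ℝ, F)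
      (fun p : RightCosets H ↦ orbitMap p q) (proj H 1)))

theorem IsQuotientManifold.mfderiv_proj_eq_zero_iff
    (hM : IsQuotientManifold (E := E) (F := F) H) (q : G) (v : TangentSpace 𝓘(ℝ, E) q) :
    mfderiv 𝓘(ℝ, E) 𝓘(ℝ, F) (proj H) q v = 0 ↔ rightTrInv q v ∈ isotropyAlgebra F H := by
  rw [← hM.mfderiv_proj_rightField_eq_zero_iff q, rightField_rightTrInv]

end Translations

/-! ### The horizontal field and its momentum -/

theorem contract_comm {V : Type*} [AddCommGroup V] [Module ℝ V] (C : V ⊗[ℝ] V)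
    (β γ : Module.Dual ℝ V) : γ (contract C β) = β (contract (TensorProduct.comm ℝ V V C) γ) := by
  induction C using TensorProduct.induction_on with
  | zero => simp [contract]
  | tmul x y => simp [contract, mul_comm]
  | add x y hx hy =>
    simp only [contract, LinearMap.coe_mk, AddHom.coe_mk, map_add] at hx hy ⊢
    rw [hx, hy]

theorem contract_symm {V : Type*} [AddCommGroup V] [Module ℝ V] {C : V ⊗[ℝ] V}
    (hC : TensorProduct.comm ℝ V V C = C) (β γ : Module.Dual ℝ V) :
    γ (contract C β) = β (contract C γ) := by
  conv_rhs => rw [← hC]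
  exact contract_comm C β γ

section Group

variable {E : Type*} [NormedAddCommGroup E] [NormedSpace ℝ E] [FiniteDimensional ℝ E]
  {G : Type*} [TopologicalSpace G] [ChartedSpace E G] [Group G]

/-- The contraction with `C` as a continuous linear map, in the coordinates of `T_1 G = E`. -/
noncomputable def contractL (C : GroupLieAlgebra 𝓘(ℝ, E) G ⊗[ℝ] GroupLieAlgebra 𝓘(ℝ, E) G) :
    (E →L[ℝ] ℝ) →L[ℝ] E :=
  LinearMap.toContinuousLinearMap
    (contract C ∘ₗ (ContinuousLinearMap.coeLM ℝ : (E →L[ℝ] ℝ) →ₗ[ℝ] (E →ₗ[ℝ] ℝ)) :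
      (E →L[ℝ] ℝ) →ₗ[ℝ] E)

theorem contractL_apply (C : GroupLieAlgebra 𝓘(ℝ, E) G ⊗[ℝ] GroupLieAlgebra 𝓘(ℝ, E) G)
    (β : E →L[ℝ] ℝ) : contractL C β = contract C (β : E →ₗ[ℝ] ℝ) := rfl

theorem contractL_symm {C : GroupLieAlgebra 𝓘(ℝ, E) G ⊗[ℝ] GroupLieAlgebra 𝓘(ℝ, E) G}
    (hC : TensorProduct.comm ℝ _ _ C = C) (β γ : E →L[ℝ] ℝ) :
    β (contractL C γ) = γ (contractL C β) :=
  contract_symm hC (γ : E →ₗ[ℝ] ℝ) (β : E →ₗ[ℝ] ℝ)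

/-- A linear form on the Lie algebra as a continuous linear form on `T_1 G = E`. -/
noncomputable def dualL (α : Module.Dual ℝ (GroupLieAlgebra 𝓘(ℝ, E) G)) : E →L[ℝ] ℝ :=
  LinearMap.toContinuousLinearMap (α : E →ₗ[ℝ] ℝ)

/-- The field `Cᴸ αᴿ` in the left trivialization of the tangent bundle of the group. -/
noncomputable def bodyVelocity (C : GroupLieAlgebra 𝓘(ℝ, E) G ⊗[ℝ] GroupLieAlgebra 𝓘(ℝ, E) G)
    (α : Module.Dual ℝ (GroupLieAlgebra 𝓘(ℝ, E) G)) (q : G) : E :=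
  contractL C (dualL α ∘L Ad E q)

variable [LieGroup 𝓘(ℝ, E) ∞ G]

theorem horizontalField_eq (C : GroupLieAlgebra 𝓘(ℝ, E) G ⊗[ℝ] GroupLieAlgebra 𝓘(ℝ, E) G)
    (α : Module.Dual ℝ (GroupLieAlgebra 𝓘(ℝ, E) G)) (q : G) :
    horizontalField C α q = leftTr q (bodyVelocity (E := E) C α q) := by
  have h1 : (leftTr q).dualMap (rightForm α q) =
      ((dualL α ∘L Ad E q : E →L[ℝ] ℝ) : E →ₗ[ℝ] ℝ) := by
    refine LinearMap.ext fun (a : E) ↦ ?_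
    exact congrArg α (Ad_eq_rightTrInv_leftTr (E := E) q a).symm
  have h2 : contract C ((leftTr q).dualMap (rightForm α q)) = bodyVelocity C α q := by
    rw [h1]; rfl
  exact congrArg (leftTr q) h2

theorem contMDiff_bodyVelocity
    (C : GroupLieAlgebra 𝓘(ℝ, E) G ⊗[ℝ] GroupLieAlgebra 𝓘(ℝ, E) G)
    (α : Module.Dual ℝ (GroupLieAlgebra 𝓘(ℝ, E) G)) :
    ContMDiff 𝓘(ℝ, E) 𝓘(ℝ, E) ∞ (bodyVelocity C α) := by
  have h1 : ContDiff ℝ ∞ fun A : E →L[ℝ] E ↦ contractL C (dualL α ∘L A) := by fun_prop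
  exact h1.contMDiff.comp contMDiff_Ad

end Group

section Momentum

variable {E : Type*} [NormedAddCommGroup E] [NormedSpace ℝ E]
  {G : Type*} [TopologicalSpace G] [ChartedSpace E G] [Group G]
  {H : Subgroup G} {F : Type*} [NormedAddCommGroup F] [NormedSpace ℝ F]
  [ChartedSpace F (RightCosets H)]
  {C : GroupLieAlgebra 𝓘(ℝ, E) G ⊗[ℝ] GroupLieAlgebra 𝓘(ℝ, E) G}
  {𝔣 : Submodule ℝ (GroupLieAlgebra 𝓘(ℝ, E) G)}
  {α : Module.Dual ℝ (GroupLieAlgebra 𝓘(ℝ, E) G)}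

theorem metric_cometric {p : RightCosets H} (hp : p ∈ nondegenerateLocus F H C)
    (β : Module.Dual ℝ (TangentSpace 𝓘(ℝ, F) p)) : metric C p (cometric C p β) = β := by
  have hp' : Function.Bijective (cometric (F := F) C p) := hp
  unfold metric
  rw [dif_pos hp']
  exact (LinearEquiv.ofBijective (cometric (F := F) C p) hp').symm_apply_apply β

theorem metric_bijective {p : RightCosets H} (hp : p ∈ nondegenerateLocus F H C) :
    Function.Bijective (metric (F := F) C p) := by
  have hp' : Function.Bijective (cometric (F := F) C p) := hp
  unfold metric
  rw [dif_pos hp']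
  exact (LinearEquiv.ofBijective (cometric (F := F) C p) hp').symm.bijective

theorem tangentMap_proj_eq {q : G} {u : TangentSpace 𝓘(ℝ, E) q} {p : RightCosets H}
    {v : TangentSpace 𝓘(ℝ, F) p}
    (h : tangentMap 𝓘(ℝ, E) 𝓘(ℝ, F) (proj H) ⟨q, u⟩ = ⟨p, v⟩) :
    proj H q = p ∧ (mfderiv 𝓘(ℝ, E) 𝓘(ℝ, F) (proj H) q u : F) = v := by
  unfold tangentMap at h
  cases h
  exact ⟨rfl, rfl⟩

theorem mem_invariantDistribution {q : G} {a : GroupLieAlgebra 𝓘(ℝ, E) G} (ha : a ∈ 𝔣) :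
    mfderiv 𝓘(ℝ, E) 𝓘(ℝ, F) (proj H) q (rightField a q) ∈
      invariantDistribution (F := F) 𝔣 (proj H q) :=
  Submodule.subset_span ⟨q, a, ha, rfl⟩

/-- If `𝔣ᴿ` is projectable, its image can be computed at any point of the fibre. -/
theorem IsProjectable.exists_of_mem (h𝔣 : IsProjectable F H 𝔣) {q : G}
    {v : TangentSpace 𝓘(ℝ, F) (proj H q)} (hv : v ∈ invariantDistribution 𝔣 (proj H q)) :
    ∃ a ∈ 𝔣, mfderiv 𝓘(ℝ, E) 𝓘(ℝ, F) (proj H) q (rightField a q) = v := by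
  induction hv using Submodule.span_induction with
  | mem v hv =>
    obtain ⟨q', a, ha, h⟩ := hv
    obtain ⟨h1, h2⟩ := tangentMap_proj_eq h
    obtain ⟨a', ha', h3⟩ := h𝔣 q' q h1 a ha
    obtain ⟨h4, h5⟩ := tangentMap_proj_eq (h3.symm.trans h)
    exact ⟨a', ha', h5⟩
  | zero =>
    refine ⟨0, 𝔣.zero_mem, ?_⟩
    have h1 : rightField (0 : GroupLieAlgebra 𝓘(ℝ, E) G) q = 0 :=
      map_zero (mfderiv 𝓘(ℝ, E) 𝓘(ℝ, E) (fun x : G ↦ x * q) 1)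
    rw [h1, map_zero]
  | add v w _ _ hv hw =>
    obtain ⟨a, ha, rfl⟩ := hv
    obtain ⟨b, hb, rfl⟩ := hw
    refine ⟨a + b, 𝔣.add_mem ha hb, ?_⟩
    have h1 : rightField (a + b) q = rightField a q + rightField b q :=
      map_add (mfderiv 𝓘(ℝ, E) 𝓘(ℝ, E) (fun x : G ↦ x * q) 1) a b
    rw [h1, map_add]
  | smul r v _ hv =>
    obtain ⟨a, ha, rfl⟩ := hv
    refine ⟨r • a, 𝔣.smul_mem r ha, ?_⟩
    have h1 : rightField (r • a) q = r • rightField a q :=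
      map_smul (mfderiv 𝓘(ℝ, E) 𝓘(ℝ, E) (fun x : G ↦ x * q) 1) r a
    rw [h1, map_smul]

variable [LieGroup 𝓘(ℝ, E) ∞ G]

/-- The momentum corresponds to the projected velocity under the cometric. -/
theorem IsQuotientManifold.cometric_momentum (hM : IsQuotientManifold (E := E) (F := F) H) {q : G}
    {β : Module.Dual ℝ (TangentSpace 𝓘(ℝ, F) (proj H q))}
    (hβ : ∀ v : TangentSpace 𝓘(ℝ, E) q,
      β (mfderiv 𝓘(ℝ, E) 𝓘(ℝ, F) (proj H) q v) = rightForm α q v) :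
    cometric C (proj H q) β =
      mfderiv 𝓘(ℝ, E) 𝓘(ℝ, F) (proj H) q (horizontalField C α q) := by
  have h1 : (generator (F := F) (proj H q)).dualMap β = (leftTr q).dualMap (rightForm α q) := by
    refine LinearMap.ext fun a ↦ ?_
    refine (congrArg β (hM.generator_proj q a)).trans (hβ _)
  have h2 : cometric C (proj H q) β = generator (F := F) (proj H q)
      (contract C ((generator (F := F) (proj H q)).dualMap β)) := rfl
  rw [h2, h1]
  exact hM.generator_proj q _

variable [FiniteDimensional ℝ F]

/-- A right-invariant form that vanishes on `𝔥` is the pull-back of a covector on the space of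
cosets. -/
theorem IsQuotientManifold.exists_momentum (hM : IsQuotientManifold (E := E) (F := F) H)
    (hα : ∀ a ∈ isotropyAlgebra F H, α a = 0) (q : G) :
    ∃ β : Module.Dual ℝ (TangentSpace 𝓘(ℝ, F) (proj H q)), ∀ v : TangentSpace 𝓘(ℝ, E) q,
      β (mfderiv 𝓘(ℝ, E) 𝓘(ℝ, F) (proj H) q v) = rightForm α q v := by
  have h1 : rightForm α q ∈
      (LinearMap.ker (mfderiv 𝓘(ℝ, E) 𝓘(ℝ, F) (proj H) q).toLinearMap).dualAnnihilator := by
    rw [Submodule.mem_dualAnnihilator]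
    intro v hv
    exact hα _ ((hM.mfderiv_proj_eq_zero_iff q v).mp hv)
  rw [← LinearMap.range_dualMap_eq_dualAnnihilator_ker] at h1
  obtain ⟨β, hβ⟩ := h1
  exact ⟨β, fun v ↦ congrArg (fun L ↦ L v) hβ⟩

/-- The projected horizontal field lies in `Λ^⊥`. -/
theorem IsQuotientManifold.mfderiv_proj_horizontalField_mem
    (hM : IsQuotientManifold (E := E) (F := F) H) (h𝔣 : IsProjectable F H 𝔣)
    (h𝔥𝔣 : isotropyAlgebra F H ≤ 𝔣) (hα : ∀ a ∈ 𝔣, α a = 0) {q : G}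
    (hq : proj H q ∈ nondegenerateLocus F H C) :
    mfderiv 𝓘(ℝ, E) 𝓘(ℝ, F) (proj H) q (horizontalField C α q) ∈
      perpDistribution C 𝔣 (proj H q) := by
  obtain ⟨β, hβ⟩ := hM.exists_momentum (fun a ha ↦ hα a (h𝔥𝔣 ha)) q
  intro w hw
  obtain ⟨a, ha, rfl⟩ := h𝔣.exists_of_mem hw
  rw [← hM.cometric_momentum hβ, metric_cometric hq, hβ]
  exact (congrArg α (rightTrInv_rightField (E := E) q a)).trans (hα a ha)

theorem IsQuotientManifold.mfderiv_proj_horizontalField_ne_zero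
    (hM : IsQuotientManifold (E := E) (F := F) H)
    (h𝔥 : ∀ a ∈ isotropyAlgebra F H, α a = 0) (hα : α ≠ 0) {q : G}
    (hq : proj H q ∈ nondegenerateLocus F H C) :
    mfderiv 𝓘(ℝ, E) 𝓘(ℝ, F) (proj H) q (horizontalField C α q) ≠ 0 := by
  obtain ⟨β, hβ⟩ := hM.exists_momentum h𝔥 q
  intro h
  rw [← hM.cometric_momentum hβ] at h
  have h0 : β = 0 := by rw [← metric_cometric hq β, h, map_zero]
  refine hα (LinearMap.ext fun a ↦ ?_)
  have h1 := hβ (rightField a q)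
  rw [h0] at h1
  exact ((congrArg α (rightTrInv_rightField (E := E) q a)).symm.trans h1.symm)

variable [FiniteDimensional ℝ E]

/-- If `Λ^⊥` has rank 1, left translation by `h ∈ H` preserves `Cᴸ αᴿ` up to a constant.
The factor is found at a single point `q₀`, where it is a factor of `α ∘ Ad h` over `α`, and this
no longer depends on the point. -/
theorem IsQuotientManifold.exists_horizontalField_mul
    (hM : IsQuotientManifold (E := E) (F := F) H) (h𝔣 : IsProjectable F H 𝔣)
    (h𝔥𝔣 : isotropyAlgebra F H ≤ 𝔣) (hα : ∀ a ∈ 𝔣, α a = 0) (hα0 : α ≠ 0)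
    {h : G} (hh : h ∈ H) {q₀ : G} (hq₀ : proj H q₀ ∈ nondegenerateLocus F H C)
    (hrank : Module.finrank ℝ (perpDistribution (F := F) C 𝔣 (proj H q₀)) = 1) :
    ∃ χ : ℝ, χ ≠ 0 ∧ ∀ q : G, (horizontalField C α (h * q) : E) =
      χ • (mfderiv 𝓘(ℝ, E) 𝓘(ℝ, E) (fun y : G ↦ h * y) q (horizontalField C α q) : E) := by
  have h𝔥 : ∀ a ∈ isotropyAlgebra F H, α a = 0 := fun a ha ↦ hα a (h𝔥𝔣 ha)
  have hp : proj H (h * q₀) = proj H q₀ := proj_mul_of_mem hh q₀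
  have hq₁ : proj H (h * q₀) ∈ nondegenerateLocus F H C := by rwa [hp]
  obtain ⟨β, hβ⟩ := hM.exists_momentum h𝔥 q₀
  obtain ⟨β', hβ'⟩ := hM.exists_momentum h𝔥 (h * q₀)
  -- the two momenta are proportional because their velocities span the line `Λ^⊥`
  obtain ⟨χ, hχ0, hχ⟩ : ∃ χ : ℝ, χ ≠ 0 ∧ ∀ v : F, β' v = χ * β v := by
    have hm := hM.mfderiv_proj_horizontalField_mem h𝔣 h𝔥𝔣 hα hq₀
    have hn := hM.mfderiv_proj_horizontalField_ne_zero h𝔥 hα0 hq₀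
    have hm' := hM.mfderiv_proj_horizontalField_mem h𝔣 h𝔥𝔣 hα hq₁
    have hn' := hM.mfderiv_proj_horizontalField_ne_zero h𝔥 hα0 hq₁
    rw [← hM.cometric_momentum hβ] at hm hn
    rw [← hM.cometric_momentum hβ'] at hm' hn'
    revert β'
    rw [hp]
    intro β' _ hm' hn'
    obtain ⟨χ, hχ⟩ := (finrank_eq_one_iff_of_nonzero' (⟨_, hm⟩ : perpDistribution (F := F) C 𝔣
      (proj H q₀)) (fun h ↦ hn (congrArg Subtype.val h))).mp hrank ⟨_, hm'⟩
    have hχ' : χ • cometric C (proj H q₀) β = cometric C (proj H q₀) β' := congrArg Subtype.val hχ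
    refine ⟨χ, ?_, ?_⟩
    · rintro rfl
      rw [zero_smul] at hχ'
      exact hn' hχ'.symm
    · intro v
      have h2 := congrArg (metric C (proj H q₀)) hχ'
      rw [map_smul, metric_cometric hq₀, metric_cometric hq₀] at h2
      exact congrArg (fun L ↦ L v) h2.symm
  -- evaluated on projected right-invariant fields, the proportionality says `α ∘ Ad h = χ • α`
  have hAd : ∀ b : E, α (Ad E h b) = χ * α b := by
    intro b
    have h1 := hβ' (rightField (Ad E h b) (h * q₀))
    have h2 : rightForm α (h * q₀) (rightField (Ad E h b) (h * q₀)) = α (Ad E h b) :=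
      congrArg α (rightTrInv_rightField (h * q₀) (Ad E h b))
    have h3 := hβ (rightField b q₀)
    have h4 : rightForm α q₀ (rightField b q₀) = α b :=
      congrArg α (rightTrInv_rightField q₀ b)
    rw [← h2, ← h1, ← h4, ← h3]
    refine Eq.trans (congrArg β' ?_) (hχ _)
    have h5 := hM.mfderiv_proj_mul_left hh q₀ (rightField b q₀)
    rw [mfderiv_mul_left_rightField] at h5
    exact h5
  refine ⟨χ, hχ0, fun q ↦ ?_⟩
  have hη : bodyVelocity C α (h * q) = χ • bodyVelocity C α q := by
    unfold bodyVelocity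
    rw [← map_smul]
    congr 1
    ext b
    have := hAd (Ad E q b)
    rw [← Ad_mul] at this
    exact this
  rw [horizontalField_eq, horizontalField_eq, hη, ← leftTr_mul]
  exact (leftTr (h * q)).map_smul χ _

end Momentum

/-! ### The cometric in charts -/

/-- The mixed partial derivatives of a function of two variables coincide. -/
theorem fderiv_fderiv_comm {E E' F : Type*} [NormedAddCommGroup E] [NormedSpace ℝ E]
    [NormedAddCommGroup E'] [NormedSpace ℝ E'] [NormedAddCommGroup F] [NormedSpace ℝ F]
    {U : E → E' → F} {x : E} {y : E'} (hU : ContDiffAt ℝ 2 (Function.uncurry U) (x, y))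
    (b : E) (a : E') :
    fderiv ℝ (fun z₁ ↦ fderiv ℝ (fun z₂ ↦ U z₁ z₂) y a) x b =
      fderiv ℝ (fun z₂ ↦ fderiv ℝ (fun z₁ ↦ U z₁ z₂) x b) y a := by
  set D := fderiv ℝ (Function.uncurry U) with hD
  have hev : ∀ᶠ w in 𝓝 (x, y), HasFDerivAt (Function.uncurry U) (D w) w := by
    filter_upwards [hU.eventually (by simp)] with w hw
    exact (hw.differentiableAt (by simp)).hasFDerivAt
  have hD' : HasFDerivAt D (fderiv ℝ D (x, y)) (x, y) :=
    ((hU.fderiv_right (m := 1) (by norm_num)).differentiableAt one_ne_zero).hasFDerivAt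
  have h1 : ∀ z₁ : E, HasFDerivAt (fun z₂ : E' ↦ (z₁, z₂)) (ContinuousLinearMap.inr ℝ E E') y :=
    fun z₁ ↦ hasFDerivAt_prodMk_right z₁ y
  have h2 : ∀ z₂ : E', HasFDerivAt (fun z₁ : E ↦ (z₁, z₂)) (ContinuousLinearMap.inl ℝ E E') x :=
    fun z₂ ↦ hasFDerivAt_prodMk_left x z₂
  have h3 : (fun z₁ ↦ fderiv ℝ (fun z₂ ↦ U z₁ z₂) y a) =ᶠ[𝓝 x] fun z₁ ↦ D (z₁, y) (0, a) := by
    have hc : ContinuousAt (fun z₁ : E ↦ (z₁, y)) x := (h2 y).continuousAt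
    filter_upwards [hc.eventually hev] with z₁ hz
    have := (HasFDerivAt.comp (f := fun z₂ : E' ↦ (z₁, z₂)) y hz (h1 z₁)).fderiv
    exact congrArg (fun L : E' →L[ℝ] F ↦ L a) this
  have h4 : (fun z₂ ↦ fderiv ℝ (fun z₁ ↦ U z₁ z₂) x b) =ᶠ[𝓝 y] fun z₂ ↦ D (x, z₂) (b, 0) := by
    have hc : ContinuousAt (fun z₂ : E' ↦ (x, z₂)) y := (h1 x).continuousAt
    filter_upwards [hc.eventually hev] with z₂ hz
    have := (HasFDerivAt.comp (f := fun z₁ : E ↦ (z₁, z₂)) x hz (h2 z₂)).fderiv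
    exact congrArg (fun L : E →L[ℝ] F ↦ L b) this
  rw [h3.fderiv_eq, h4.fderiv_eq]
  have h5 := ((HasFDerivAt.comp (f := fun z₁ : E ↦ (z₁, y)) x hD' (h2 y)).clm_apply
    (hasFDerivAt_const ((0, a) : E × E') x)).fderiv
  have h6 := ((HasFDerivAt.comp (f := fun z₂ : E' ↦ (x, z₂)) y hD' (h1 x)).clm_apply
    (hasFDerivAt_const ((b, 0) : E × E') y)).fderiv
  have h7 := (hU.isSymmSndFDerivAt (by simp)) (b, 0) (0, a)
  refine (congrArg (fun L : E →L[ℝ] F ↦ L b) h5).trans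
    (Eq.trans ?_ (congrArg (fun L : E' →L[ℝ] F ↦ L a) h6).symm)
  simpa using h7

/-- The derivative at a point of a vector-valued map, read in the preferred chart there. -/
theorem fderiv_comp_extChartAt_symm {E F P : Type*} [NormedAddCommGroup E] [NormedSpace ℝ E]
    [NormedAddCommGroup F] [NormedSpace ℝ F] [TopologicalSpace P] [ChartedSpace E P]
    [IsManifold 𝓘(ℝ, E) 1 P] {f : P → F} {x : P} (hf : MDifferentiableAt 𝓘(ℝ, E) 𝓘(ℝ, F) f x) :
    HasFDerivAt (fun z ↦ f ((extChartAt 𝓘(ℝ, E) x).symm z))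
      (vectorDiff f x : E →L[ℝ] F) (extChartAt 𝓘(ℝ, E) x x) := by
  have h1 := mfderiv_extChartAt_symm_self (E := E) x
  have h3 := HasMFDerivAt.comp (extChartAt 𝓘(ℝ, E) x x) (g := f)
    (by rw [extChartAt_to_inv]; exact hf.hasMFDerivAt) h1
  have h4 : HasFDerivAt (fun z ↦ f ((extChartAt 𝓘(ℝ, E) x).symm z))
    ((mfderiv 𝓘(ℝ, E) 𝓘(ℝ, F) f x : E →L[ℝ] F) ∘L ContinuousLinearMap.id ℝ E)
    (extChartAt 𝓘(ℝ, E) x x) := hasMFDerivAt_iff_hasFDerivAt.mp h3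
  exact h4

section ChartCometric

variable {E : Type*} [NormedAddCommGroup E] [NormedSpace ℝ E]
  {G : Type*} [TopologicalSpace G] [ChartedSpace E G] [Group G]
  {H : Subgroup G} {F : Type*} [NormedAddCommGroup F] [NormedSpace ℝ F]
  [ChartedSpace F (RightCosets H)]

variable (E) in
/-- The generators of the right action of the group at `p`, in the chart of the space of cosets
around `p₀`. -/
noncomputable def orbitCoord (p₀ p : RightCosets H) : E →L[ℝ] F :=
  fderiv ℝ (fun z ↦ extChartAt 𝓘(ℝ, F) p₀ (orbitMap p ((extChartAt 𝓘(ℝ, E) (1 : G)).symm z)))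
    (extChartAt 𝓘(ℝ, E) (1 : G) 1)

variable (E) in
/-- The differentials of the maps `x ↦ H x q` at `1`, in the chart of the space of cosets
around `p₀`. -/
noncomputable def rightCoord (p₀ : RightCosets H) (q : G) : E →L[ℝ] F :=
  fderiv ℝ (fun z ↦ extChartAt 𝓘(ℝ, F) p₀ (proj H ((extChartAt 𝓘(ℝ, E) (1 : G)).symm z * q)))
    (extChartAt 𝓘(ℝ, E) (1 : G) 1)

variable [LieGroup 𝓘(ℝ, E) ∞ G]

theorem IsQuotientManifold.contMDiffAt_rightCoord (hM : IsQuotientManifold (E := E) (F := F) H)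
    {p₀ : RightCosets H} {q : G} (hp : proj H q ∈ (chartAt F p₀).source) :
    ContMDiffAt 𝓘(ℝ, E) 𝓘(ℝ, E →L[ℝ] F) ∞ (rightCoord E p₀ : G → E →L[ℝ] F) q := by
  have := hM.isManifold
  have h1 : ContMDiff (𝓘(ℝ, E).prod 𝓘(ℝ, E)) 𝓘(ℝ, F) ∞
      (Function.uncurry fun (q x : G) ↦ proj H (x * q)) :=
    hM.contMDiff_proj.comp (contMDiff_snd.mul contMDiff_fst)
  exact contMDiffAt_partial_fderiv (n₀ := q) (x := (1 : G)) (h1 (q, 1)) (by rwa [one_mul])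

theorem IsQuotientManifold.rightCoord_apply (hM : IsQuotientManifold (E := E) (F := F) H)
    {p₀ : RightCosets H} {q : G} (hp : proj H q ∈ (chartAt F p₀).source) (a : E) :
    rightCoord E p₀ q a =
      chartDiff F p₀ (proj H q)
        (mfderiv 𝓘(ℝ, E) 𝓘(ℝ, F) (proj H) q (rightField a q)) := by
  have := hM.isManifold
  have hd : MDifferentiableAt 𝓘(ℝ, E) 𝓘(ℝ, F) (fun x : G ↦ proj H (x * q)) 1 :=
    MDifferentiableAt.comp (1 : G) (hM.mdifferentiableAt_proj _)
      (mdifferentiableAt_mul_right' q (1 : G))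
  have h1 := fderiv_extChartAt_comp hd (p₀ := p₀) (by rwa [one_mul]) a
  refine h1.trans ?_
  have h2 := mfderiv_mfderiv_of_comp (h := fun x ↦ proj H (x * q))
    (mdifferentiableAt_mul_right' q (1 : G)) (hM.mdifferentiableAt_proj q) (one_mul q)
    (fun _ ↦ rfl) a
  rw [one_mul]
  exact congrArg (chartDiff F p₀ (proj H q)) h2.symm

theorem IsQuotientManifold.surjective_rightCoord (hM : IsQuotientManifold (E := E) (F := F) H)
    {p₀ : RightCosets H} {q : G} (hp : proj H q ∈ (chartAt F p₀).source) :
    Function.Surjective (rightCoord E p₀ q : E →L[ℝ] F) := by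
  have := hM.isManifold
  intro w
  obtain ⟨v, hv⟩ := (bijective_chartDiff hp).2 w
  obtain ⟨u, rfl⟩ := hM.surjective_mfderiv_proj q v
  refine ⟨rightTrInv q u, (hM.rightCoord_apply hp _).trans ?_⟩
  have h1 := rightField_rightTrInv q u
  rw [h1]
  exact hv

variable [FiniteDimensional ℝ F]

theorem IsQuotientManifold.orbitCoord_apply (hM : IsQuotientManifold (E := E) (F := F) H)
    {p₀ p : RightCosets H} (hp : p ∈ (chartAt F p₀).source) (a : E) :
    orbitCoord E p₀ p a =
      chartDiff F p₀ p (generator p a) := by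
  have := hM.isManifold
  have h1 := fderiv_extChartAt_comp (hM.mdifferentiableAt_orbitMap p 1) (p₀ := p₀)
    (by rwa [orbitMap_one]) a
  refine h1.trans ?_
  rw [orbitMap_one]
  rfl

theorem IsQuotientManifold.orbitCoord_proj (hM : IsQuotientManifold (E := E) (F := F) H)
    {p₀ : RightCosets H} {q : G} (hp : proj H q ∈ (chartAt F p₀).source) (a : E) :
    orbitCoord E p₀ (proj H q) a =
      chartDiff F p₀ (proj H q)
        (mfderiv 𝓘(ℝ, E) 𝓘(ℝ, F) (proj H) q (leftTr q a)) := by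
  exact (hM.orbitCoord_apply hp a).trans (congrArg _ (hM.generator_proj q a))

theorem IsQuotientManifold.contMDiffAt_orbitCoord (hM : IsQuotientManifold (E := E) (F := F) H)
    {p₀ p : RightCosets H} (hp : p ∈ (chartAt F p₀).source) :
    ContMDiffAt 𝓘(ℝ, F) 𝓘(ℝ, E →L[ℝ] F) ∞ (orbitCoord E p₀ : RightCosets H → E →L[ℝ] F) p := by
  have := hM.isManifold
  exact contMDiffAt_partial_fderiv (n₀ := p) (x := (1 : G)) (hM.contMDiff_orbitMap (p, 1))
    (by rwa [orbitMap_one])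

variable [FiniteDimensional ℝ E]
  {C : GroupLieAlgebra 𝓘(ℝ, E) G ⊗[ℝ] GroupLieAlgebra 𝓘(ℝ, E) G}

/-- In the chart around `p₀`, the tensor `C^π` is the push-forward of `C` along the generators of
the action. -/
theorem IsQuotientManifold.pushCometric_orbitCoord (hM : IsQuotientManifold (E := E) (F := F) H)
    {p₀ p : RightCosets H} (hp : p ∈ (chartAt F p₀).source) (β : F →L[ℝ] ℝ) :
    pushCometric (contractL C) (orbitCoord E p₀ p) β =
      chartDiff F p₀ p (cometric C p ((β : F →ₗ[ℝ] ℝ) ∘ₗ (chartDiff F p₀ p).toLinearMap)) := by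
  rw [pushCometric_apply]
  refine (hM.orbitCoord_apply hp _).trans ?_
  rw [contractL_apply]
  have h1 : ((β ∘L orbitCoord E p₀ p : E →L[ℝ] ℝ) : E →ₗ[ℝ] ℝ) =
      (generator (F := F) p).dualMap ((β : F →ₗ[ℝ] ℝ) ∘ₗ
        (chartDiff F p₀ p).toLinearMap) :=
    LinearMap.ext fun a ↦ congrArg β (hM.orbitCoord_apply hp a)
  rw [h1]
  rfl

theorem IsQuotientManifold.bijective_pushCometric_iff
    (hM : IsQuotientManifold (E := E) (F := F) H) {p₀ p : RightCosets H}
    (hp : p ∈ (chartAt F p₀).source) :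
    Function.Bijective (pushCometric (contractL C) (orbitCoord E p₀ p : E →L[ℝ] F)) ↔
      p ∈ nondegenerateLocus F H C := by
  have := hM.isManifold
  set θ := chartDiff F p₀ p with hθ
  have hb : Function.Bijective θ := bijective_chartDiff hp
  let θe : TangentSpace 𝓘(ℝ, F) p ≃ₗ[ℝ] F := LinearEquiv.ofBijective θ.toLinearMap hb
  let d : (F →L[ℝ] ℝ) ≃ₗ[ℝ] Module.Dual ℝ (TangentSpace 𝓘(ℝ, F) p) :=
    (LinearMap.toContinuousLinearMap (𝕜 := ℝ) (E := F) (F' := ℝ)).symm.trans θe.dualMap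
  have h1 : ⇑(pushCometric (contractL C) (orbitCoord E p₀ p : E →L[ℝ] F)) =
      θ ∘ (cometric C p) ∘ d := funext fun β ↦ hM.pushCometric_orbitCoord hp β
  rw [h1, hb.of_comp_iff' (cometric C p ∘ d), Function.Bijective.of_comp_iff (cometric C p)
    d.bijective]
  rfl

/-- In charts too, the metric is inverse to the cometric. -/
theorem IsQuotientManifold.chartMetric_pushCometric
    (hM : IsQuotientManifold (E := E) (F := F) H) {p₀ : RightCosets H} {y : F}
    (hy : y ∈ (extChartAt 𝓘(ℝ, F) p₀).target)
    (hp : (extChartAt 𝓘(ℝ, F) p₀).symm y ∈ nondegenerateLocus F H C) (β : F →L[ℝ] ℝ) (v : F) :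
    chartMetric C p₀ y (pushCometric (contractL C)
      (orbitCoord E p₀ ((extChartAt 𝓘(ℝ, F) p₀).symm y)) β) v = β v := by
  have := hM.isManifold
  have hsrc : (extChartAt 𝓘(ℝ, F) p₀).symm y ∈ (chartAt F p₀).source := by
    rw [← extChartAt_source 𝓘(ℝ, F)]
    exact (extChartAt 𝓘(ℝ, F) p₀).map_target hy
  have h1 := mfderiv_extChartAt_comp_mfderivWithin_extChartAt_symm hy
  have h2 := mfderivWithin_extChartAt_symm_comp_mfderiv_extChartAt hy
  simp only [modelWithCornersSelf_coe, Set.range_id, mfderivWithin_univ] at h1 h2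
  unfold chartMetric
  rw [hM.pushCometric_orbitCoord hsrc]
  have h3 : ∀ u, mfderiv 𝓘(ℝ, F) 𝓘(ℝ, F) (extChartAt 𝓘(ℝ, F) p₀).symm y
      (chartDiff F p₀ ((extChartAt 𝓘(ℝ, F) p₀).symm y) u) = u :=
    fun u ↦ congrArg (fun L ↦ L u) h2
  rw [h3, metric_cometric hp]
  exact congrArg β (congrArg (fun L ↦ L v) h1)

end ChartCometric

/-! ### Projections of integral curves are geodesics -/

theorem isInvertible_of_bijective {V W : Type*} [NormedAddCommGroup V] [NormedSpace ℝ V]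
    [FiniteDimensional ℝ V] [NormedAddCommGroup W] [NormedSpace ℝ W] {L : V →L[ℝ] W}
    (hL : Function.Bijective L) : L.IsInvertible :=
  ⟨(LinearEquiv.ofBijective L.toLinearMap hL).toContinuousLinearEquiv, by ext; rfl⟩

theorem eventually_isInvertible {V W X : Type*} [NormedAddCommGroup V] [NormedSpace ℝ V]
    [CompleteSpace V] [NormedAddCommGroup W] [NormedSpace ℝ W] [TopologicalSpace X]
    {L : X → V →L[ℝ] W} {x : X} (hL : ContinuousAt L x) (hx : (L x).IsInvertible) :
    ∀ᶠ y in 𝓝 x, (L y).IsInvertible := by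
  obtain ⟨e, he⟩ := hx
  have h1 := ContinuousLinearEquiv.nhds e
  rw [he] at h1
  exact hL h1

section Geodesics

variable {E : Type*} [NormedAddCommGroup E] [NormedSpace ℝ E]
  {G : Type*} [TopologicalSpace G] [ChartedSpace E G] [Group G] [LieGroup 𝓘(ℝ, E) ∞ G]
  {H : Subgroup G} {F : Type*} [NormedAddCommGroup F] [NormedSpace ℝ F]
  [ChartedSpace F (RightCosets H)]

/-- The partial derivatives at the identity of `(x, y) ↦ H x q y` in the two factors are
`rightCoord` and `orbitCoord`; by the symmetry of second derivatives, the derivative of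
`rightCoord` along a left-invariant field is the derivative of `orbitCoord` along a projected
right-invariant field. -/
theorem IsQuotientManifold.mfderiv_rightCoord_leftTr
    (hM : IsQuotientManifold (E := E) (F := F) H) {p₀ : RightCosets H} {q : G}
    (hp : proj H q ∈ (chartAt F p₀).source) {Φ' : F →L[ℝ] E →L[ℝ] F}
    (hΦ : HasFDerivAt (fun y ↦ orbitCoord E p₀ ((extChartAt 𝓘(ℝ, F) p₀).symm y)) Φ'
      (extChartAt 𝓘(ℝ, F) p₀ (proj H q))) (a b : E) :
    vectorDiff (rightCoord E p₀ : G → E →L[ℝ] F) q (leftTr q a) b = Φ' (rightCoord E p₀ q b) a := by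
  have := hM.isManifold
  set e := extChartAt 𝓘(ℝ, E) (1 : G) with he
  set z₀ := e 1 with hz₀
  set φ := extChartAt 𝓘(ℝ, F) p₀ with hφ
  have he1 : e.symm z₀ = 1 := extChartAt_to_inv 1
  set U : E → E → F := fun z₁ z₂ ↦ φ (proj H (e.symm z₁ * q * e.symm z₂)) with hU
  have hesymm : ContMDiffAt 𝓘(ℝ, E) 𝓘(ℝ, E) ∞ e.symm z₀ :=
    (contMDiffOn_extChartAt_symm (1 : G)).contMDiffAt (extChartAt_target_mem_nhds (1 : G))
  have hUc : ContDiffAt ℝ 2 (Function.uncurry U) (z₀, z₀) := by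
    have h1 : ContMDiffAt 𝓘(ℝ, E × E) 𝓘(ℝ, E) ∞
        (fun w : E × E ↦ e.symm w.1 * q * e.symm w.2) (z₀, z₀) :=
      ((ContMDiffAt.comp (I' := 𝓘(ℝ, E)) (z₀, z₀) hesymm contDiff_fst.contDiffAt.contMDiffAt).mul
        contMDiffAt_const).mul
        (ContMDiffAt.comp (I' := 𝓘(ℝ, E)) (z₀, z₀) hesymm contDiff_snd.contDiffAt.contMDiffAt)
    have h2 := ContMDiffAt.comp (I' := 𝓘(ℝ, E)) (z₀, z₀) (g := proj H)
      hM.contMDiff_proj.contMDiffAt h1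
    have h3 := ContMDiffAt.comp (I' := 𝓘(ℝ, F)) (z₀, z₀) (g := φ)
      (contMDiffAt_extChartAt' (by simpa [he1] using hp)) h2
    exact_mod_cast contDiffAt_infty.mp (contMDiffAt_iff_contDiffAt.mp h3) 2
  -- the derivative of `rightCoord`
  have h1 : vectorDiff (rightCoord E p₀ : G → E →L[ℝ] F) q (leftTr q a) b =
      fderiv ℝ (fun z₂ ↦ fderiv ℝ (fun z₁ ↦ U z₁ z₂) z₀ b) z₀ a := by
    have hd : MDifferentiableAt 𝓘(ℝ, E) 𝓘(ℝ, E →L[ℝ] F) (rightCoord E p₀ : G → E →L[ℝ] F) q :=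
      (hM.contMDiffAt_rightCoord hp).mdifferentiableAt (by simp)
    have h2 := mfderiv_mfderiv_of_comp (h := fun g ↦ (rightCoord E p₀ (q * g) : E →L[ℝ] F))
      (mdifferentiableAt_mul_left' q (1 : G)) hd (mul_one q) (fun _ ↦ rfl) a
    have hd' : MDifferentiableAt 𝓘(ℝ, E) 𝓘(ℝ, E →L[ℝ] F)
        (fun g : G ↦ (rightCoord E p₀ (q * g) : E →L[ℝ] F)) 1 :=
      MDifferentiableAt.comp (1 : G) (by rwa [mul_one]) (mdifferentiableAt_mul_left' q (1 : G))
    have h3 := fderiv_comp_extChartAt_symm hd'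
    have h4 := (h3.clm_apply (hasFDerivAt_const b z₀)).fderiv
    have h5 : (fun z₂ ↦ fderiv ℝ (fun z₁ ↦ U z₁ z₂) z₀ b) =
        fun z₂ ↦ (rightCoord E p₀ (q * e.symm z₂) : E →L[ℝ] F) b := by
      funext z₂
      simp only [hU, mul_assoc]
      rfl
    rw [h5, h4]
    refine (congrArg (fun L : E →L[ℝ] F ↦ L b) h2).trans ?_
    simp only [ContinuousLinearMap.comp_zero, zero_add]
    rfl
  -- the derivative of `orbitCoord`
  have h2 : Φ' (rightCoord E p₀ q b) a = fderiv ℝ (fun z₁ ↦ fderiv ℝ (U z₁) z₀ a) z₀ b := by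
    have hS : HasFDerivAt (fun z₁ ↦ φ (proj H (e.symm z₁ * q))) (rightCoord E p₀ q) z₀ := by
      have h3 : ContMDiffAt 𝓘(ℝ, E) 𝓘(ℝ, E) ∞ (fun w : E ↦ e.symm w * q) z₀ :=
        hesymm.mul contMDiffAt_const
      have h4 := ContMDiffAt.comp (I' := 𝓘(ℝ, E)) z₀ (g := proj H)
        hM.contMDiff_proj.contMDiffAt h3
      have h5 := ContMDiffAt.comp (I' := 𝓘(ℝ, F)) z₀ (g := φ)
        (contMDiffAt_extChartAt' (by simpa [he1] using hp)) h4
      exact ((contMDiffAt_iff_contDiffAt.mp h5).differentiableAt (by simp)).hasFDerivAt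
    have hΦ' : HasFDerivAt (fun y ↦ orbitCoord E p₀ (φ.symm y)) Φ'
        (φ (proj H (e.symm z₀ * q))) := by rw [he1, one_mul]; exact hΦ
    have h3 := ((HasFDerivAt.comp (f := fun z₁ ↦ φ (proj H (e.symm z₁ * q))) z₀ hΦ' hS).clm_apply
      (hasFDerivAt_const a z₀)).fderiv
    have h4 : (fun z₁ ↦ fderiv ℝ (U z₁) z₀ a) =ᶠ[𝓝 z₀] fun z₁ ↦
        ((fun y ↦ orbitCoord E p₀ (φ.symm y)) ∘ fun z₁ ↦ φ (proj H (e.symm z₁ * q))) z₁ a := by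
      have hc : ContinuousAt (fun z₁ ↦ proj H (e.symm z₁ * q)) z₀ :=
        ContinuousAt.comp (g := proj H) hM.contMDiff_proj.continuous.continuousAt
          (hesymm.mul contMDiffAt_const).continuousAt
      have hsrc : φ.source ∈ 𝓝 (proj H (e.symm z₀ * q)) := by
        rw [he1, one_mul]
        exact extChartAt_source_mem_nhds' (by rwa [extChartAt_source])
      filter_upwards [hc.preimage_mem_nhds hsrc] with z₁ hz₁
      have h6 : φ.symm (φ (proj H (e.symm z₁ * q))) = proj H (e.symm z₁ * q) := φ.left_inv hz₁
      simp only [Function.comp, h6]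
      rfl
    rw [h4.fderiv_eq, h3]
    simp
  rw [h1, h2]
  exact (fderiv_fderiv_comm hUc b a).symm

variable [FiniteDimensional ℝ E] [FiniteDimensional ℝ F]
  {C : GroupLieAlgebra 𝓘(ℝ, E) G ⊗[ℝ] GroupLieAlgebra 𝓘(ℝ, E) G}
  {α : Module.Dual ℝ (GroupLieAlgebra 𝓘(ℝ, E) G)}

/-- The projected horizontal field in a chart of the space of cosets. -/
theorem IsQuotientManifold.chartDiff_horizontalField
    (hM : IsQuotientManifold (E := E) (F := F) H) {p₀ : RightCosets H} {q : G}
    (hp : proj H q ∈ (chartAt F p₀).source) :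
    chartDiff F p₀ (proj H q)
      (mfderiv 𝓘(ℝ, E) 𝓘(ℝ, F) (proj H) q (horizontalField C α q)) =
      orbitCoord E p₀ (proj H q) (bodyVelocity C α q) := by
  rw [horizontalField_eq]
  exact (hM.orbitCoord_proj hp _).symm

/-- The geodesic equation for projections of integral curves of `Cᴸ αᴿ`. The covector `ξ` along the
projection whose pull-back is `αᴿ` satisfies Hamilton's equations: it corresponds to the velocity
under the cometric, and its pairing with the projections of right-invariant fields is constant. -/
theorem IsQuotientManifold.geodesic_equation (hM : IsQuotientManifold (E := E) (F := F) H)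
    (hC : TensorProduct.comm ℝ _ _ C = C) (hα : ∀ a ∈ isotropyAlgebra F H, α a = 0)
    {γ : ℝ → G} {t : ℝ} (hγ : ∀ᶠ τ in 𝓝 t, HasVelocityAt γ τ (horizontalField C α (γ τ)))
    (ht : proj H (γ t) ∈ nondegenerateLocus F H C) {p₀ : RightCosets H}
    (hp : proj H (γ t) ∈ (chartAt F p₀).source) {x : ℝ → F}
    (hx : x = extChartAt 𝓘(ℝ, F) p₀ ∘ proj H ∘ γ) (w : F) :
    chartMetric C p₀ (x t) (deriv (deriv x) t) w
      + christoffel C p₀ (x t) (deriv x t) (deriv x t) w = 0 := by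
  have := hM.isManifold
  have hFc : CompleteSpace F := FiniteDimensional.complete ℝ F
  set φ := extChartAt 𝓘(ℝ, F) p₀ with hφ
  set T : (E →L[ℝ] ℝ) →L[ℝ] E := contractL C with hT
  set Φ : F → E →L[ℝ] F := fun y ↦ orbitCoord E p₀ (φ.symm y) with hΦ
  have hγt : HasVelocityAt γ t (horizontalField C α (γ t)) := hγ.self_of_nhds
  have hcont : ContinuousAt (fun τ ↦ proj H (γ τ)) t :=
    ContinuousAt.comp (g := proj H) hM.contMDiff_proj.continuous.continuousAt hγt.continuousAt
  have hsrc : ∀ᶠ τ in 𝓝 t, proj H (γ τ) ∈ (chartAt F p₀).source :=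
    hcont.eventually ((chartAt F p₀).open_source.mem_nhds hp)
  have hps : proj H (γ t) ∈ φ.source := by rwa [extChartAt_source]
  have hxt : x t = φ (proj H (γ t)) := by rw [hx]; rfl
  have hφx : φ.symm (x t) = proj H (γ t) := by rw [hxt]; exact φ.left_inv hps
  have htarget : φ.target ∈ 𝓝 (x t) := by
    rw [hxt]
    exact extChartAt_target_mem_nhds' (φ.map_source hps)
  -- smoothness of the generators in the chart
  have hΦc : ContDiffAt ℝ ∞ Φ (x t) := by
    rw [← contMDiffAt_iff_contDiffAt]
    refine ContMDiffAt.comp (I' := 𝓘(ℝ, F)) (x t) (g := orbitCoord E p₀) ?_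
      ((contMDiffOn_extChartAt_symm p₀).contMDiffAt htarget)
    rw [hφx]
    exact hM.contMDiffAt_orbitCoord hp
  have hΦd : HasFDerivAt Φ (fderiv ℝ Φ (x t)) (x t) :=
    (hΦc.differentiableAt (by simp)).hasFDerivAt
  have hKc : ContinuousAt (fun y ↦ pushCometric T (Φ y)) (x t) :=
    ContinuousAt.comp (g := pushCometric T)
      (contDiff_pushCometric T (n := 1)).continuous.continuousAt hΦc.continuousAt
  have hinv : ∀ᶠ y in 𝓝 (x t), (pushCometric T (Φ y)).IsInvertible := by
    refine eventually_isInvertible hKc (isInvertible_of_bijective ?_)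
    simp only [hΦ, hφx]
    exact (hM.bijective_pushCometric_iff hp).mpr ht
  have hmetric : ∀ᶠ y in 𝓝 (x t), ∀ β v, chartMetric C p₀ y (pushCometric T (Φ y) β) v = β v := by
    filter_upwards [hinv, htarget] with y hy hyt β v
    refine hM.chartMetric_pushCometric hyt ?_ β v
    refine (hM.bijective_pushCometric_iff (p₀ := p₀) ?_).mp hy.bijective
    rw [← extChartAt_source 𝓘(ℝ, F)]
    exact φ.map_target hyt
  -- the momentum along the curve, in the chart (and `0` at times when the curve is not in it)
  have hξex : ∀ τ, ∃ ξ : F →L[ℝ] ℝ, proj H (γ τ) ∈ (chartAt F p₀).source →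
      ∀ v : TangentSpace 𝓘(ℝ, E) (γ τ), ξ (chartDiff F p₀ (proj H (γ τ))
        (mfderiv 𝓘(ℝ, E) 𝓘(ℝ, F) (proj H) (γ τ) v)) = rightForm α (γ τ) v := by
    intro τ
    by_cases hτ : proj H (γ τ) ∈ (chartAt F p₀).source
    · obtain ⟨β, hβ⟩ := hM.exists_momentum hα (γ τ)
      let θ : TangentSpace 𝓘(ℝ, F) (proj H (γ τ)) ≃ₗ[ℝ] F :=
        LinearEquiv.ofBijective (chartDiff F p₀ (proj H (γ τ))).toLinearMap (bijective_chartDiff hτ)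
      refine ⟨LinearMap.toContinuousLinearMap (β ∘ₗ θ.symm.toLinearMap), fun _ v ↦ ?_⟩
      rw [← hβ]
      exact congrArg β (θ.symm_apply_apply _)
    · exact ⟨0, fun h ↦ absurd h hτ⟩
  choose ξ hξ using hξex
  have hξΦ : ∀ τ, proj H (γ τ) ∈ (chartAt F p₀).source →
      ξ τ ∘L orbitCoord E p₀ (proj H (γ τ)) = dualL α ∘L Ad E (γ τ) := by
    intro τ hτ
    ext a
    have h1 := hξ τ hτ (leftTr (γ τ) a)
    refine (congrArg (ξ τ) (hM.orbitCoord_proj hτ a)).trans (h1.trans ?_)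
    exact (congrArg α (Ad_eq_rightTrInv_leftTr (γ τ) a)).symm
  have hvel : ∀ᶠ τ in 𝓝 t, HasDerivAt x
      (orbitCoord E p₀ (proj H (γ τ)) (bodyVelocity C α (γ τ))) τ := by
    filter_upwards [hγ, hsrc] with τ hτ hτs
    have h1 := (hτ.comp_map (hM.mdifferentiableAt_proj (γ τ))).hasDerivAt hτs
    rw [hx]
    exact h1.congr_deriv (hM.chartDiff_horizontalField hτs)
  have hvel' : ∀ᶠ τ in 𝓝 t, HasDerivAt x (pushCometric T (Φ (x τ)) (ξ τ)) τ := by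
    filter_upwards [hvel, hsrc] with τ hτ hτs
    have h1 : φ.symm (x τ) = proj H (γ τ) := by
      rw [hx]
      exact φ.left_inv (by rwa [extChartAt_source])
    rw [pushCometric_apply, hΦ]
    simp only [h1]
    rw [hξΦ τ hτs]
    exact hτ
  have hacc : DifferentiableAt ℝ (deriv x) t := by
    have h1 : deriv x =ᶠ[𝓝 t] fun τ ↦
        orbitCoord E p₀ (proj H (γ τ)) (bodyVelocity C α (γ τ)) := by
      filter_upwards [hvel] with τ hτ using hτ.deriv
    refine DifferentiableAt.congr_of_eventuallyEq ?_ h1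
    have h2 : MDifferentiableAt 𝓘(ℝ, E) 𝓘(ℝ, E →L[ℝ] F)
        (orbitCoord E p₀ ∘ proj H : G → E →L[ℝ] F) (γ t) :=
      MDifferentiableAt.comp (γ t) ((hM.contMDiffAt_orbitCoord hp).mdifferentiableAt (by simp))
        (hM.mdifferentiableAt_proj _)
    have h3 := MDifferentiableAt.comp t h2 (HasMFDerivAt.mdifferentiableAt hγt)
    have h4 := MDifferentiableAt.comp t
      ((contMDiff_bodyVelocity C α).contMDiffAt.mdifferentiableAt (by simp))
      (HasMFDerivAt.mdifferentiableAt hγt)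
    exact (mdifferentiableAt_iff_differentiableAt.mp h3).clm_apply
      (mdifferentiableAt_iff_differentiableAt.mp h4)
  refine geodesic_equation_of_hamilton (contractL_symm hC) hΦd hinv hmetric hvel' hacc ?_ w
  intro ξ' hξ' w
  obtain ⟨b, rfl⟩ := hM.surjective_rightCoord hp w
  -- Noether: the pairing with projected right-invariant fields is constant
  have hconst : (fun τ ↦ ξ τ (rightCoord E p₀ (γ τ) b)) =ᶠ[𝓝 t] fun _ ↦ α b := by
    filter_upwards [hsrc] with τ hτ
    refine (congrArg (ξ τ) (hM.rightCoord_apply hτ b)).trans ?_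
    rw [hξ τ hτ]
    exact congrArg α (rightTrInv_rightField (γ τ) b)
  have hρ := hγt.hasDerivAt_comp ((hM.contMDiffAt_rightCoord hp).mdifferentiableAt (by simp))
  have h1 := (hξ'.clm_apply (hρ.clm_apply (hasDerivAt_const t b))).unique
    ((hasDerivAt_const t (α b)).congr_of_eventuallyEq hconst)
  have h2 : vectorDiff (rightCoord E p₀ : G → E →L[ℝ] F) (γ t) (horizontalField C α (γ t)) b =
      fderiv ℝ Φ (x t) (rightCoord E p₀ (γ t) b) (bodyVelocity C α (γ t)) := by
    rw [horizontalField_eq]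
    exact hM.mfderiv_rightCoord_leftTr hp (by rw [← hxt]; exact hΦd) _ b
  have h3 : T (ξ t ∘L Φ (x t)) = bodyVelocity C α (γ t) := by
    simp only [hΦ, hφx]
    rw [hξΦ t hp]
    rfl
  rw [h3, ← h2]
  simp only [map_zero, add_zero] at h1
  linarith

end Geodesics

/-! ### Integral curves of smooth vector fields -/

section IntegralCurves

variable {E : Type*} [NormedAddCommGroup E] [NormedSpace ℝ E]
  {P : Type*} [TopologicalSpace P] [ChartedSpace E P]

theorem _root_.IsMIntegralCurveOn.hasVelocityAt {γ : ℝ → P} {X : ∀ p : P, TangentSpace 𝓘(ℝ, E) p}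
    {J : Set ℝ} (h : IsMIntegralCurveOn γ X J) (hJ : IsOpen J) {t : ℝ} (ht : t ∈ J) :
    HasVelocityAt γ t (X (γ t)) :=
  (h t ht).hasMFDerivAt (hJ.mem_nhds ht)

variable [IsManifold 𝓘(ℝ, E) ∞ P]

/-- A vector field whose components in charts are smooth is a smooth section. -/
theorem contMDiffAt_section_of_chartDiff {X : ∀ p : P, TangentSpace 𝓘(ℝ, E) p} {p : P}
    (hX : ContMDiffAt 𝓘(ℝ, E) 𝓘(ℝ, E) ∞ (fun x ↦ chartDiff E p x (X x)) p) :
    ContMDiffAt 𝓘(ℝ, E) (𝓘(ℝ, E).prod 𝓘(ℝ, E)) 1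
      (fun x ↦ (⟨x, X x⟩ : TangentBundle 𝓘(ℝ, E) P)) p := by
  rw [Bundle.contMDiffAt_section]
  refine (hX.of_le (by exact_mod_cast le_top)).congr_of_eventuallyEq ?_
  filter_upwards [(chartAt E p).open_source.mem_nhds (mem_chart_source E p)] with x hx
  have h1 := TangentBundle.continuousLinearMapAt_trivializationAt (I := 𝓘(ℝ, E)) hx
  have h2 : x ∈ (trivializationAt E (TangentSpace 𝓘(ℝ, E)) p).baseSet := by
    simpa using hx
  rw [← Bundle.Trivialization.continuousLinearMapAt_apply_of_mem ℝ _ h2, h1]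
  rfl

/-- Integral curves of smooth vector fields are smooth. -/
theorem contMDiffOn_of_hasVelocityAt {X : ∀ p : P, TangentSpace 𝓘(ℝ, E) p}
    (hX : ∀ p₀ p : P, p ∈ (chartAt E p₀).source →
      ContMDiffAt 𝓘(ℝ, E) 𝓘(ℝ, E) ∞ (fun x ↦ chartDiff E p₀ x (X x)) p)
    {γ : ℝ → P} {J : Set ℝ} (hJ : IsOpen J) (hγ : ∀ t ∈ J, HasVelocityAt γ t (X (γ t))) :
    ContMDiffOn 𝓘(ℝ, ℝ) 𝓘(ℝ, E) ∞ γ J := by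
  have hcont : ContinuousOn γ J := fun t ht ↦ (hγ t ht).continuousAt.continuousWithinAt
  suffices h : ∀ n : ℕ, ContMDiffOn 𝓘(ℝ, ℝ) 𝓘(ℝ, E) n γ J from contMDiffOn_infty.mpr h
  intro n
  induction n with
  | zero => exact contMDiffOn_zero_iff.mpr hcont
  | succ n ih =>
    intro t₀ ht₀
    set φ := extChartAt 𝓘(ℝ, E) (γ t₀) with hφ
    set U : Set ℝ := J ∩ γ ⁻¹' (chartAt E (γ t₀)).source with hU
    have hUo : IsOpen U := hcont.isOpen_inter_preimage hJ (chartAt E (γ t₀)).open_source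
    have htU : t₀ ∈ U := ⟨ht₀, mem_chart_source E (γ t₀)⟩
    have hd : ∀ t ∈ U, HasDerivAt (φ ∘ γ) (chartDiff E (γ t₀) (γ t) (X (γ t))) t :=
      fun t ht ↦ (hγ t ht.1).hasDerivAt ht.2
    have hc : ContDiffOn ℝ ((n : WithTop ℕ∞) + 1) (φ ∘ γ) U := by
      rw [contDiffOn_succ_iff_deriv_of_isOpen hUo]
      refine ⟨fun t ht ↦ (hd t ht).differentiableAt.differentiableWithinAt, by simp, ?_⟩
      have h1 : ContDiffOn ℝ n (fun t ↦ chartDiff E (γ t₀) (γ t) (X (γ t))) U := by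
        rw [← contMDiffOn_iff_contDiffOn]
        intro t ht
        have h2 := (hX (γ t₀) (γ t) ht.2).of_le (n := ∞) (m := n) (by exact_mod_cast le_top)
        exact ContMDiffAt.comp_contMDiffWithinAt t h2 ((ih t ht.1).mono Set.inter_subset_left)
      exact h1.congr fun t ht ↦ (hd t ht).deriv
    have h3 : ContMDiffAt 𝓘(ℝ, ℝ) 𝓘(ℝ, E) ((n : WithTop ℕ∞) + 1) (φ ∘ γ) t₀ :=
      (contMDiffOn_iff_contDiffOn.mpr hc).contMDiffAt (hUo.mem_nhds htU)
    have h4 : ContMDiffAt 𝓘(ℝ, E) 𝓘(ℝ, E) ((n : WithTop ℕ∞) + 1) φ.symm (φ (γ t₀)) :=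
      ((contMDiffOn_extChartAt_symm (n := ∞) (γ t₀)).contMDiffAt
        (extChartAt_target_mem_nhds (γ t₀))).of_le (by exact_mod_cast le_top)
    have h5 := ContMDiffAt.comp t₀ (g := φ.symm) h4 h3
    push_cast
    refine (h5.congr_of_eventuallyEq ?_).contMDiffWithinAt
    filter_upwards [hUo.mem_nhds htU] with t ht
    exact (φ.left_inv (by rw [extChartAt_source]; exact ht.2)).symm

end IntegralCurves

section HorizontalCurves

variable {E : Type*} [NormedAddCommGroup E] [NormedSpace ℝ E] [FiniteDimensional ℝ E]
  {G : Type*} [TopologicalSpace G] [ChartedSpace E G] [Group G] [LieGroup 𝓘(ℝ, E) ∞ G]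

theorem contMDiffAt_chartDiff_horizontalField
    (C : GroupLieAlgebra 𝓘(ℝ, E) G ⊗[ℝ] GroupLieAlgebra 𝓘(ℝ, E) G)
    (α : Module.Dual ℝ (GroupLieAlgebra 𝓘(ℝ, E) G)) (q₀ q : G)
    (hq : q ∈ (chartAt E q₀).source) :
    ContMDiffAt 𝓘(ℝ, E) 𝓘(ℝ, E) ∞ (fun x ↦ chartDiff E q₀ x (horizontalField C α x)) q := by
  have h1 : ContMDiffAt 𝓘(ℝ, E) 𝓘(ℝ, E →L[ℝ] E) ∞ (fun q : G ↦ fderiv ℝ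
      (fun z ↦ extChartAt 𝓘(ℝ, E) q₀ (q * ((extChartAt 𝓘(ℝ, E) (1 : G)).symm z)))
      (extChartAt 𝓘(ℝ, E) (1 : G) 1)) q := by
    refine contMDiffAt_partial_fderiv (f := fun q x : G ↦ q * x) (n₀ := q) (x := (1 : G))
      ((contMDiff_mul 𝓘(ℝ, E) ∞) (q, 1)) ?_
    rwa [mul_one]
  refine (h1.clm_apply (contMDiff_bodyVelocity C α).contMDiffAt).congr_of_eventuallyEq ?_
  filter_upwards [(chartAt E q₀).open_source.mem_nhds hq] with x hx
  have h2 := fderiv_extChartAt_comp (mdifferentiableAt_mul_left' x (1 : G)) (p₀ := q₀)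
    (by rwa [mul_one]) (bodyVelocity C α x)
  rw [h2, mul_one, horizontalField_eq]
  rfl

variable {H : Subgroup G} {F : Type*} [NormedAddCommGroup F] [NormedSpace ℝ F]
  [FiniteDimensional ℝ F] [ChartedSpace F (RightCosets H)]
  {C : GroupLieAlgebra 𝓘(ℝ, E) G ⊗[ℝ] GroupLieAlgebra 𝓘(ℝ, E) G}
  {𝔣 : Submodule ℝ (GroupLieAlgebra 𝓘(ℝ, E) G)}
  {α : Module.Dual ℝ (GroupLieAlgebra 𝓘(ℝ, E) G)}

/-- Integral curves of `Cᴸ αᴿ` over `M₀` project to geodesics. -/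
theorem IsQuotientManifold.isGeodesicOn_proj (hM : IsQuotientManifold (E := E) (F := F) H)
    (hC : TensorProduct.comm ℝ _ _ C = C) (hα : ∀ a ∈ isotropyAlgebra F H, α a = 0)
    {γ : ℝ → G} {J : Set ℝ} (hJ : IsOpen J) (hγ : IsMIntegralCurveOn γ (horizontalField C α) J)
    (hγJ : Set.MapsTo (proj H ∘ γ) J (nondegenerateLocus F H C)) :
    IsGeodesicOn (F := F) C (proj H ∘ γ) J where
  mapsTo := hγJ
  contMDiffOn := hM.contMDiff_proj.comp_contMDiffOn
    (contMDiffOn_of_hasVelocityAt (contMDiffAt_chartDiff_horizontalField C α) hJ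
      fun _ ht ↦ hγ.hasVelocityAt hJ ht)
  equation t ht p₀ hp x hx w := by
    refine hM.geodesic_equation hC hα (γ := γ) ?_ (hγJ ht) hp hx w
    filter_upwards [hJ.mem_nhds ht] with τ hτ using hγ.hasVelocityAt hJ hτ

/-- Integral curves of `Cᴸ αᴿ` over `M₀` project to integral curves of `Λ^⊥`. -/
theorem IsQuotientManifold.isIntegralCurvePerp_proj
    (hM : IsQuotientManifold (E := E) (F := F) H) (h𝔣 : IsProjectable F H 𝔣)
    (h𝔥𝔣 : isotropyAlgebra F H ≤ 𝔣) (hα : ∀ a ∈ 𝔣, α a = 0) (hα0 : α ≠ 0)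
    {γ : ℝ → G} {J : Set ℝ} (hJ : IsOpen J) (hγ : IsMIntegralCurveOn γ (horizontalField C α) J)
    (hγJ : Set.MapsTo (proj H ∘ γ) J (nondegenerateLocus F H C)) :
    IsIntegralCurvePerp (F := F) C 𝔣 (proj H ∘ γ) J := by
  have hvel : ∀ t ∈ J, mfderiv 𝓘(ℝ, ℝ) 𝓘(ℝ, F) (proj H ∘ γ) t (1 : ℝ) =
      mfderiv 𝓘(ℝ, E) 𝓘(ℝ, F) (proj H) (γ t) (horizontalField C α (γ t)) := fun t ht ↦
    ((hγ.hasVelocityAt hJ ht).comp_map (hM.mdifferentiableAt_proj (γ t))).mfderiv_one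
  refine ⟨hγJ, ?_, fun t ht ↦ ?_, fun t ht ↦ ?_⟩
  · exact (hM.contMDiff_proj.comp_contMDiffOn
      (contMDiffOn_of_hasVelocityAt (contMDiffAt_chartDiff_horizontalField C α) hJ
        fun _ ht ↦ hγ.hasVelocityAt hJ ht)).of_le (by exact_mod_cast le_top)
  · rw [hvel t ht]
    exact hM.mfderiv_proj_horizontalField_ne_zero (fun a ha ↦ hα a (h𝔥𝔣 ha)) hα0 (hγJ ht)
  · rw [hvel t ht]
    exact hM.mfderiv_proj_horizontalField_mem h𝔣 h𝔥𝔣 hα (hγJ ht)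

end HorizontalCurves

/-! ### The rank of the perpendicular distribution on a surface -/

section Rank

variable {E : Type*} [NormedAddCommGroup E] [NormedSpace ℝ E]
  {G : Type*} [TopologicalSpace G] [ChartedSpace E G] [Group G]
  {H : Subgroup G} {F : Type*} [NormedAddCommGroup F] [NormedSpace ℝ F] [FiniteDimensional ℝ F]
  [ChartedSpace F (RightCosets H)]
  {C : GroupLieAlgebra 𝓘(ℝ, E) G ⊗[ℝ] GroupLieAlgebra 𝓘(ℝ, E) G}
  {𝔣 : Submodule ℝ (GroupLieAlgebra 𝓘(ℝ, E) G)}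

/-- The nondegenerate metric maps `Λ^⊥` onto the annihilator of `Λ`. -/
theorem finrank_add_finrank_perpDistribution {p : RightCosets H}
    (hp : p ∈ nondegenerateLocus F H C) :
    Module.finrank ℝ (invariantDistribution (F := F) 𝔣 p) +
      Module.finrank ℝ (perpDistribution (F := F) C 𝔣 p) = Module.finrank ℝ F := by
  have : FiniteDimensional ℝ (TangentSpace 𝓘(ℝ, F) p) := inferInstanceAs (FiniteDimensional ℝ F)
  set e := LinearEquiv.ofBijective (metric (F := F) C p) (metric_bijective hp)
  have h1 : (perpDistribution (F := F) C 𝔣 p).map e.toLinearMap =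
      (invariantDistribution (F := F) 𝔣 p).dualAnnihilator := by
    ext β
    rw [Submodule.mem_map, Submodule.mem_dualAnnihilator]
    constructor
    · rintro ⟨v, hv, rfl⟩
      exact hv
    · intro hβ
      refine ⟨e.symm β, fun w hw ↦ ?_, e.apply_symm_apply β⟩
      exact (LinearMap.congr_fun (e.apply_symm_apply β) w).trans (hβ w hw)
  have h2 : Module.finrank ℝ (perpDistribution (F := F) C 𝔣 p) =
      Module.finrank ℝ (invariantDistribution (F := F) 𝔣 p).dualAnnihilator :=
    (LinearEquiv.finrank_map_eq e _).symm.trans (by rw [← h1])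
  rw [h2]
  exact Subspace.finrank_add_finrank_dualAnnihilator_eq _

variable [LieGroup 𝓘(ℝ, E) ∞ G]

/-- The distribution `Λ` is neither zero nor the whole tangent bundle. -/
theorem IsQuotientManifold.finrank_invariantDistribution_mem_Ioo
    (hM : IsQuotientManifold (E := E) (F := F) H) (hproj : IsProjectable F H 𝔣)
    (h𝔥𝔣 : isotropyAlgebra F H < 𝔣) (h𝔣 : 𝔣 < ⊤) (p : RightCosets H) :
    Module.finrank ℝ (invariantDistribution (F := F) 𝔣 p) ∈ Set.Ioo 0 (Module.finrank ℝ F) := by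
  obtain ⟨q, rfl⟩ := proj_surjective p
  have : FiniteDimensional ℝ (TangentSpace 𝓘(ℝ, F) (proj H q)) :=
    inferInstanceAs (FiniteDimensional ℝ F)
  constructor
  · obtain ⟨a, ha, ha'⟩ := SetLike.exists_of_lt h𝔥𝔣
    rw [Module.finrank_pos_iff_exists_ne_zero]
    refine ⟨⟨_, mem_invariantDistribution (q := q) ha⟩, fun h ↦ ha' ?_⟩
    exact (hM.mfderiv_proj_rightField_eq_zero_iff q a).mp (congrArg Subtype.val h)
  · refine Submodule.finrank_lt (V := TangentSpace 𝓘(ℝ, F) (proj H q)) fun htop ↦ h𝔣.ne ?_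
    refine eq_top_iff.mpr fun b _ ↦ ?_
    obtain ⟨a, ha, hab⟩ := hproj.exists_of_mem (q := q)
      (v := mfderiv 𝓘(ℝ, E) 𝓘(ℝ, F) (proj H) q (rightField b q)) (by rw [htop]; trivial)
    have h1 : mfderiv 𝓘(ℝ, E) 𝓘(ℝ, F) (proj H) q (rightField (b - a) q) = 0 := by
      have h2 : rightField (b - a) q = rightField b q - rightField a q := map_sub _ b a
      rw [h2, map_sub, hab, sub_self]
    have h3 := h𝔥𝔣.le ((hM.mfderiv_proj_rightField_eq_zero_iff q (b - a)).mp h1)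
    simpa using 𝔣.add_mem h3 ha

theorem IsQuotientManifold.finrank_perpDistribution_of_finrank_eq_two
    (hM : IsQuotientManifold (E := E) (F := F) H) (hproj : IsProjectable F H 𝔣)
    (h𝔥𝔣 : isotropyAlgebra F H < 𝔣) (h𝔣 : 𝔣 < ⊤) (hF : Module.finrank ℝ F = 2)
    {p : RightCosets H} (hp : p ∈ nondegenerateLocus F H C) :
    Module.finrank ℝ (perpDistribution (F := F) C 𝔣 p) = 1 := by
  have h1 := finrank_add_finrank_perpDistribution (𝔣 := 𝔣) hp
  have h2 := hM.finrank_invariantDistribution_mem_Ioo hproj h𝔥𝔣 h𝔣 p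
  rw [Set.mem_Ioo] at h2
  omega

end Rank

/-! ### The differential of the adjoint representation -/

section Adjoint

variable {E : Type*} [NormedAddCommGroup E] [NormedSpace ℝ E]
  {G : Type*} [TopologicalSpace G] [ChartedSpace E G] [Group G]

variable (E) in
/-- The differential at `1` of left translation by `q`, in the chart of the group around `1`. -/
noncomputable def leftMulCoord (q : G) : E →L[ℝ] E :=
  fderiv ℝ (fun z ↦ extChartAt 𝓘(ℝ, E) (1 : G) (q * (extChartAt 𝓘(ℝ, E) (1 : G)).symm z))
    (extChartAt 𝓘(ℝ, E) (1 : G) 1)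

variable (E) in
/-- The differential at `1` of right translation by `q`, in the chart of the group around `1`. -/
noncomputable def rightMulCoord (q : G) : E →L[ℝ] E :=
  fderiv ℝ (fun z ↦ extChartAt 𝓘(ℝ, E) (1 : G) ((extChartAt 𝓘(ℝ, E) (1 : G)).symm z * q))
    (extChartAt 𝓘(ℝ, E) (1 : G) 1)

variable [LieGroup 𝓘(ℝ, E) ∞ G]

theorem leftMulCoord_apply {q : G} (hq : q ∈ (chartAt E (1 : G)).source) (a : E) :
    leftMulCoord E q a = chartDiff E 1 q (leftTr q a) := by
  have h1 := fderiv_extChartAt_comp (mdifferentiableAt_mul_left' q (1 : G)) (p₀ := 1)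
    (by rwa [mul_one]) a
  refine h1.trans ?_
  rw [mul_one]
  rfl

theorem rightMulCoord_apply {q : G} (hq : q ∈ (chartAt E (1 : G)).source) (a : E) :
    rightMulCoord E q a = chartDiff E 1 q (rightField a q) := by
  have h1 := fderiv_extChartAt_comp (mdifferentiableAt_mul_right' q (1 : G)) (p₀ := 1)
    (by rwa [one_mul]) a
  refine h1.trans ?_
  rw [one_mul]
  rfl

theorem contMDiffAt_rightMulCoord {q : G} (hq : q ∈ (chartAt E (1 : G)).source) :
    ContMDiffAt 𝓘(ℝ, E) 𝓘(ℝ, E →L[ℝ] E) ∞ (rightMulCoord E : G → E →L[ℝ] E) q :=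
  contMDiffAt_partial_fderiv (f := fun q x : G ↦ x * q) (n₀ := q) (x := (1 : G))
    ((contMDiff_snd.mul contMDiff_fst : ContMDiff (𝓘(ℝ, E).prod 𝓘(ℝ, E)) 𝓘(ℝ, E) ∞
      (fun x : G × G ↦ x.2 * x.1)) (q, 1)) (by rwa [one_mul])

theorem leftMulCoord_one (a : E) : leftMulCoord E (1 : G) a = a := by
  rw [leftMulCoord_apply (mem_chart_source E 1), chartDiff, mfderiv_extChartAt_self]
  have h0 : (fun x : G ↦ 1 * x) = id := by ext; simp
  have h1 : (leftTr (1 : G) a : E) = mfderiv 𝓘(ℝ, E) 𝓘(ℝ, E) (fun x : G ↦ 1 * x) 1 a := rfl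
  rw [h0, mfderiv_id] at h1
  exact h1

theorem rightMulCoord_one (a : E) : rightMulCoord E (1 : G) a = a := by
  rw [rightMulCoord_apply (mem_chart_source E 1), chartDiff, mfderiv_extChartAt_self]
  have h0 : (fun x : G ↦ x * 1) = id := by ext; simp
  have h1 : (rightField a (1 : G) : E) = mfderiv 𝓘(ℝ, E) 𝓘(ℝ, E) (fun x : G ↦ x * 1) 1 a := rfl
  rw [h0, mfderiv_id] at h1
  exact h1

theorem rightMulCoord_Ad {q : G} (hq : q ∈ (chartAt E (1 : G)).source) (a : E) :
    rightMulCoord E q (Ad E q a) = leftMulCoord E q a := by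
  rw [rightMulCoord_apply hq, leftMulCoord_apply hq, Ad_eq_rightTrInv_leftTr]
  exact congrArg _ (rightField_rightTrInv q (leftTr q a))

/-- Both sides are the mixed second derivative at `1` of the multiplication `(x, y) ↦ x y` in
coordinates, in the directions `a` of `x` and `b` of `y`. -/
theorem fderiv_rightMulCoord (a b : E) :
    fderiv ℝ (fun z ↦ rightMulCoord E ((extChartAt 𝓘(ℝ, E) (1 : G)).symm z) a)
      (extChartAt 𝓘(ℝ, E) (1 : G) 1) b =
    fderiv ℝ (fun z ↦ leftMulCoord E ((extChartAt 𝓘(ℝ, E) (1 : G)).symm z) b)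
      (extChartAt 𝓘(ℝ, E) (1 : G) 1) a := by
  set e := extChartAt 𝓘(ℝ, E) (1 : G) with he
  have hU : ContDiffAt ℝ 2 (Function.uncurry fun z₁ z₂ : E ↦ e (e.symm z₁ * e.symm z₂))
      (e 1, e 1) := by
    have hs : ContMDiffAt 𝓘(ℝ, E) 𝓘(ℝ, E) ∞ e.symm (e 1) :=
      (contMDiffOn_extChartAt_symm 1).contMDiffAt (extChartAt_target_mem_nhds 1)
    have h1 : ContMDiffAt 𝓘(ℝ, E × E) 𝓘(ℝ, E) ∞ (fun z : E × E ↦ e.symm z.1 * e.symm z.2)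
        (e 1, e 1) :=
      (ContMDiffAt.comp (e 1, e 1) (g := e.symm) (f := fun z : E × E ↦ z.1) hs
        contDiff_fst.contMDiff.contMDiffAt).mul
      (ContMDiffAt.comp (e 1, e 1) (g := e.symm) (f := fun z : E × E ↦ z.2) hs
        contDiff_snd.contMDiff.contMDiffAt)
    have h2 : ContMDiffAt 𝓘(ℝ, E × E) 𝓘(ℝ, E) ∞ (fun z : E × E ↦ e (e.symm z.1 * e.symm z.2))
        (e 1, e 1) := by
      refine ContMDiffAt.comp (I' := 𝓘(ℝ, E)) (e 1, e 1) (g := e) ?_ h1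
      refine contMDiffAt_extChartAt' ?_
      simp only [he, extChartAt_to_inv, mul_one]
      exact mem_chart_source E 1
    exact_mod_cast contDiffAt_infty.mp h2.contDiffAt 2
  exact (fderiv_fderiv_comm hU a b).symm

/-- The Lie bracket of the Lie algebra of a Lie group, in coordinates. -/
theorem bracket_eq_fderiv_leftMulCoord (a b : GroupLieAlgebra 𝓘(ℝ, E) G) :
    (⁅a, b⁆ : GroupLieAlgebra 𝓘(ℝ, E) G) =
      fderiv ℝ (fun z ↦ leftMulCoord E ((extChartAt 𝓘(ℝ, E) (1 : G)).symm z) b)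
        (extChartAt 𝓘(ℝ, E) (1 : G) 1) a -
      fderiv ℝ (fun z ↦ leftMulCoord E ((extChartAt 𝓘(ℝ, E) (1 : G)).symm z) a)
        (extChartAt 𝓘(ℝ, E) (1 : G) 1) b := by
  set e := extChartAt 𝓘(ℝ, E) (1 : G) with he
  have hpull : ∀ v : E, (fun z : E ↦ (VectorField.mpullbackWithin 𝓘(ℝ, E) 𝓘(ℝ, E) e.symm
      (mulInvariantVectorField (I := 𝓘(ℝ, E)) v) (Set.range 𝓘(ℝ, E)) z : E)) =ᶠ[𝓝 (e 1)]
      fun z ↦ leftMulCoord E (e.symm z) v := by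
    intro v
    filter_upwards [extChartAt_target_mem_nhds (I := 𝓘(ℝ, E)) (1 : G)] with z hz
    have h1 : e.symm z ∈ (chartAt E (1 : G)).source := by
      rw [← extChartAt_source (I := 𝓘(ℝ, E))]
      exact e.map_target hz
    rw [leftMulCoord_apply h1, VectorField.mpullbackWithin_apply,
      ContinuousLinearMap.inverse_eq
        (mfderivWithin_extChartAt_symm_comp_mfderiv_extChartAt (I := 𝓘(ℝ, E)) hz)
        (mfderiv_extChartAt_comp_mfderivWithin_extChartAt_symm (I := 𝓘(ℝ, E)) hz)]
    rfl
  have h0 : ∀ v : E, leftMulCoord E (e.symm (e 1)) v = v := fun v ↦ by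
    rw [he, extChartAt_to_inv, leftMulCoord_one]
  have hbr : ∀ (x y : E) (V W : E → E) (s : Set E), s = Set.univ →
      V =ᶠ[𝓝 (e 1)] (fun z ↦ leftMulCoord E (e.symm z) x) →
      W =ᶠ[𝓝 (e 1)] (fun z ↦ leftMulCoord E (e.symm z) y) →
      VectorField.lieBracketWithin ℝ V W s (e 1) =
        fderiv ℝ (fun z ↦ leftMulCoord E (e.symm z) y) (e 1) x -
        fderiv ℝ (fun z ↦ leftMulCoord E (e.symm z) x) (e 1) y := by
    intro x y V W s hs hV hW
    rw [hs, VectorField.lieBracketWithin_univ, hV.lieBracket_vectorField_eq hW,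
      VectorField.lieBracket_eq]
    simp only [h0]
  have hid : mfderiv 𝓘(ℝ, E) 𝓘(ℝ, E) e 1 = ContinuousLinearMap.id ℝ E := mfderiv_extChartAt_self
  have hinv : ∀ w : E, (mfderiv 𝓘(ℝ, E) 𝓘(ℝ, E) e 1 : E →L[ℝ] E).inverse w = w := fun w ↦ by
    have h1 := congrArg (fun L : E →L[ℝ] E ↦ L.inverse w) hid
    rw [ContinuousLinearMap.inverse_id] at h1
    exact h1
  rw [GroupLieAlgebra.bracket_def, ← VectorField.mlieBracketWithin_univ,
    VectorField.mlieBracketWithin_apply, ← he]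
  exact (hinv _).trans (hbr _ _ _ _ _ (by simp) (hpull a) (hpull b))

theorem mdifferentiableAt_Ad (q : G) :
    MDifferentiableAt 𝓘(ℝ, E) 𝓘(ℝ, E →L[ℝ] E) (Ad E : G → E →L[ℝ] E) q :=
  contMDiff_Ad.contMDiffAt.mdifferentiableAt (by simp)

/-- The differential at `1` of the adjoint representation is the Lie bracket. -/
theorem vectorDiff_Ad_one (b a : E) :
    (vectorDiff (Ad E : G → E →L[ℝ] E) 1 b : E →L[ℝ] E) a =
      @Bracket.bracket (GroupLieAlgebra 𝓘(ℝ, E) G) (GroupLieAlgebra 𝓘(ℝ, E) G) _ b a := by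
  set e := extChartAt 𝓘(ℝ, E) (1 : G) with he
  have hsrc := mem_chart_source E (1 : G)
  have h1 : e.symm (e 1) = 1 := extChartAt_to_inv 1
  have hev : (fun z ↦ rightMulCoord E (e.symm z) (Ad E (e.symm z) a)) =ᶠ[𝓝 (e 1)]
      fun z ↦ leftMulCoord E (e.symm z) a := by
    filter_upwards [extChartAt_target_mem_nhds (I := 𝓘(ℝ, E)) (1 : G)] with z hz
    refine rightMulCoord_Ad ?_ a
    rw [← extChartAt_source (I := 𝓘(ℝ, E))]
    exact e.map_target hz
  -- differentiating `R(q) (Ad q a) = L(q) a` at `q = 1`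
  have hdiff : ∀ S T : E →L[ℝ] E →L[ℝ] E,
      HasFDerivAt (fun z ↦ rightMulCoord E (e.symm z)) S (e 1) →
      HasFDerivAt (fun z ↦ Ad E (e.symm z)) T (e 1) →
      T b a + fderiv ℝ (fun z ↦ rightMulCoord E (e.symm z) a) (e 1) b =
        fderiv ℝ (fun z ↦ leftMulCoord E (e.symm z) a) (e 1) b := by
    intro S T hS hT
    have hTa := hT.clm_apply (hasFDerivAt_const a (e 1))
    have hSa := hS.clm_apply (hasFDerivAt_const a (e 1))
    rw [← hev.fderiv_eq, (hS.clm_apply hTa).fderiv, hSa.fderiv]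
    simp [h1, Ad_one, rightMulCoord_one]
  have h2 := hdiff _ _
    (fderiv_comp_extChartAt_symm ((contMDiffAt_rightMulCoord hsrc).mdifferentiableAt (by simp)))
    (fderiv_comp_extChartAt_symm (mdifferentiableAt_Ad (E := E) (1 : G)))
  rw [fderiv_rightMulCoord] at h2
  exact (eq_sub_of_add_eq h2).trans (bracket_eq_fderiv_leftMulCoord _ _).symm

end Adjoint

/-! ### Connected isotropy groups -/

theorem tangentBundle_mk_eq {F M : Type*} [NormedAddCommGroup F] [NormedSpace ℝ F]
    [TopologicalSpace M] [ChartedSpace F M] {p p' : M} {v : TangentSpace 𝓘(ℝ, F) p}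
    {v' : TangentSpace 𝓘(ℝ, F) p'} (hp : p = p') (hv : (v : F) = v') :
    (⟨p, v⟩ : TangentBundle 𝓘(ℝ, F) M) = ⟨p', v'⟩ := by
  subst hp
  exact congrArg (fun w ↦ (⟨p, w⟩ : TangentBundle 𝓘(ℝ, F) M)) hv

section Connected

variable {E : Type*} [NormedAddCommGroup E] [NormedSpace ℝ E]
  {G : Type*} [TopologicalSpace G] [ChartedSpace E G] [Group G] [LieGroup 𝓘(ℝ, E) ∞ G]

/-- The derivative of the adjoint representation along a curve. -/
theorem HasVelocityAt.hasDerivAt_Ad {h : ℝ → G} {t : ℝ} {u : TangentSpace 𝓘(ℝ, E) (h t)}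
    (hu : HasVelocityAt h t u) (a : E) :
    HasDerivAt (fun s ↦ Ad E (h s) a)
      ((vectorDiff (Ad E : G → E →L[ℝ] E) 1 (rightTrInv (h t) u) : E →L[ℝ] E)
        (Ad E (h t) a)) t := by
  have h1 := HasVelocityAt.comp_map (mdifferentiableAt_mul_right' (h t)⁻¹ (h t)) hu
  have h2 := HasVelocityAt.hasDerivAt_comp h1 (mdifferentiableAt_Ad _)
  have h3 := h2.clm_apply (hasDerivAt_const t (Ad E (h t) a))
  have h4 : (fun s ↦ Ad E (((fun x ↦ x * (h t)⁻¹) ∘ h) s) (Ad E (h t) a)) =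
      fun s ↦ Ad E (h s) a := by
    funext s
    rw [← Ad_mul]
    simp
  rw [h4] at h3
  refine h3.congr_deriv ?_
  have h5 : ∀ q' : G, q' = 1 → ∀ v b : E,
      (vectorDiff (Ad E : G → E →L[ℝ] E) q' v : E →L[ℝ] E) b =
        (vectorDiff (Ad E : G → E →L[ℝ] E) 1 v : E →L[ℝ] E) b := by
    rintro _ rfl _ _
    rfl
  rw [map_zero, add_zero]
  exact h5 _ (mul_inv_cancel _) _ _

/-- A curve in the group whose right logarithmic derivative stays in a Lie subalgebra does not
move this subalgebra: modulo `𝔣`, the curve `Ad (h t) a` with `a ∈ 𝔣` solves a homogeneous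
linear differential equation. -/
theorem Ad_mem_of_curve [FiniteDimensional ℝ E]
    (𝔣 : LieSubalgebra ℝ (GroupLieAlgebra 𝓘(ℝ, E) G)) {h : ℝ → G}
    {u : ∀ t, TangentSpace 𝓘(ℝ, E) (h t)} {b : ℝ → E} {B : ℝ}
    (hu : ∀ t ∈ Set.Icc (0 : ℝ) 1, HasVelocityAt h t (u t))
    (hb : ∀ t, b t = rightTrInv (h t) (u t)) (h𝔣 : ∀ t ∈ Set.Icc (0 : ℝ) 1, b t ∈ 𝔣.toSubmodule)
    (hB : ∀ t ∈ Set.Icc (0 : ℝ) 1, ‖b t‖ ≤ B) {a : E} (ha : Ad E (h 0) a ∈ 𝔣.toSubmodule) :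
    Ad E (h 1) a ∈ 𝔣.toSubmodule := by
  set 𝔣' : Submodule ℝ E := 𝔣.toSubmodule with h𝔣'
  obtain ⟨W, hW⟩ := Submodule.exists_isCompl 𝔣'
  -- the projection onto a complement, with kernel `𝔣`
  obtain ⟨P, hP0, hP⟩ : ∃ P : E →L[ℝ] E, (∀ y, P y = 0 ↔ y ∈ 𝔣') ∧ ∀ y, y - P y ∈ 𝔣' := by
    refine ⟨(Submodule.projection W 𝔣' hW.symm).toContinuousLinearMap, fun y ↦ ?_, fun y ↦ ?_⟩
    · exact Submodule.projection_apply_eq_zero_iff hW.symm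
    · exact Submodule.sub_projection_mem hW.symm y
  set T : E →L[ℝ] E →L[ℝ] E := vectorDiff (Ad E : G → E →L[ℝ] E) 1 with hT
  have hd : ∀ t ∈ Set.Icc (0 : ℝ) 1,
      HasDerivAt (fun s ↦ P (Ad E (h s) a)) (P (T (b t) (Ad E (h t) a))) t := by
    intro t ht
    rw [hb]
    exact P.hasFDerivAt.comp_hasDerivAt t ((hu t ht).hasDerivAt_Ad a)
  -- `[b, y]` and `[b, P y]` agree modulo `𝔣`, since `b` and `y - P y` belong to `𝔣`
  have hbound : ∀ t ∈ Set.Icc (0 : ℝ) 1,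
      ‖P (T (b t) (Ad E (h t) a))‖ ≤ ‖P‖ * ‖T‖ * B * ‖P (Ad E (h t) a)‖ := by
    intro t ht
    set y := Ad E (h t) a with hy
    have h1 : P (T (b t) (y - P y)) = 0 := by
      rw [hP0]
      have h2 := 𝔣.lie_mem (h𝔣 t ht) (hP y)
      exact (vectorDiff_Ad_one (G := G) (b t) (y - P y)).symm ▸ h2
    have h3 : P (T (b t) y) = P (T (b t) (P y)) := by
      rw [map_sub, map_sub, sub_eq_zero] at h1
      exact h1
    rw [h3]
    calc ‖P (T (b t) (P y))‖ ≤ ‖P‖ * (‖T‖ * ‖b t‖ * ‖P y‖) :=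
          P.le_of_opNorm_le_of_le le_rfl (T.le_opNorm₂ _ _)
      _ ≤ ‖P‖ * (‖T‖ * B * ‖P y‖) := by
          gcongr
          exact hB t ht
      _ = ‖P‖ * ‖T‖ * B * ‖P y‖ := by ring
  refine (hP0 _).mp (eq_zero_of_abs_deriv_le_mul_abs_self_of_eq_zero_right
    (f := fun s ↦ P (Ad E (h s) a)) (a := 0) (b := 1)
    (fun t ht ↦ (hd t ht).continuousAt.continuousWithinAt)
    (fun t ht ↦ (hd t (Set.Ico_subset_Icc_self ht)).hasDerivWithinAt) ((hP0 _).mpr ha)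
    (fun t ht ↦ hbound t (Set.Ico_subset_Icc_self ht)) 1 (by simp))

theorem bijective_rightMulCoord {q : G} (hq : q ∈ (chartAt E (1 : G)).source) :
    Function.Bijective (rightMulCoord E q) := by
  have h1 : (rightMulCoord E q : E → E) = fun a ↦ chartDiff E 1 q (rightField a q) :=
    funext (rightMulCoord_apply hq)
  rw [h1]
  refine (bijective_chartDiff hq).comp (Function.bijective_iff_has_inverse.mpr
    ⟨fun v ↦ rightTrInv q v, rightTrInv_rightField q, rightField_rightTrInv q⟩)

/-- The right logarithmic derivative of a curve of class `C¹` is continuous. -/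
theorem continuousAt_rightTrInv_mfderiv [FiniteDimensional ℝ E] {h : ℝ → G} {t : ℝ}
    (hh : ContMDiffAt 𝓘(ℝ, ℝ) 𝓘(ℝ, E) 1 h t) (ht : h t ∈ (chartAt E (1 : G)).source) :
    ContinuousAt (fun s ↦ (rightTrInv (h s) (mfderiv 𝓘(ℝ, ℝ) 𝓘(ℝ, E) h s (1 : ℝ)) : E)) t := by
  have : CompleteSpace E := FiniteDimensional.complete ℝ E
  set x : ℝ → E := extChartAt 𝓘(ℝ, E) (1 : G) ∘ h with hx
  have hxc : ContDiffAt ℝ 1 x t :=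
    (ContMDiffAt.comp (I' := 𝓘(ℝ, E)) t (g := extChartAt 𝓘(ℝ, E) (1 : G))
      (contMDiffAt_extChartAt' ht) hh).contDiffAt
  have hR : ContinuousAt (fun s ↦ (rightMulCoord E (h s)).inverse) t :=
    ((isInvertible_of_bijective
      (bijective_rightMulCoord ht)).contDiffAt_map_inverse (n := 1)).continuousAt.comp
      (f := fun s ↦ rightMulCoord E (h s))
      ((contMDiffAt_rightMulCoord ht).continuousAt.comp hh.continuousAt)
  have hd : ContinuousAt (fun s ↦ fderiv ℝ x s 1) t :=
    (hxc.fderiv_right (m := 0) (by norm_num)).continuousAt.clm_apply continuousAt_const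
  refine (hR.clm_apply hd).congr ?_
  filter_upwards [(contMDiffAt_iff_contMDiffAt_nhds (by simp)).mp hh,
    hh.continuousAt.eventually ((chartAt E (1 : G)).open_source.mem_nhds ht)] with s hs hs'
  have h1 := MDifferentiableAt.hasVelocityAt (hs.mdifferentiableAt (by simp))
  refine ((isInvertible_of_bijective (bijective_rightMulCoord hs')).inverse_apply_eq).mpr
    (Eq.trans ?_ (rightMulCoord_apply hs' _).symm)
  have h2 : fderiv ℝ x s 1 =
      chartDiff E 1 (h s) (mfderiv 𝓘(ℝ, ℝ) 𝓘(ℝ, E) h s (1 : ℝ)) := (h1.hasDerivAt hs').deriv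
  rw [h2]
  exact congrArg _ (rightField_rightTrInv _ _).symm

variable {H : Subgroup G} {F : Type*} [NormedAddCommGroup F] [NormedSpace ℝ F]
  [FiniteDimensional ℝ F] [ChartedSpace F (RightCosets H)]

/-- The right logarithmic derivative of a curve in a fibre lies in the Lie algebra of `H`. -/
theorem IsQuotientManifold.rightTrInv_mem_isotropyAlgebra
    (hM : IsQuotientManifold (E := E) (F := F) H) {h : ℝ → G} {t : ℝ}
    {u : TangentSpace 𝓘(ℝ, E) (h t)} (hu : HasVelocityAt h t u)
    (hev : ∀ᶠ s in 𝓝 t, proj H (h s) = proj H (h t)) :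
    rightTrInv (h t) u ∈ isotropyAlgebra F H := by
  rw [← hM.mfderiv_proj_eq_zero_iff]
  have h1 := hu.comp_map (hM.mdifferentiableAt_proj (h t))
  have h2 : HasVelocityAt (F := F) (fun _ : ℝ ↦ proj H (h t)) t 0 :=
    (hasMFDerivAt_const (proj H (h t)) t).congr_mfderiv
      (ContinuousLinearMap.ext fun (r : ℝ) ↦ (smul_zero (A := F) r).symm)
  exact h1.unique (h2.congr hev rfl)

/-- The elements of `H` near `1` preserve `𝔣`: such an element is joined to `1` in `H` by a curve of
class `C¹`, the image of a segment in a chart under a retraction onto `H`. -/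
theorem IsQuotientManifold.eventually_Ad_mem [FiniteDimensional ℝ E]
    (hM : IsQuotientManifold (E := E) (F := F) H)
    {𝔣 : LieSubalgebra ℝ (GroupLieAlgebra 𝓘(ℝ, E) G)}
    (h𝔥𝔣 : isotropyAlgebra F H ≤ 𝔣.toSubmodule) :
    ∀ᶠ x in 𝓝 (1 : G), x ∈ H → ∀ a ∈ 𝔣.toSubmodule, Ad E x a ∈ 𝔣.toSubmodule := by
  obtain ⟨σ, hσ, hσ1, hσπ⟩ := hM.exists_localSection 1
  -- a retraction of a neighbourhood of `1` onto the fibre `H`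
  set g : G → G := fun x ↦ x * (σ (proj H x))⁻¹ with hg
  have hgc : ContMDiffAt 𝓘(ℝ, E) 𝓘(ℝ, E) ∞ g 1 :=
    contMDiffAt_id.mul (ContMDiffAt.comp (I' := 𝓘(ℝ, F)) (1 : G) (g := σ) (f := proj H) hσ
      hM.contMDiff_proj.contMDiffAt).inv
  have hg1 : g 1 = 1 := by simp [hg, hσ1]
  have hgH : ∀ᶠ x in 𝓝 (1 : G), g x ∈ H := by
    filter_upwards [hM.contMDiff_proj.continuous.continuousAt.eventually hσπ] with x hx
    exact proj_eq_proj.mp hx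
  have hgx : ∀ x ∈ H, g x = x := fun x hx ↦ by
    have h1 : proj H x = proj H 1 := by simpa using proj_mul_of_mem hx 1
    simp [hg, h1, hσ1]
  set e := extChartAt 𝓘(ℝ, E) (1 : G) with he
  have he1 : e.symm (e 1) = 1 := extChartAt_to_inv 1
  have hs : ContMDiffAt 𝓘(ℝ, E) 𝓘(ℝ, E) ∞ e.symm (e 1) :=
    (contMDiffOn_extChartAt_symm 1).contMDiffAt (extChartAt_target_mem_nhds 1)
  have hk : ContMDiffAt 𝓘(ℝ, E) 𝓘(ℝ, E) 1 (fun z ↦ g (e.symm z)) (e 1) :=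
    (ContMDiffAt.comp (I' := 𝓘(ℝ, E)) (e 1) (g := g) (by rwa [he1]) hs).of_le
      (by exact_mod_cast le_top)
  have hk1 : g (e.symm (e 1)) = 1 := by rw [he1, hg1]
  have hev : ∀ᶠ z in 𝓝 (e 1), ContMDiffAt 𝓘(ℝ, E) 𝓘(ℝ, E) 1 (fun z ↦ g (e.symm z)) z ∧
      g (e.symm z) ∈ (chartAt E (1 : G)).source ∧ g (e.symm z) ∈ H := by
    refine ((contMDiffAt_iff_contMDiffAt_nhds (by simp)).mp hk).and (Filter.Eventually.and ?_ ?_)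
    · refine hk.continuousAt.eventually ?_
      simp only [hk1]
      exact (chartAt E (1 : G)).open_source.mem_nhds (mem_chart_source E 1)
    · exact hs.continuousAt.eventually (by rwa [he1])
  obtain ⟨r, hr, hball⟩ := Metric.eventually_nhds_iff_ball.mp hev
  filter_upwards [(continuousAt_extChartAt (I := 𝓘(ℝ, E)) (1 : G)).eventually
    (Metric.ball_mem_nhds (e 1) hr), extChartAt_source_mem_nhds (I := 𝓘(ℝ, E)) (1 : G)]
    with x hx hxs hxH a ha
  set ℓ : ℝ → E := fun t ↦ e 1 + t • (e x - e 1) with hℓ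
  have hℓc : ContDiff ℝ 1 ℓ := by fun_prop
  have hℓb : ∀ t ∈ Set.Icc (0 : ℝ) 1, ℓ t ∈ Metric.ball (e 1) r := by
    intro t ht
    have h2 : ‖e x - e 1‖ < r := mem_ball_iff_norm.mp hx
    have h3 : dist (ℓ t) (e 1) = |t| * ‖e x - e 1‖ := by
      simp [hℓ, dist_eq_norm, norm_smul]
    rw [Metric.mem_ball, h3, abs_of_nonneg ht.1]
    exact (mul_le_of_le_one_left (norm_nonneg _) ht.2).trans_lt h2
  set h : ℝ → G := fun t ↦ g (e.symm (ℓ t)) with hh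
  have hhc : ∀ t ∈ Set.Icc (0 : ℝ) 1, ContMDiffAt 𝓘(ℝ, ℝ) 𝓘(ℝ, E) 1 h t := fun t ht ↦
    ContMDiffAt.comp (I' := 𝓘(ℝ, E)) t (g := fun z ↦ g (e.symm z)) (hball _ (hℓb t ht)).1
      hℓc.contMDiff.contMDiffAt
  set b : ℝ → E := fun t ↦ rightTrInv (h t) (mfderiv 𝓘(ℝ, ℝ) 𝓘(ℝ, E) h t (1 : ℝ)) with hb
  have hu : ∀ t ∈ Set.Icc (0 : ℝ) 1,
      HasVelocityAt h t (mfderiv 𝓘(ℝ, ℝ) 𝓘(ℝ, E) h t (1 : ℝ)) := fun t ht ↦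
    MDifferentiableAt.hasVelocityAt ((hhc t ht).mdifferentiableAt (by simp))
  obtain ⟨B, hB⟩ := isCompact_Icc.exists_bound_of_continuousOn (s := Set.Icc (0 : ℝ) 1) (f := b)
    fun t ht ↦ (continuousAt_rightTrInv_mfderiv (hhc t ht)
      (hball _ (hℓb t ht)).2.1).continuousWithinAt
  have h0 : h 0 = 1 := by simp [hh, hℓ, he1, hg1]
  have h0a : Ad E (h 0) a = a := by
    rw [h0]
    exact Ad_one _
  have h1 : h 1 = x := by
    simp only [hh, hℓ, one_smul, add_sub_cancel]
    rw [e.left_inv hxs, hgx x hxH]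
  have hmem := Ad_mem_of_curve 𝔣 (h := h) (b := b) (a := a) hu (fun _ ↦ rfl) (fun t ht ↦ ?_) hB
    (Eq.mpr (congrArg (fun y : GroupLieAlgebra 𝓘(ℝ, E) G ↦ y ∈ 𝔣.toSubmodule) h0a) ha)
  · rwa [h1] at hmem
  · refine h𝔥𝔣 (hM.rightTrInv_mem_isotropyAlgebra (hu t ht) ?_)
    have h2 : ∀ᶠ s in 𝓝 t, ℓ s ∈ Metric.ball (e 1) r :=
      hℓc.continuous.continuousAt.eventually (Metric.isOpen_ball.mem_nhds (hℓb t ht))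
    filter_upwards [h2] with s hs
    rw [proj_eq_proj]
    exact H.mul_mem (hball _ (hℓb t ht)).2.2 (H.inv_mem (hball _ hs).2.2)

/-- A connected group `H` preserves under `Ad` every Lie algebra `𝔣` that contains its Lie
algebra. -/
theorem IsQuotientManifold.Ad_mem_of_isConnected [FiniteDimensional ℝ E]
    (hM : IsQuotientManifold (E := E) (F := F) H) (hH : IsConnected (H : Set G))
    {𝔣 : LieSubalgebra ℝ (GroupLieAlgebra 𝓘(ℝ, E) G)}
    (h𝔥𝔣 : isotropyAlgebra F H ≤ 𝔣.toSubmodule) {x : G} (hx : x ∈ H) {a : E}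
    (ha : a ∈ 𝔣.toSubmodule) : Ad E x a ∈ 𝔣.toSubmodule := by
  have : IsTopologicalGroup G := topologicalGroup_of_lieGroup 𝓘(ℝ, E) ∞
  have : ConnectedSpace H := isConnected_iff_connectedSpace.mp hH
  set 𝔣' : Submodule ℝ E := 𝔣.toSubmodule with h𝔣'
  -- the stabilizer of `𝔣` is an open subgroup of `H`
  set K : Subgroup H :=
    { carrier := {x | ∀ a ∈ 𝔣', Ad E (x : G) a ∈ 𝔣' ∧ Ad E (x : G)⁻¹ a ∈ 𝔣'}
      mul_mem' := fun {x y} hx hy a ha ↦ by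
        simp only [Subgroup.coe_mul, mul_inv_rev, Ad_mul]
        exact ⟨(hx _ (hy _ ha).1).1, (hy _ (hx _ ha).2).2⟩
      one_mem' := fun a ha ↦ by simpa [Ad_one] using ha
      inv_mem' := fun {x} hx a ha ↦ by simpa using (hx a ha).symm } with hK
  have hKn : (K : Set H) ∈ 𝓝 (1 : H) := by
    have h1 := hM.eventually_Ad_mem h𝔥𝔣
    have h2 : Filter.Tendsto (fun x : H ↦ (x : G)) (𝓝 1) (𝓝 (1 : G)) :=
      continuous_subtype_val.continuousAt
    have h3 : Filter.Tendsto (fun x : H ↦ (x : G)⁻¹) (𝓝 1) (𝓝 (1 : G)) := by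
      simpa using h2.inv
    filter_upwards [h2.eventually h1, h3.eventually h1] with y hy hy' a ha
    exact ⟨hy y.2 a ha, hy' (H.inv_mem y.2) a ha⟩
  have hKo : IsOpen (K : Set H) := K.isOpen_of_mem_nhds hKn
  have hKu : (K : Set H) = Set.univ :=
    IsClopen.eq_univ ⟨K.isClosed_of_isOpen hKo, hKo⟩ ⟨1, K.one_mem⟩
  have h4 : (⟨x, hx⟩ : H) ∈ (K : Set H) := hKu ▸ Set.mem_univ _
  exact (h4 a ha).1

theorem IsQuotientManifold.isProjectable_of_isConnected [FiniteDimensional ℝ E]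
    (hM : IsQuotientManifold (E := E) (F := F) H) (hH : IsConnected (H : Set G))
    {𝔣 : LieSubalgebra ℝ (GroupLieAlgebra 𝓘(ℝ, E) G)}
    (h𝔥𝔣 : isotropyAlgebra F H ≤ 𝔣.toSubmodule) : IsProjectable F H 𝔣.toSubmodule := by
  intro q q' hqq' a ha
  obtain ⟨x, hx, rfl⟩ : ∃ x ∈ H, x * q = q' :=
    ⟨q' * q⁻¹, proj_eq_proj.mp hqq', inv_mul_cancel_right q' q⟩
  refine ⟨Ad E x a, hM.Ad_mem_of_isConnected hH h𝔥𝔣 hx ha, tangentBundle_mk_eq hqq' ?_⟩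
  have h1 := hM.mfderiv_proj_mul_left hx q (rightField a q)
  exact h1.symm.trans (congrArg (fun w : E ↦ (mfderiv 𝓘(ℝ, E) 𝓘(ℝ, F) (proj H) (x * q) w : F))
    (mfderiv_mul_left_rightField (E := E) x q a))

end Connected

/-! ### Uniqueness and gluing of horizontal lifts -/

section Connectedness

/-- A property of the points of a preconnected set that is locally constant there and holds at
one point holds everywhere. -/
theorem _root_.IsPreconnected.forall_of_eventually_iff {X : Type*} [TopologicalSpace X] {I : Set X}
    (hI : IsPreconnected I) {p : X → Prop} (hp : ∀ t ∈ I, ∀ᶠ s in 𝓝 t, (p s ↔ p t)) {t₁ : X}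
    (ht₁ : t₁ ∈ I) (h₁ : p t₁) : ∀ t ∈ I, p t := by
  have h := hI.subset_left_of_subset_union (u := {t | ∀ᶠ s in 𝓝 t, p s})
    (v := {t | ∀ᶠ s in 𝓝 t, ¬p s}) isOpen_setOfPred_eventually_nhds
    isOpen_setOfPred_eventually_nhds
    (Set.disjoint_left.mpr fun t ht ht' ↦ ht'.self_of_nhds ht.self_of_nhds)
    (fun t ht ↦ ?_) ⟨t₁, ht₁, ?_⟩
  · exact fun t ht ↦ (h ht).self_of_nhds
  · by_cases hpt : p t
    · exact Or.inl ((hp t ht).mono fun s hs ↦ hs.mpr hpt)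
    · exact Or.inr ((hp t ht).mono fun s hs ↦ mt hs.mp hpt)
  · exact (hp t₁ ht₁).mono fun s hs ↦ hs.mpr h₁

theorem eventually_eq_of_hasVelocityAt_zero {F M : Type*} [NormedAddCommGroup F] [NormedSpace ℝ F]
    [TopologicalSpace M] [ChartedSpace F M] [IsManifold 𝓘(ℝ, F) 1 M] {h : ℝ → M} {t : ℝ}
    (hh : ∀ᶠ s in 𝓝 t, HasVelocityAt (F := F) h s 0) : ∀ᶠ s in 𝓝 t, h s = h t := by
  have hsrc : ∀ᶠ s in 𝓝 t, h s ∈ (chartAt F (h t)).source :=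
    hh.self_of_nhds.continuousAt.eventually
      ((chartAt F (h t)).open_source.mem_nhds (mem_chart_source F (h t)))
  obtain ⟨r, hr, hball⟩ := Metric.eventually_nhds_iff_ball.mp (hh.and hsrc)
  have hd : ∀ s ∈ Metric.ball t r, HasDerivAt (extChartAt 𝓘(ℝ, F) (h t) ∘ h) 0 s := fun s hs ↦
    ((hball s hs).1.hasDerivAt (hball s hs).2).congr_deriv (map_zero (chartDiff F (h t) (h s)))
  filter_upwards [Metric.ball_mem_nhds t hr] with s hs
  have h1 : extChartAt 𝓘(ℝ, F) (h t) (h s) = extChartAt 𝓘(ℝ, F) (h t) (h t) :=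
    Metric.isOpen_ball.is_const_of_deriv_eq_zero (convex_ball t r).isPreconnected
      (fun s hs ↦ (hd s hs).differentiableAt.differentiableWithinAt)
      (fun s hs ↦ (hd s hs).deriv) hs (Metric.mem_ball_self hr)
  refine (extChartAt 𝓘(ℝ, F) (h t)).injOn ?_ (mem_extChartAt_source (h t)) h1
  rw [extChartAt_source]
  exact (hball s hs).2

end Connectedness

section Lifts

variable {E : Type*} [NormedAddCommGroup E] [NormedSpace ℝ E]
  {G : Type*} [TopologicalSpace G] [ChartedSpace E G] [Group G]

/-- The field `Cᴸ αᴿ` is invariant under left translations by the elements of `H` up to nonzero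
constant factors. -/
def IsQuasiInvariant (C : GroupLieAlgebra 𝓘(ℝ, E) G ⊗[ℝ] GroupLieAlgebra 𝓘(ℝ, E) G)
    (α : Module.Dual ℝ (GroupLieAlgebra 𝓘(ℝ, E) G)) (H : Subgroup G) : Prop :=
  ∀ h ∈ H, ∃ χ : ℝ, χ ≠ 0 ∧ ∀ q : G, (horizontalField C α (h * q) : E) =
    χ • (mfderiv 𝓘(ℝ, E) 𝓘(ℝ, E) (fun y : G ↦ h * y) q (horizontalField C α q) : E)

/-- The curve `δ` in the group is a lift over the open set `I` of times of the curve `c` in the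
space of cosets, and its velocity at the time `t` is `lam t` times the value of `Cᴸ αᴿ`. -/
structure IsLiftOn {H : Subgroup G}
    (C : GroupLieAlgebra 𝓘(ℝ, E) G ⊗[ℝ] GroupLieAlgebra 𝓘(ℝ, E) G)
    (α : Module.Dual ℝ (GroupLieAlgebra 𝓘(ℝ, E) G)) (c : ℝ → RightCosets H) (δ : ℝ → G)
    (lam : ℝ → ℝ) (I : Set ℝ) : Prop where
  proj_eq : ∀ t ∈ I, proj H (δ t) = c t
  continuousOn : ContinuousOn lam I
  hasVelocityAt : ∀ t ∈ I, HasVelocityAt δ t (lam t • horizontalField C α (δ t))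

variable {C : GroupLieAlgebra 𝓘(ℝ, E) G ⊗[ℝ] GroupLieAlgebra 𝓘(ℝ, E) G}
  {α : Module.Dual ℝ (GroupLieAlgebra 𝓘(ℝ, E) G)} {H : Subgroup G} {c : ℝ → RightCosets H}
  {δ : ℝ → G} {lam : ℝ → ℝ} {I : Set ℝ}

theorem IsLiftOn.mono (hδ : IsLiftOn C α c δ lam I) {I' : Set ℝ} (h : I' ⊆ I) :
    IsLiftOn C α c δ lam I' :=
  ⟨fun t ht ↦ hδ.proj_eq t (h ht), hδ.continuousOn.mono h, fun t ht ↦ hδ.hasVelocityAt t (h ht)⟩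

theorem IsLiftOn.congr (hδ : IsLiftOn C α c δ lam I) (hI : IsOpen I) {δ' : ℝ → G} {lam' : ℝ → ℝ}
    (h : Set.EqOn δ' δ I) (h' : Set.EqOn lam' lam I) : IsLiftOn C α c δ' lam' I where
  proj_eq t ht := by rw [h ht, hδ.proj_eq t ht]
  continuousOn := hδ.continuousOn.congr h'
  hasVelocityAt t ht := (hδ.hasVelocityAt t ht).congr
    (h.eventuallyEq_of_mem (hI.mem_nhds ht)) (by rw [h ht, h' ht])

variable [LieGroup 𝓘(ℝ, E) ∞ G]

/-- The quotient of two curves in the group is stationary at every time at which they have the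
same velocity up to a left translation. -/
theorem hasVelocityAt_mul_inv_zero {δ₁ δ₂ : ℝ → G} {h : G} {t : ℝ}
    {v₁ : TangentSpace 𝓘(ℝ, E) (δ₁ t)} {v₂ : TangentSpace 𝓘(ℝ, E) (δ₂ t)}
    (h₁ : HasVelocityAt δ₁ t v₁) (h₂ : HasVelocityAt δ₂ t v₂) (hh : δ₂ t = h * δ₁ t)
    (hv : (v₂ : E) = mfderiv 𝓘(ℝ, E) 𝓘(ℝ, E) (fun y : G ↦ h * y) (δ₁ t) v₁) :
    HasVelocityAt (F := E) (fun s ↦ δ₂ s * (δ₁ s)⁻¹) t 0 := by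
  set D : G × G → G := fun x ↦ x.1 * x.2⁻¹ with hD
  have hDd : ∀ x, MDifferentiableAt (𝓘(ℝ, E).prod 𝓘(ℝ, E)) 𝓘(ℝ, E) D x := fun x ↦
    (contMDiff_fst.mul contMDiff_snd.inv : ContMDiff (𝓘(ℝ, E).prod 𝓘(ℝ, E)) 𝓘(ℝ, E) ∞
      D).contMDiffAt.mdifferentiableAt (by simp)
  have h₃ := h₁.comp_map (mdifferentiableAt_mul_left' h (δ₁ t))
  have hA := (hDd _).hasMFDerivAt.comp t (HasMFDerivAt.prodMk h₂ h₁)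
  have hB := (hDd _).hasMFDerivAt.comp t (HasMFDerivAt.prodMk h₃ h₁)
  -- `D` is constant on the curve `(h δ₁, δ₁)`
  have hconst : D ∘ (fun s ↦ (((fun y : G ↦ h * y) ∘ δ₁) s, δ₁ s)) = fun _ ↦ h := by
    funext s
    simp [hD]
  rw [hconst] at hB
  have h0 := hasMFDerivAt_unique hB (hasMFDerivAt_const h t)
  have htransport : ∀ x : G × G, x = (h * δ₁ t, δ₁ t) → ∀ w : E × E,
      (mfderiv (𝓘(ℝ, E).prod 𝓘(ℝ, E)) 𝓘(ℝ, E) D x w : E) =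
        mfderiv (𝓘(ℝ, E).prod 𝓘(ℝ, E)) 𝓘(ℝ, E) D (h * δ₁ t, δ₁ t) w := by
    rintro _ rfl _
    rfl
  refine hA.congr_mfderiv (ContinuousLinearMap.ext fun (r : ℝ) ↦ ?_)
  refine Eq.trans ?_ (smul_zero (A := E) r).symm
  refine (htransport (δ₂ t, δ₁ t) (by rw [hh]) (r • (v₂ : E), r • (v₁ : E))).trans ?_
  rw [hv]
  exact congrArg (fun L : ℝ →L[ℝ] E ↦ L r) h0

variable {F : Type*} [NormedAddCommGroup F] [NormedSpace ℝ F]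
  [ChartedSpace F (RightCosets H)]

/-- Lifts that agree at one time agree. Two lifts `δ`, `δ'` differ by a curve `δ' δ⁻¹` in `H`;
quasi-invariance makes their velocities at each time correspond under the left translation, so
this curve is stationary. -/
theorem IsLiftOn.eqOn (hM : IsQuotientManifold (E := E) (F := F) H)
    (hinv : IsQuasiInvariant C α H) (hI : IsOpenInterval I)
    (hX : ∀ t ∈ I, ∀ q : G, proj H q = c t →
      mfderiv 𝓘(ℝ, E) 𝓘(ℝ, F) (proj H) q (horizontalField C α q) ≠ 0)
    (hδ : IsLiftOn C α c δ lam I) {δ' : ℝ → G} {lam' : ℝ → ℝ} (hδ' : IsLiftOn C α c δ' lam' I)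
    {t₁ : ℝ} (ht₁ : t₁ ∈ I) (h₁ : δ' t₁ = δ t₁) : Set.EqOn δ' δ I := by
  have hvel : ∀ t ∈ I, HasVelocityAt (F := E) (fun s ↦ δ' s * (δ s)⁻¹) t 0 := by
    intro t ht
    obtain ⟨h, hh, hδh⟩ : ∃ h ∈ H, h * δ t = δ' t :=
      ⟨δ' t * (δ t)⁻¹, proj_eq_proj.mp ((hδ.proj_eq t ht).trans (hδ'.proj_eq t ht).symm),
        inv_mul_cancel_right _ _⟩
    obtain ⟨χ, hχ0, hχ⟩ := hinv h hh
    set n : F := mfderiv 𝓘(ℝ, E) 𝓘(ℝ, F) (proj H) (δ t) (horizontalField C α (δ t)) with hn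
    have hn0 : n ≠ 0 := hX t ht (δ t) (hδ.proj_eq t ht)
    have h2 := (hδ.hasVelocityAt t ht).comp_map (hM.mdifferentiableAt_proj (δ t))
    have h3 := (hδ'.hasVelocityAt t ht).comp_map (hM.mdifferentiableAt_proj (δ' t))
    have hev : proj H ∘ δ =ᶠ[𝓝 t] proj H ∘ δ' := by
      filter_upwards [hI.1.mem_nhds ht] with s hs
      exact (hδ.proj_eq s hs).trans (hδ'.proj_eq s hs).symm
    have h4 : (mfderiv 𝓘(ℝ, E) 𝓘(ℝ, F) (proj H) (δ t) (lam t • horizontalField C α (δ t)) : F) =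
        mfderiv 𝓘(ℝ, E) 𝓘(ℝ, F) (proj H) (δ' t) (lam' t • horizontalField C α (δ' t)) :=
      h2.unique (h3.congr hev rfl)
    have h5 : ∀ q', h * δ t = q' → ∀ x : ℝ,
        ((x • horizontalField C α q' : E) = mfderiv 𝓘(ℝ, E) 𝓘(ℝ, E) (fun y : G ↦ h * y) (δ t)
          ((x * χ) • horizontalField C α (δ t))) ∧
        (mfderiv 𝓘(ℝ, E) 𝓘(ℝ, F) (proj H) q' (x • horizontalField C α q') : F) =
          (x * χ) • n := by
      rintro _ rfl x
      have h6 : (x • horizontalField C α (h * δ t) : E) = mfderiv 𝓘(ℝ, E) 𝓘(ℝ, E)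
          (fun y : G ↦ h * y) (δ t) ((x * χ) • horizontalField C α (δ t)) := by
        rw [map_smul, mul_smul]
        exact congrArg (fun v : E ↦ x • v) (hχ (δ t))
      refine ⟨h6, ?_⟩
      refine (congrArg (fun v : E ↦ (mfderiv 𝓘(ℝ, E) 𝓘(ℝ, F) (proj H) (h * δ t) v : F)) h6).trans ?_
      refine (hM.mfderiv_proj_mul_left hh (δ t) _).trans ?_
      exact map_smul _ _ _
    have h7 : lam t • n = (lam' t * χ) • n := by
      refine Eq.trans ?_ (h4.trans (h5 _ hδh (lam' t)).2)
      exact (map_smul (mfderiv 𝓘(ℝ, E) 𝓘(ℝ, F) (proj H) (δ t)) (lam t) _).symm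
    have h8 : lam t = lam' t * χ := smul_left_injective ℝ hn0 h7
    refine hasVelocityAt_mul_inv_zero (hδ.hasVelocityAt t ht) (hδ'.hasVelocityAt t ht) hδh.symm ?_
    rw [h8]
    exact (h5 _ hδh (lam' t)).1
  have hconst : ∀ t ∈ I, δ' t * (δ t)⁻¹ = 1 := by
    refine hI.2.isPreconnected.forall_of_eventually_iff (fun t ht ↦ ?_) ht₁ (by simp [h₁])
    have h2 := eventually_eq_of_hasVelocityAt_zero (F := E) (h := fun s ↦ δ' s * (δ s)⁻¹) (t := t)
      (by filter_upwards [hI.1.mem_nhds ht] with s hs using hvel s hs)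
    filter_upwards [h2] with s hs
    rw [hs]
  exact fun t ht ↦ mul_inv_eq_one.mp (hconst t ht)

/-- Lifts over intervals with a common time at which they agree can be glued together. -/
theorem IsLiftOn.exists_iUnion (hM : IsQuotientManifold (E := E) (F := F) H)
    (hinv : IsQuasiInvariant C α H) {ι : Type*} {δ : ι → ℝ → G} {lam : ι → ℝ → ℝ} {I : ι → Set ℝ}
    (hI : ∀ i, IsOpenInterval (I i))
    (hX : ∀ i, ∀ t ∈ I i, ∀ q : G, proj H q = c t →
      mfderiv 𝓘(ℝ, E) 𝓘(ℝ, F) (proj H) q (horizontalField C α q) ≠ 0)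
    (hδ : ∀ i, IsLiftOn C α c (δ i) (lam i) (I i)) {t₁ : ℝ} (ht₁ : ∀ i, t₁ ∈ I i)
    (h₁ : ∀ i j, δ i t₁ = δ j t₁) :
    ∃ (δ' : ℝ → G) (lam' : ℝ → ℝ), IsLiftOn C α c δ' lam' (⋃ i, I i) ∧
      ∀ i, Set.EqOn δ' (δ i) (I i) := by
  classical
  have heq : ∀ i j, ∀ t ∈ I i, t ∈ I j → δ i t = δ j t := fun i j t hi hj ↦
    IsLiftOn.eqOn hM hinv ⟨(hI j).1.inter (hI i).1, (hI j).2.inter (hI i).2⟩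
      (fun t ht ↦ hX j t ht.1) ((hδ j).mono Set.inter_subset_left)
      ((hδ i).mono Set.inter_subset_right) ⟨ht₁ j, ht₁ i⟩ (h₁ i j) ⟨hj, hi⟩
  have heq' : ∀ i j, ∀ t ∈ I i, t ∈ I j → lam i t = lam j t := by
    intro i j t hi hj
    have h2 : HasVelocityAt (δ j) t (lam i t • horizontalField C α (δ j t)) := by
      refine ((hδ i).hasVelocityAt t hi).congr ?_ (by rw [heq i j t hi hj])
      filter_upwards [(hI i).1.mem_nhds hi, (hI j).1.mem_nhds hj] with s hs hs'
      exact (heq i j s hs hs').symm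
    refine smul_left_injective ℝ (fun h0 ↦ ?_) (h2.unique ((hδ j).hasVelocityAt t hj))
    refine hX j t hj (δ j t) ((hδ j).proj_eq t hj) ?_
    rw [h0, map_zero]
  have hex : ∀ t, t ∈ ⋃ i, I i → ∃ i, t ∈ I i := fun t ↦ Set.mem_iUnion.mp
  set δ' : ℝ → G := fun t ↦ if h : t ∈ ⋃ i, I i then δ (hex t h).choose t else 1 with hδ'
  set lam' : ℝ → ℝ := fun t ↦ if h : t ∈ ⋃ i, I i then lam (hex t h).choose t else 0 with hlam'
  have h2 : ∀ i, Set.EqOn δ' (δ i) (I i) := by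
    intro i t ht
    have hu : t ∈ ⋃ i, I i := Set.mem_iUnion.mpr ⟨i, ht⟩
    simp only [hδ', dif_pos hu]
    exact heq _ _ t (hex t hu).choose_spec ht
  have h3 : ∀ i, Set.EqOn lam' (lam i) (I i) := by
    intro i t ht
    have hu : t ∈ ⋃ i, I i := Set.mem_iUnion.mpr ⟨i, ht⟩
    simp only [hlam', dif_pos hu]
    exact heq' _ _ t (hex t hu).choose_spec ht
  have h4 : ∀ i, IsLiftOn C α c δ' lam' (I i) := fun i ↦ (hδ i).congr (hI i).1 (h2 i) (h3 i)
  refine ⟨δ', lam', ⟨fun t ht ↦ ?_, ?_, fun t ht ↦ ?_⟩, h2⟩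
  · obtain ⟨i, hi⟩ := hex t ht
    exact (h4 i).proj_eq t hi
  · exact ContinuousOn.iUnion_of_isOpen (fun i ↦ (h4 i).continuousOn) fun i ↦ (hI i).1
  · obtain ⟨i, hi⟩ := hex t ht
    exact (h4 i).hasVelocityAt t hi

end Lifts

/-! ### Existence of horizontal lifts -/

/-- Two curves through a point that are tangent to the same nonvanishing `C¹` vector field, up to
nonzero factors, agree up to a change of parameter. -/
theorem exists_reparametrization_of_tangent {F : Type*} [NormedAddCommGroup F] [NormedSpace ℝ F]
    {Y : F → F} {x y : ℝ → F} {μ ν : ℝ → ℝ} {t₀ : ℝ} (hY : ContDiffAt ℝ 1 Y (x t₀))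
    (hx : ∀ᶠ t in 𝓝 t₀, μ t ≠ 0 ∧ ContinuousAt μ t ∧ HasDerivAt x (μ t • Y (x t)) t)
    (hy : ∀ᶠ t in 𝓝 t₀, ν t ≠ 0 ∧ ContinuousAt ν t ∧ HasDerivAt y (ν t • Y (y t)) t)
    (h₀ : x t₀ = y t₀) :
    ∃ ρ κ : ℝ → ℝ, ρ t₀ = t₀ ∧
      ∀ᶠ t in 𝓝 t₀, ContinuousAt κ t ∧ HasDerivAt ρ (κ t) t ∧ x t = y (ρ t) := by
  obtain ⟨ε, hε, hball⟩ := Metric.eventually_nhds_iff_ball.mp (hx.and hy)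
  have hJ : IsOpenInterval (Metric.ball t₀ ε) :=
    ⟨Metric.isOpen_ball, (convex_ball t₀ ε).ordConnected⟩
  have ht₀ := Metric.mem_ball_self (x := t₀) hε
  obtain ⟨r₁, s₁, J₁, hJ₁, hb₁, hr₁, hm₁, hsr₁, -, hdr₁, hds₁⟩ := exists_primitive_inverse hJ
    (fun t ht ↦ (hball t ht).1.2.1.continuousWithinAt) (fun t ht ↦ (hball t ht).1.1) ht₀
  obtain ⟨r₂, s₂, J₂, hJ₂, hb₂, hr₂, hm₂, hsr₂, -, hdr₂, hds₂⟩ := exists_primitive_inverse hJ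
    (fun t ht ↦ (hball t ht).2.2.1.continuousWithinAt) (fun t ht ↦ (hball t ht).2.1) ht₀
  have h01 : (0 : ℝ) ∈ J₁ := hr₁ ▸ hm₁ ht₀
  have h02 : (0 : ℝ) ∈ J₂ := hr₂ ▸ hm₂ ht₀
  have hs₁ : s₁ 0 = t₀ := hr₁ ▸ hsr₁ t₀ ht₀
  have hs₂ : s₂ 0 = t₀ := hr₂ ▸ hsr₂ t₀ ht₀
  have hf : ∀ u ∈ J₁, HasDerivAt (x ∘ s₁) (Y ((x ∘ s₁) u)) u := by
    intro u hu
    have h1 := (hball _ (hb₁.mapsTo hu)).1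
    have h2 := HasDerivAt.scomp u h1.2.2 (hds₁ u hu)
    rwa [smul_smul, inv_mul_cancel₀ h1.1, one_smul] at h2
  have hg : ∀ u ∈ J₂, HasDerivAt (y ∘ s₂) (Y ((y ∘ s₂) u)) u := by
    intro u hu
    have h1 := (hball _ (hb₂.mapsTo hu)).2
    have h2 := HasDerivAt.scomp u h1.2.2 (hds₂ u hu)
    rwa [smul_smul, inv_mul_cancel₀ h1.1, one_smul] at h2
  obtain ⟨K, N, hN, hK⟩ := hY.exists_lipschitzOnWith
  have hfg : x ∘ s₁ =ᶠ[𝓝 0] y ∘ s₂ := by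
    refine ODE_solution_unique_of_eventually (v := fun _ ↦ Y) (s := fun _ ↦ N)
      (.of_forall fun _ ↦ hK) ?_ ?_ (by simp [hs₁, hs₂, h₀])
    · refine Filter.Eventually.and ?_ ((hf 0 h01).continuousAt.eventually (p := (· ∈ N)) ?_)
      · filter_upwards [hJ₁.1.mem_nhds h01] with u hu using hf u hu
      · rwa [Function.comp, hs₁]
    · refine Filter.Eventually.and ?_ ((hg 0 h02).continuousAt.eventually (p := (· ∈ N)) ?_)
      · filter_upwards [hJ₂.1.mem_nhds h02] with u hu using hg u hu
      · rwa [Function.comp, hs₂, ← h₀]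
  refine ⟨s₂ ∘ r₁, fun t ↦ (ν (s₂ (r₁ t)))⁻¹ * μ t, by simp [hr₁, hs₂], ?_⟩
  have hr₁c : ContinuousAt r₁ t₀ := (hdr₁ t₀ ht₀).continuousAt
  filter_upwards [Metric.ball_mem_nhds t₀ hε,
    hr₁c.eventually (p := (· ∈ J₂)) (hJ₂.1.mem_nhds (by rwa [hr₁])),
    hr₁c.eventually (p := fun u ↦ (x ∘ s₁) u = (y ∘ s₂) u) (by rwa [hr₁])] with t ht htJ hxy
  refine ⟨?_, (hds₂ _ htJ).comp t (hdr₁ t ht), ?_⟩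
  · have h1 := (hball _ (hb₂.mapsTo htJ)).2
    refine ContinuousAt.mul (ContinuousAt.inv₀ ?_ h1.1) (hball t ht).1.2.1
    exact ContinuousAt.comp (f := fun t ↦ s₂ (r₁ t)) h1.2.1
      ((hds₂ _ htJ).continuousAt.comp (hdr₁ t ht).continuousAt)
  · simpa [hsr₁ t ht] using hxy

section Lifts

variable {E : Type*} [NormedAddCommGroup E] [NormedSpace ℝ E]
  {G : Type*} [TopologicalSpace G] [ChartedSpace E G] [Group G] [LieGroup 𝓘(ℝ, E) ∞ G]
  {C : GroupLieAlgebra 𝓘(ℝ, E) G ⊗[ℝ] GroupLieAlgebra 𝓘(ℝ, E) G}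
  {α : Module.Dual ℝ (GroupLieAlgebra 𝓘(ℝ, E) G)} {H : Subgroup G}

/-- Quasi-invariance makes left translation by an element of `H` map lifts to lifts of the same
curve. -/
theorem IsLiftOn.mul_left (hinv : IsQuasiInvariant C α H) {c : ℝ → RightCosets H} {δ : ℝ → G}
    {lam : ℝ → ℝ} {I : Set ℝ} (hδ : IsLiftOn C α c δ lam I) {h : G} (hh : h ∈ H) :
    ∃ lam' : ℝ → ℝ, IsLiftOn C α c (fun s ↦ h * δ s) lam' I := by
  obtain ⟨χ, hχ0, hχ⟩ := hinv h hh
  refine ⟨fun t ↦ lam t * χ⁻¹, fun t ht ↦ ?_, hδ.continuousOn.mul_const _, fun t ht ↦ ?_⟩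
  · rw [proj_mul_of_mem hh, hδ.proj_eq t ht]
  · refine ((hδ.hasVelocityAt t ht).comp_map (mdifferentiableAt_mul_left' h (δ t))).congr
      (.of_eq rfl) ?_
    rw [map_smul, mul_smul]
    refine congrArg (fun v : E ↦ lam t • v) ?_
    exact ((congrArg (fun v : E ↦ χ⁻¹ • v) (hχ (δ t))).trans (inv_smul_smul₀ hχ0 _)).symm

variable {F : Type*} [NormedAddCommGroup F] [NormedSpace ℝ F]
  [ChartedSpace F (RightCosets H)]

/-- The projected field `Cᴸ αᴿ` at a point of the space of cosets is well defined up to a nonzero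
factor. -/
theorem IsQuasiInvariant.exists_smul_eq (hinv : IsQuasiInvariant C α H)
    (hM : IsQuotientManifold (E := E) (F := F) H) {q q' : G} (hq : proj H q = proj H q') :
    ∃ χ : ℝ, χ ≠ 0 ∧ (mfderiv 𝓘(ℝ, E) 𝓘(ℝ, F) (proj H) q' (horizontalField C α q') : F) =
      χ • (mfderiv 𝓘(ℝ, E) 𝓘(ℝ, F) (proj H) q (horizontalField C α q) : F) := by
  obtain ⟨h, hh, rfl⟩ : ∃ h ∈ H, h * q = q' :=
    ⟨q' * q⁻¹, proj_eq_proj.mp hq, inv_mul_cancel_right _ _⟩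
  obtain ⟨χ, hχ0, hχ⟩ := hinv h hh
  refine ⟨χ, hχ0, ?_⟩
  refine (congrArg (fun v : E ↦ (mfderiv 𝓘(ℝ, E) 𝓘(ℝ, F) (proj H) (h * q) v : F)) (hχ q)).trans ?_
  refine (map_smul (mfderiv 𝓘(ℝ, E) 𝓘(ℝ, F) (proj H) (h * q)) χ _).trans ?_
  exact congrArg (fun w : F ↦ χ • w) (hM.mfderiv_proj_mul_left hh q _)

/-- The curve `c` in the space of cosets is tangent at the time `t` to the projected field
`Cᴸ αᴿ`, with nonzero velocity. -/
def IsTangentAt (F : Type*) [NormedAddCommGroup F] [NormedSpace ℝ F]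
    [ChartedSpace F (RightCosets H)] (C : GroupLieAlgebra 𝓘(ℝ, E) G ⊗[ℝ] GroupLieAlgebra 𝓘(ℝ, E) G)
    (α : Module.Dual ℝ (GroupLieAlgebra 𝓘(ℝ, E) G)) (c : ℝ → RightCosets H) (t : ℝ) : Prop :=
  ∃ (q : G) (m : ℝ) (v : TangentSpace 𝓘(ℝ, F) (c t)), proj H q = c t ∧ m ≠ 0 ∧
    HasVelocityAt c t v ∧
    (v : F) = m • (mfderiv 𝓘(ℝ, E) 𝓘(ℝ, F) (proj H) q (horizontalField C α q) : F)

variable [FiniteDimensional ℝ E] [FiniteDimensional ℝ F]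

/-- In a chart of the space of cosets, the curves tangent to the projected field are tangent to
one smooth vector field: the projection of the values of `Cᴸ αᴿ` along a local section. -/
theorem IsQuotientManifold.exists_chartField (hM : IsQuotientManifold (E := E) (F := F) H)
    (hinv : IsQuasiInvariant C α H) {q₀ : G}
    (hX : mfderiv 𝓘(ℝ, E) 𝓘(ℝ, F) (proj H) q₀ (horizontalField C α q₀) ≠ 0) :
    ∃ Y : F → F, ContDiffAt ℝ 1 Y (extChartAt 𝓘(ℝ, F) (proj H q₀) (proj H q₀)) ∧
      ∀ (c : ℝ → RightCosets H) (t₀ : ℝ), c t₀ = proj H q₀ →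
        (∀ᶠ t in 𝓝 t₀, ContinuousAt (deriv (extChartAt 𝓘(ℝ, F) (proj H q₀) ∘ c)) t) →
        (∀ᶠ t in 𝓝 t₀, IsTangentAt F C α c t) →
        ∃ μ : ℝ → ℝ, ∀ᶠ t in 𝓝 t₀, μ t ≠ 0 ∧ ContinuousAt μ t ∧
          HasDerivAt (extChartAt 𝓘(ℝ, F) (proj H q₀) ∘ c)
            (μ t • Y ((extChartAt 𝓘(ℝ, F) (proj H q₀) ∘ c) t)) t := by
  have := hM.isManifold
  obtain ⟨σ, hσ, hσ0, hσπ⟩ := hM.exists_localSection q₀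
  set p₀ := proj H q₀ with hp₀
  set φ := extChartAt 𝓘(ℝ, F) p₀ with hφ
  have hsrc := mem_chart_source F p₀
  have hφ0 : φ.symm (φ p₀) = p₀ := extChartAt_to_inv p₀
  set Y : F → F := fun y ↦ orbitCoord E p₀ (φ.symm y) (bodyVelocity C α (σ (φ.symm y))) with hYdef
  have hYc : ContDiffAt ℝ 1 Y (φ p₀) := by
    have h1 : ContMDiffAt 𝓘(ℝ, F) 𝓘(ℝ, F) ∞ φ.symm (φ p₀) :=
      (contMDiffOn_extChartAt_symm p₀).contMDiffAt (extChartAt_target_mem_nhds p₀)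
    have h2 : ContMDiffAt 𝓘(ℝ, F) 𝓘(ℝ, F) ∞
        (fun p ↦ orbitCoord E p₀ p (bodyVelocity C α (σ p))) p₀ :=
      (hM.contMDiffAt_orbitCoord hsrc).clm_apply
        (ContMDiffAt.comp (I' := 𝓘(ℝ, E)) p₀ (g := bodyVelocity C α) (f := σ)
          (contMDiff_bodyVelocity C α).contMDiffAt hσ)
    have h3 : ContMDiffAt 𝓘(ℝ, F) 𝓘(ℝ, F) ∞ Y (φ p₀) :=
      ContMDiffAt.comp (I' := 𝓘(ℝ, F)) (φ p₀)
        (g := fun p ↦ orbitCoord E p₀ p (bodyVelocity C α (σ p))) (by rwa [hφ0]) h1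
    exact h3.contDiffAt.of_le (by exact_mod_cast le_top)
  have hYφ : ∀ p ∈ (chartAt F p₀).source, ∀ q, proj H q = p → σ p = q →
      Y (φ p) = chartDiff F p₀ (proj H q)
        (mfderiv 𝓘(ℝ, E) 𝓘(ℝ, F) (proj H) q (horizontalField C α q)) := by
    rintro p hp q rfl hσq
    have h1 : φ.symm (φ (proj H q)) = proj H q :=
      φ.left_inv (by rw [hφ, extChartAt_source]; exact hp)
    rw [hM.chartDiff_horizontalField hp, hYdef]
    simp only [h1, hσq]
  have hY0 : Y (φ p₀) ≠ 0 := by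
    rw [hYφ p₀ hsrc q₀ rfl hσ0]
    exact fun h ↦ hX ((bijective_chartDiff hsrc).1 (h.trans (map_zero _).symm))
  refine ⟨Y, hYc, fun c t₀ hc₀ hcont htan ↦ ?_⟩
  have hcc : ContinuousAt c t₀ := by
    obtain ⟨_, _, _, _, _, hv, _⟩ := htan.self_of_nhds
    exact hv.continuousAt
  have hcoef : ∀ᶠ t in 𝓝 t₀, ∃ m : ℝ, m ≠ 0 ∧ HasDerivAt (φ ∘ c) (m • Y ((φ ∘ c) t)) t := by
    filter_upwards [htan, hcc.eventually (p := (· ∈ (chartAt F p₀).source))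
      (by rw [hc₀]; exact (chartAt F p₀).open_source.mem_nhds hsrc),
      hcc.eventually (p := fun p ↦ proj H (σ p) = p) (by rwa [hc₀])] with t ht hts htσ
    obtain ⟨q, m, v, hq, hm, hv, hvm⟩ := ht
    obtain ⟨χ, hχ0, hχ⟩ := hinv.exists_smul_eq hM (q := σ (c t)) (q' := q) (htσ.trans hq.symm)
    refine ⟨m * χ, mul_ne_zero hm hχ0, (hv.hasDerivAt hts).congr_deriv ?_⟩
    have h2 : ∀ p, p = c t → ∀ w : F, (chartDiff F p₀ p w : F) = chartDiff F p₀ (c t) w := by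
      rintro _ rfl _
      rfl
    have h1 := (hYφ (c t) hts (σ (c t)) htσ rfl).trans (h2 _ htσ _)
    have h3 : (v : F) = (m * χ) • (mfderiv 𝓘(ℝ, E) 𝓘(ℝ, F) (proj H) (σ (c t))
        (horizontalField C α (σ (c t))) : F) :=
      hvm.trans ((congrArg (fun w : F ↦ m • w) hχ).trans (mul_smul m χ (_ : F)).symm)
    exact (congrArg (fun w : F ↦ chartDiff F p₀ (c t) w) h3).trans
      ((map_smul (chartDiff F p₀ (c t)) _ _).trans (congrArg (fun w : F ↦ (m * χ) • w) h1.symm))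
  obtain ⟨μ, hμ⟩ : ∃ μ : ℝ → ℝ, ∀ᶠ t in 𝓝 t₀, μ t ≠ 0 ∧
      HasDerivAt (φ ∘ c) (μ t • Y ((φ ∘ c) t)) t := by
    choose! μ hμ using fun (t : ℝ)
      (h : ∃ m : ℝ, m ≠ 0 ∧ HasDerivAt (φ ∘ c) (m • Y ((φ ∘ c) t)) t) ↦ h
    exact ⟨μ, hcoef.mono hμ⟩
  have hφc0 : (φ ∘ c) t₀ = φ p₀ := congrArg φ hc₀
  have hφcc : ContinuousAt (φ ∘ c) t₀ := hμ.self_of_nhds.2.continuousAt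
  have hYev : ∀ᶠ t in 𝓝 t₀, ContinuousAt Y ((φ ∘ c) t) ∧ Y ((φ ∘ c) t) ≠ 0 := by
    refine hφcc.eventually (p := fun y ↦ ContinuousAt Y y ∧ Y y ≠ 0) ?_
    rw [hφc0]
    exact ((hYc.eventually (by simp)).mono fun y hy ↦ hy.continuousAt).and
      (hYc.continuousAt.eventually_ne hY0)
  refine ⟨μ, ?_⟩
  filter_upwards [hμ.eventually_nhds, hYev, hcont] with t ht hYt hct
  refine ⟨ht.self_of_nhds.1, ?_, ht.self_of_nhds.2⟩
  exact continuousAt_coeff_of_smul (v := deriv (φ ∘ c)) (w := fun s ↦ Y ((φ ∘ c) s)) hct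
    (hYt.1.comp (f := φ ∘ c) ht.self_of_nhds.2.continuousAt) hYt.2
    (ht.mono fun s hs ↦ hs.2.deriv)

/-- Near every time, lifts exist through all the points above the curve. -/
theorem IsQuotientManifold.exists_isLiftOn_nhds (hM : IsQuotientManifold (E := E) (F := F) H)
    (hinv : IsQuasiInvariant C α H) {c : ℝ → RightCosets H} {J : Set ℝ} (hJ : IsOpen J)
    (hc : ContMDiffOn 𝓘(ℝ, ℝ) 𝓘(ℝ, F) 1 c J) (htan : ∀ t ∈ J, IsTangentAt F C α c t)
    (hX : ∀ t ∈ J, ∀ q : G, proj H q = c t →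
      mfderiv 𝓘(ℝ, E) 𝓘(ℝ, F) (proj H) q (horizontalField C α q) ≠ 0)
    {t₀ : ℝ} (ht₀ : t₀ ∈ J) :
    ∃ I : Set ℝ, IsOpenInterval I ∧ t₀ ∈ I ∧ I ⊆ J ∧ ∀ t ∈ I, ∀ q : G, proj H q = c t →
      ∃ (δ : ℝ → G) (lam : ℝ → ℝ), IsLiftOn C α c δ lam I ∧ δ t = q := by
  have := hM.isManifold
  have : CompleteSpace E := FiniteDimensional.complete ℝ E
  obtain ⟨q₀, hq₀⟩ := proj_surjective (c t₀)
  obtain ⟨Y, hY, hcoeff⟩ := hM.exists_chartField hinv (hX t₀ ht₀ q₀ hq₀)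
  set φ := extChartAt 𝓘(ℝ, F) (proj H q₀) with hφ
  have hcJ : ∀ t ∈ J, ContMDiffAt 𝓘(ℝ, ℝ) 𝓘(ℝ, F) 1 c t := fun t ht ↦
    (hc t ht).contMDiffAt (hJ.mem_nhds ht)
  have hJn : ∀ᶠ t in 𝓝 t₀, t ∈ J := hJ.mem_nhds ht₀
  have hsrcn : (chartAt F (proj H q₀)).source ∈ 𝓝 (proj H q₀) :=
    (chartAt F (proj H q₀)).open_source.mem_nhds (mem_chart_source F _)
  have hcsrc : ∀ᶠ t in 𝓝 t₀, c t ∈ (chartAt F (proj H q₀)).source :=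
    (hcJ t₀ ht₀).continuousAt.eventually (p := (· ∈ (chartAt F (proj H q₀)).source))
      (by rwa [← hq₀])
  have hderiv : ∀ {b : ℝ → RightCosets H} {t : ℝ}, ContMDiffAt 𝓘(ℝ, ℝ) 𝓘(ℝ, F) 1 b t →
      b t ∈ (chartAt F (proj H q₀)).source → ContinuousAt (deriv (φ ∘ b)) t := by
    intro b t hb hbs
    have h1 : ContDiffAt ℝ 1 (φ ∘ b) t :=
      (ContMDiffAt.comp (I' := 𝓘(ℝ, F)) t (g := φ) (contMDiffAt_extChartAt' hbs) hb).contDiffAt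
    exact (h1.fderiv_right (m := 0) (by norm_num)).continuousAt.clm_apply continuousAt_const
  obtain ⟨μ, hμ⟩ := hcoeff c t₀ hq₀.symm
    (by filter_upwards [hJn, hcsrc] with t ht hts using hderiv (hcJ t ht) hts)
    (hJn.mono htan)
  -- an integral curve through `q₀`
  obtain ⟨γ, hγ0, hγ⟩ := exists_isMIntegralCurveAt_of_contMDiffAt_boundaryless t₀
    (contMDiffAt_section_of_chartDiff
      (contMDiffAt_chartDiff_horizontalField C α q₀ q₀ (mem_chart_source E q₀)))
  obtain ⟨ε, hε, hγε⟩ := isMIntegralCurveAt_iff'.mp hγ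
  have hγv : ∀ t ∈ Metric.ball t₀ ε, HasVelocityAt γ t (horizontalField C α (γ t)) :=
    fun t ht ↦ hγε.hasVelocityAt Metric.isOpen_ball ht
  have hγc : ∀ t ∈ Metric.ball t₀ ε, ContMDiffAt 𝓘(ℝ, ℝ) 𝓘(ℝ, F) 1 (proj H ∘ γ) t := fun t ht ↦
    ((hM.contMDiff_proj.comp_contMDiffOn (contMDiffOn_of_hasVelocityAt
      (contMDiffAt_chartDiff_horizontalField C α) Metric.isOpen_ball hγv)).contMDiffAt
      (Metric.isOpen_ball.mem_nhds ht)).of_le (by exact_mod_cast le_top)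
  have hγn : ∀ᶠ t in 𝓝 t₀, t ∈ Metric.ball t₀ ε := Metric.ball_mem_nhds t₀ hε
  have hγ₀ : (proj H ∘ γ) t₀ = proj H q₀ := congrArg (proj H) hγ0
  have hγsrc : ∀ᶠ t in 𝓝 t₀, (proj H ∘ γ) t ∈ (chartAt F (proj H q₀)).source :=
    (hγc t₀ (Metric.mem_ball_self hε)).continuousAt.eventually
      (p := (· ∈ (chartAt F (proj H q₀)).source)) (by rwa [hγ₀])
  obtain ⟨ν, hν⟩ := hcoeff (proj H ∘ γ) t₀ hγ₀
    (by filter_upwards [hγn, hγsrc] with t ht hts using hderiv (hγc t ht) hts)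
    (by
      filter_upwards [hγn] with t ht
      exact ⟨γ t, 1, _, rfl, one_ne_zero,
        (hγv t ht).comp_map (hM.mdifferentiableAt_proj (γ t)), (one_smul ℝ (_ : F)).symm⟩)
  have hφc : (φ ∘ c) t₀ = φ (proj H q₀) := congrArg φ hq₀.symm
  obtain ⟨ρ, κ, hρ0, hρ⟩ := exists_reparametrization_of_tangent (by rwa [hφc]) hμ hν
    (hφc.trans (congrArg φ hγ₀).symm)
  have hρc : Filter.Tendsto ρ (𝓝 t₀) (𝓝 t₀) := by
    have h1 : ContinuousAt ρ t₀ := hρ.self_of_nhds.2.1.continuousAt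
    rwa [ContinuousAt, hρ0] at h1
  have hev := hρ.and ((hρc.eventually (hγn.and hγsrc)).and (hcsrc.and hJn))
  obtain ⟨r, hr, hball⟩ := Metric.eventually_nhds_iff_ball.mp hev
  have hlift : IsLiftOn C α c (γ ∘ ρ) κ (Metric.ball t₀ r) := by
    refine ⟨fun t ht ↦ ?_, fun t ht ↦ (hball t ht).1.1.continuousWithinAt, fun t ht ↦ ?_⟩
    · obtain ⟨⟨-, -, h1⟩, ⟨-, h2⟩, h3, -⟩ := hball t ht
      refine φ.injOn ?_ ?_ h1.symm
      · rw [hφ, extChartAt_source]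
        exact h2
      · rwa [hφ, extChartAt_source]
    · obtain ⟨⟨-, h1, -⟩, ⟨h2, -⟩, -⟩ := hball t ht
      exact (hγv _ h2).comp_param h1
  -- one lift over the ball gives all the others by left translation by elements of `H`
  refine ⟨Metric.ball t₀ r, ⟨Metric.isOpen_ball, (convex_ball t₀ r).ordConnected⟩,
    Metric.mem_ball_self hr, fun t ht ↦ (hball t ht).2.2.2, fun t ht q hq ↦ ?_⟩
  obtain ⟨lam, hlam⟩ := hlift.mul_left hinv
    (proj_eq_proj.mp ((hlift.proj_eq t ht).trans hq.symm))
  exact ⟨_, lam, hlam, inv_mul_cancel_right _ _⟩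

/-- A curve tangent to the projected field has a lift over its whole interval of definition through
every point above it: the neighbourhoods over which lifts through all the points exist do not
depend on the point, so lifts never cease to exist at an inner time. -/
theorem IsQuotientManifold.exists_isLiftOn (hM : IsQuotientManifold (E := E) (F := F) H)
    (hinv : IsQuasiInvariant C α H) {c : ℝ → RightCosets H} {J : Set ℝ} (hJ : IsOpenInterval J)
    (hc : ContMDiffOn 𝓘(ℝ, ℝ) 𝓘(ℝ, F) 1 c J) (htan : ∀ t ∈ J, IsTangentAt F C α c t)
    (hX : ∀ t ∈ J, ∀ q : G, proj H q = c t →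
      mfderiv 𝓘(ℝ, E) 𝓘(ℝ, F) (proj H) q (horizontalField C α q) ≠ 0)
    {t₀ : ℝ} (ht₀ : t₀ ∈ J) {q : G} (hq : proj H q = c t₀) :
    ∃ (δ : ℝ → G) (lam : ℝ → ℝ), IsLiftOn C α c δ lam J ∧ δ t₀ = q := by
  have hloc := fun t (ht : t ∈ J) ↦ hM.exists_isLiftOn_nhds hinv hJ.1 hc htan hX ht
  have hex : ∀ t ∈ J, ∃ (I : Set ℝ) (δ : ℝ → G) (lam : ℝ → ℝ), IsOpenInterval I ∧ t₀ ∈ I ∧ t ∈ I ∧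
      I ⊆ J ∧ IsLiftOn C α c δ lam I ∧ δ t₀ = q := by
    refine hJ.2.isPreconnected.forall_of_eventually_iff (fun t ht ↦ ?_) ht₀ ?_
    · obtain ⟨U, hU, htU, hUJ, hUlift⟩ := hloc t ht
      -- a lift that reaches one point of `U` can be prolonged over `U`
      have hprolong : ∀ s ∈ U, ∀ s' ∈ U,
          (∃ (I : Set ℝ) (δ : ℝ → G) (lam : ℝ → ℝ), IsOpenInterval I ∧ t₀ ∈ I ∧ s ∈ I ∧
            I ⊆ J ∧ IsLiftOn C α c δ lam I ∧ δ t₀ = q) →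
          ∃ (I : Set ℝ) (δ : ℝ → G) (lam : ℝ → ℝ), IsOpenInterval I ∧ t₀ ∈ I ∧ s' ∈ I ∧
            I ⊆ J ∧ IsLiftOn C α c δ lam I ∧ δ t₀ = q := by
        rintro s hs s' hs' ⟨I, δ, lam, hI, ht₀I, hsI, hIJ, hδ, hδq⟩
        obtain ⟨δ', lam', hδ', hδs⟩ := hUlift s hs (δ s) (hδ.proj_eq s hsI)
        obtain ⟨δ'', lam'', hlift, heq⟩ := IsLiftOn.exists_iUnion hM hinv (ι := Bool)
          (I := fun b ↦ cond b I U) (δ := fun b ↦ cond b δ δ') (lam := fun b ↦ cond b lam lam')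
          (c := c) (t₁ := s) (by rintro (_ | _) <;> assumption)
          (by rintro (_ | _) t ht <;> [exact hX t (hUJ ht); exact hX t (hIJ ht)])
          (by rintro (_ | _) <;> assumption) (by rintro (_ | _) <;> assumption)
          (by rintro (_ | _) (_ | _) <;> simp [hδs])
        rw [← Set.union_eq_iUnion] at hlift
        refine ⟨I ∪ U, δ'', lam'', ⟨hI.1.union hU.1, ?_⟩, Or.inl ht₀I, Or.inr hs',
          Set.union_subset hIJ hUJ, hlift, (heq true ht₀I).trans hδq⟩
        exact (hI.2.isPreconnected.union s hsI hs hU.2.isPreconnected).ordConnected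
      filter_upwards [hU.1.mem_nhds htU] with s hs
      exact ⟨hprolong s hs t htU, hprolong t htU s hs⟩
    · obtain ⟨U, hU, htU, hUJ, hUlift⟩ := hloc t₀ ht₀
      obtain ⟨δ, lam, hδ, hδq⟩ := hUlift t₀ htU q hq
      exact ⟨U, δ, lam, hU, htU, htU, hUJ, hδ, hδq⟩
  choose I δ lam hI ht₀I htI hIJ hδ hδq using fun t : J ↦ hex t t.2
  obtain ⟨δ', lam', hlift, heq⟩ := IsLiftOn.exists_iUnion hM hinv hI
    (fun i t ht ↦ hX t (hIJ i ht)) hδ ht₀I fun i j ↦ (hδq i).trans (hδq j).symm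
  refine ⟨δ', lam', hlift.mono fun t ht ↦ Set.mem_iUnion.mpr ⟨⟨t, ht⟩, htI _⟩, ?_⟩
  exact (heq ⟨t₀, ht₀⟩ (ht₀I _)).trans (hδq _)

end Lifts

/-! ### Integral curves of the perpendicular distribution -/

theorem IsGeodesicOn.congr {E : Type*} [NormedAddCommGroup E] [NormedSpace ℝ E]
    {G : Type*} [TopologicalSpace G] [ChartedSpace E G] [Group G] {H : Subgroup G}
    {F : Type*} [NormedAddCommGroup F] [NormedSpace ℝ F] [ChartedSpace F (RightCosets H)]
    {C : GroupLieAlgebra 𝓘(ℝ, E) G ⊗[ℝ] GroupLieAlgebra 𝓘(ℝ, E) G}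
    {c c' : ℝ → RightCosets H} {J : Set ℝ}
    (hc : IsGeodesicOn (F := F) C c J) (hJ : IsOpen J) (h : Set.EqOn c' c J) :
    IsGeodesicOn (F := F) C c' J where
  mapsTo := hc.mapsTo.congr h.symm
  contMDiffOn := hc.contMDiffOn.congr h
  equation t ht p₀ hp x hx w := by
    have h1 : x =ᶠ[𝓝 t] extChartAt 𝓘(ℝ, F) p₀ ∘ c := by
      filter_upwards [hJ.mem_nhds ht] with τ hτ
      rw [hx, Function.comp, Function.comp, h hτ]
    rw [h1.deriv.deriv_eq, h1.deriv_eq, h1.self_of_nhds]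
    exact hc.equation t ht p₀ (h ht ▸ hp) _ rfl w

section IntegralCurves

variable {E : Type*} [NormedAddCommGroup E] [NormedSpace ℝ E]
  {G : Type*} [TopologicalSpace G] [ChartedSpace E G] [Group G] [LieGroup 𝓘(ℝ, E) ∞ G]
  {H : Subgroup G} {F : Type*} [NormedAddCommGroup F] [NormedSpace ℝ F]
  [FiniteDimensional ℝ F] [ChartedSpace F (RightCosets H)]
  {C : GroupLieAlgebra 𝓘(ℝ, E) G ⊗[ℝ] GroupLieAlgebra 𝓘(ℝ, E) G}
  {𝔣 : Submodule ℝ (GroupLieAlgebra 𝓘(ℝ, E) G)}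
  {α : Module.Dual ℝ (GroupLieAlgebra 𝓘(ℝ, E) G)}

/-- Where `Λ^⊥` is a line, it is spanned by the projection of `Cᴸ αᴿ`. -/
theorem IsQuotientManifold.exists_eq_smul_of_mem_perpDistribution
    (hM : IsQuotientManifold (E := E) (F := F) H) (h𝔣 : IsProjectable F H 𝔣)
    (h𝔥𝔣 : isotropyAlgebra F H ≤ 𝔣) (hα : ∀ a ∈ 𝔣, α a = 0) (hα0 : α ≠ 0) {q : G}
    {p : RightCosets H} (hq : proj H q = p) (hp : p ∈ nondegenerateLocus F H C)
    (hrank : Module.finrank ℝ (perpDistribution (F := F) C 𝔣 p) = 1)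
    {v : TangentSpace 𝓘(ℝ, F) p} (hv : v ∈ perpDistribution C 𝔣 p) (hv0 : v ≠ 0) :
    ∃ m : ℝ, m ≠ 0 ∧
      (v : F) = m • (mfderiv 𝓘(ℝ, E) 𝓘(ℝ, F) (proj H) q (horizontalField C α q) : F) := by
  subst hq
  have hn := hM.mfderiv_proj_horizontalField_ne_zero (fun a ha ↦ hα a (h𝔥𝔣 ha)) hα0 hp
  obtain ⟨m, hm⟩ := (finrank_eq_one_iff_of_nonzero' (⟨_,
    hM.mfderiv_proj_horizontalField_mem h𝔣 h𝔥𝔣 hα hp⟩ : perpDistribution (F := F) C 𝔣 (proj H q))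
    (fun h ↦ hn (congrArg Subtype.val h))).mp hrank ⟨v, hv⟩
  have hm' : m • mfderiv 𝓘(ℝ, E) 𝓘(ℝ, F) (proj H) q (horizontalField C α q) = v :=
    congrArg Subtype.val hm
  refine ⟨m, ?_, hm'.symm⟩
  rintro rfl
  rw [zero_smul] at hm'
  exact hv0 hm'.symm

variable [FiniteDimensional ℝ E]

/-- The integral curves of `Λ^⊥` are, up to a change of parameter, the projections of the
integral curves of `Cᴸ αᴿ`. -/
theorem IsQuotientManifold.exists_integralCurve_lift
    (hM : IsQuotientManifold (E := E) (F := F) H) (h𝔣 : IsProjectable F H 𝔣)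
    (h𝔥𝔣 : isotropyAlgebra F H ≤ 𝔣) (hα : ∀ a ∈ 𝔣, α a = 0) (hα0 : α ≠ 0)
    (hrank : ∀ p ∈ nondegenerateLocus F H C,
      Module.finrank ℝ (perpDistribution (F := F) C 𝔣 p) = 1)
    {J : Set ℝ} {c : ℝ → RightCosets H} (hJ : IsOpenInterval J)
    (hc : IsIntegralCurvePerp (F := F) C 𝔣 c J) {t₀ : ℝ} (ht₀ : t₀ ∈ J) {q : G}
    (hq : proj H q = c t₀) :
    ∃ (J' : Set ℝ) (s : ℝ → ℝ) (γ : ℝ → G), IsReparametrization s J' J ∧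
      IsMIntegralCurveOn γ (horizontalField C α) J' ∧ (∃ t ∈ J', s t = t₀ ∧ γ t = q) ∧
      ∀ t ∈ J', proj H (γ t) = c (s t) := by
  have hinv : IsQuasiInvariant C α H := fun h hh ↦
    hM.exists_horizontalField_mul h𝔣 h𝔥𝔣 hα hα0 hh (hq ▸ hc.mapsTo ht₀)
      (hrank _ (hq ▸ hc.mapsTo ht₀))
  have hvel : ∀ t ∈ J, HasVelocityAt c t (mfderiv 𝓘(ℝ, ℝ) 𝓘(ℝ, F) c t (1 : ℝ)) := fun t ht ↦
    MDifferentiableAt.hasVelocityAt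
      (((hc.contMDiffOn t ht).contMDiffAt (hJ.1.mem_nhds ht)).mdifferentiableAt (by simp))
  have htan : ∀ t ∈ J, IsTangentAt F C α c t := by
    intro t ht
    obtain ⟨q', hq'⟩ := proj_surjective (c t)
    obtain ⟨m, hm, hvm⟩ := hM.exists_eq_smul_of_mem_perpDistribution h𝔣 h𝔥𝔣 hα hα0 hq'
      (hc.mapsTo ht) (hrank _ (hc.mapsTo ht)) (hc.velocity_mem t ht) (hc.velocity_ne_zero t ht)
    exact ⟨q', m, _, hq', hm, hvel t ht, hvm⟩
  obtain ⟨δ, lam, hδ, hδq⟩ := hM.exists_isLiftOn hinv hJ hc.contMDiffOn htan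
    (fun t ht q' hq' ↦ hM.mfderiv_proj_horizontalField_ne_zero
      (fun a ha ↦ hα a (h𝔥𝔣 ha)) hα0 (hq' ▸ hc.mapsTo ht)) ht₀ hq
  have hlam : ∀ t ∈ J, lam t ≠ 0 := by
    intro t ht h0
    refine hc.velocity_ne_zero t ht ?_
    have h1 := (hδ.hasVelocityAt t ht).comp_map (hM.mdifferentiableAt_proj (δ t))
    have h2 : c =ᶠ[𝓝 t] proj H ∘ δ := by
      filter_upwards [hJ.1.mem_nhds ht] with s hs using (hδ.proj_eq s hs).symm
    refine (hvel t ht).unique (h1.congr h2 ?_)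
    rw [h0, zero_smul, map_zero]
    rfl
  obtain ⟨r, s, J', hJ', hs, -, hr, hsr, -, -, hds⟩ :=
    exists_primitive_inverse hJ hδ.continuousOn hlam ht₀
  refine ⟨J', s, δ ∘ s, ⟨hJ', hs, ?_, fun u hu ↦ ?_⟩, fun u hu ↦ ?_,
    ⟨r t₀, hr ht₀, hsr t₀ ht₀, by rw [Function.comp, hsr t₀ ht₀, hδq]⟩,
    fun u hu ↦ hδ.proj_eq _ (hs.mapsTo hu)⟩
  · have hsd : DifferentiableOn ℝ s J' := fun u hu ↦
      (hds u hu).differentiableAt.differentiableWithinAt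
    have h1 : ContDiffOn ℝ (0 + 1) s J' := by
      rw [contDiffOn_succ_iff_deriv_of_isOpen hJ'.1]
      refine ⟨hsd, by simp, contDiffOn_zero.mpr ?_⟩
      have h2 : ContinuousOn (fun u ↦ (lam (s u))⁻¹) J' :=
        (hδ.continuousOn.comp hsd.continuousOn hs.mapsTo).inv₀ fun u hu ↦ hlam _ (hs.mapsTo hu)
      exact h2.congr fun u hu ↦ (hds u hu).deriv
    simpa using h1
  · rw [(hds u hu).deriv]
    exact inv_ne_zero (hlam _ (hs.mapsTo hu))
  · have h1 := (hδ.hasVelocityAt (s u) (hs.mapsTo hu)).comp_param (hds u hu)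
    rw [smul_smul, inv_mul_cancel₀ (hlam _ (hs.mapsTo hu)), one_smul] at h1
    exact HasMFDerivAt.hasMFDerivWithinAt h1

/-- Where `Λ^⊥` has rank one, its integral curves are geodesics up to a change of parameter. -/
theorem IsQuotientManifold.exists_isGeodesicOn_comp
    (hM : IsQuotientManifold (E := E) (F := F) H) (hC : TensorProduct.comm ℝ _ _ C = C)
    (h𝔣p : IsProjectable F H 𝔣) (h𝔥𝔣 : isotropyAlgebra F H ≤ 𝔣) (h𝔣 : 𝔣 < ⊤)
    (hrank : ∀ p ∈ nondegenerateLocus F H C,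
      Module.finrank ℝ (perpDistribution (F := F) C 𝔣 p) = 1)
    {J : Set ℝ} {c : ℝ → RightCosets H} (hJ : IsOpenInterval J)
    (hc : IsIntegralCurvePerp (F := F) C 𝔣 c J) :
    ∃ (J' : Set ℝ) (s : ℝ → ℝ), IsReparametrization s J' J ∧
      IsGeodesicOn (F := F) C (c ∘ s) J' := by
  obtain rfl | ⟨t₀, ht₀⟩ := J.eq_empty_or_nonempty
  · refine ⟨∅, id, ⟨hJ, Set.bijOn_empty _, contDiffOn_id, by simp⟩, ?_, ?_, by simp⟩
    · exact Set.mapsTo_empty _ _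
    · exact fun t ht ↦ absurd ht (Set.notMem_empty t)
  -- the curve can be lifted with respect to any nonzero functional that vanishes on `𝔣`
  · obtain ⟨α, hα0, hα⟩ := Submodule.exists_le_ker_of_lt_top 𝔣 h𝔣
    have hα' : ∀ a ∈ 𝔣, α a = 0 := fun a ha ↦ hα ha
    obtain ⟨q, hq⟩ := proj_surjective (c t₀)
    obtain ⟨J', s, γ, hs, hγ, -, hγc⟩ :=
      hM.exists_integralCurve_lift h𝔣p h𝔥𝔣 hα' hα0 hrank hJ hc ht₀ hq
    refine ⟨J', s, hs, IsGeodesicOn.congr ?_ hs.isOpenInterval.1 fun t ht ↦ (hγc t ht).symm⟩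
    refine hM.isGeodesicOn_proj hC (fun a ha ↦ hα' a (h𝔥𝔣 ha)) hs.isOpenInterval.1 hγ fun t ht ↦ ?_
    rw [Function.comp, hγc t ht]
    exact hc.mapsTo (hs.bijOn.mapsTo ht)

end IntegralCurves

end LieAlgebraicMetric

theorem mainTheorem5
    {E : Type*} [NormedAddCommGroup E] [NormedSpace ℝ E] [FiniteDimensional ℝ E]
    [CompleteSpace E]
    {G : Type*} [TopologicalSpace G] [ChartedSpace E G] [Group G] [LieGroup 𝓘(ℝ, E) ∞ G]
    (H : Subgroup G) (hH : IsClosed (H : Set G))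
    {F : Type*} [NormedAddCommGroup F] [NormedSpace ℝ F] [FiniteDimensional ℝ F]
    [ChartedSpace F (RightCosets H)] (hM : IsQuotientManifold (E := E) (F := F) H)
    (C : GroupLieAlgebra 𝓘(ℝ, E) G ⊗[ℝ] GroupLieAlgebra 𝓘(ℝ, E) G)
    (hC : TensorProduct.comm ℝ _ _ C = C)
    (𝔣 : LieSubalgebra ℝ (GroupLieAlgebra 𝓘(ℝ, E) G))
    (h𝔥𝔣 : isotropyAlgebra F H < 𝔣.toSubmodule) (h𝔣 : 𝔣.toSubmodule < ⊤)
    (hΛ : IsConnected (H : Set G) ∨ IsProjectable F H 𝔣.toSubmodule) :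
    -- if `dim M = 2`, then `Λ^⊥` has rank 1
    (Module.finrank ℝ F = 2 → ∀ p ∈ nondegenerateLocus F H C,
      Module.finrank ℝ (perpDistribution (F := F) C 𝔣.toSubmodule p) = 1) ∧
    -- if `Λ^⊥` has rank 1
    ((∀ p ∈ nondegenerateLocus F H C,
        Module.finrank ℝ (perpDistribution (F := F) C 𝔣.toSubmodule p) = 1) →
      -- its integral curves are geodesics, up to a change of parameter
      (∀ (J : Set ℝ) (c : ℝ → RightCosets H), IsOpenInterval J →
        IsIntegralCurvePerp (F := F) C 𝔣.toSubmodule c J →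
        ∃ (J' : Set ℝ) (s : ℝ → ℝ), IsReparametrization s J' J ∧
          IsGeodesicOn (F := F) C (c ∘ s) J') ∧
      -- for every nonzero annihilator `α` of `𝔣`
      (∀ α : Module.Dual ℝ (GroupLieAlgebra 𝓘(ℝ, E) G), α ≠ 0 → (∀ a ∈ 𝔣, α a = 0) →
        -- the integral curves of `Cᴸ αᴿ` over `M₀` project to geodesics that are
        -- integral curves of `Λ^⊥`
        (∀ (J : Set ℝ) (γ : ℝ → G), IsOpenInterval J →
          IsMIntegralCurveOn γ (horizontalField C α) J →
          Set.MapsTo (proj H ∘ γ) J (nondegenerateLocus F H C) →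
          IsGeodesicOn (F := F) C (proj H ∘ γ) J ∧
            IsIntegralCurvePerp (F := F) C 𝔣.toSubmodule (proj H ∘ γ) J) ∧
        -- and every integral curve of `Λ^⊥` is obtained so, up to a change of parameter,
        -- from an integral curve of `Cᴸ αᴿ` through any given point above it
        (∀ (J : Set ℝ) (c : ℝ → RightCosets H), IsOpenInterval J →
          IsIntegralCurvePerp (F := F) C 𝔣.toSubmodule c J →
          ∀ t₀ ∈ J, ∀ q : G, proj H q = c t₀ →
          ∃ (J' : Set ℝ) (s : ℝ → ℝ) (γ : ℝ → G), IsReparametrization s J' J ∧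
            IsMIntegralCurveOn γ (horizontalField C α) J' ∧
            (∃ t ∈ J', s t = t₀ ∧ γ t = q) ∧
            ∀ t ∈ J', proj H (γ t) = c (s t)))) := by
  have hproj : IsProjectable F H 𝔣.toSubmodule :=
    hΛ.elim (fun hconn ↦ hM.isProjectable_of_isConnected hconn h𝔥𝔣.le) id
  refine ⟨fun hF p hp ↦ hM.finrank_perpDistribution_of_finrank_eq_two hproj h𝔥𝔣 h𝔣 hF hp,
    fun hrank ↦ ⟨fun J c hJ hc ↦ hM.exists_isGeodesicOn_comp hC hproj h𝔥𝔣.le h𝔣 hrank hJ hc,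
      fun α hα0 hα ↦ ⟨fun J γ hJ hγ hγJ ↦ ⟨?_, ?_⟩, fun J c hJ hc t₀ ht₀ q hq ↦ ?_⟩⟩⟩
  · exact hM.isGeodesicOn_proj hC (fun a ha ↦ hα a (h𝔥𝔣.le ha)) hJ.1 hγ hγJ
  · exact hM.isIntegralCurvePerp_proj hproj h𝔥𝔣.le hα hα0 hJ.1 hγ hγJ
  · exact hM.exists_integralCurve_lift hproj h𝔥𝔣.le hα hα0 hrank hJ hc ht₀ hq
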